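/- Let $d\in\mathbb N$, let $\Theta\in M_d(\mathbb R)$ be an invertible skew-symmetric matrix (so $d$ is even), and let $\tilde\Omega>0$. Put $\mathcal H=L^2(\mathbb R^d)\otimes\bigwedge(\mathbb C^d)$, let $b_\mu,b_\mu^*$ ($\mu=1,\dots,d$) be the fermionic annihilation and creation operators on $\bigwedge(\mathbb C^d)$, so that $\{b_\mu,b_\nu\}=0$ and $\{b_\mu,b_\nu^*\}=\delta_{\mu\nu}$, and let $a_\mu=\partial_\mu+\tilde\Omega x_\mu$, $a_\mu^*=-\partial_\mu+\tilde\Omega x_\mu$. Let $\mathcal D_1$ and $\mathcal D_2$ be the closures in $\mathcal H$ of the operators $$\sum_\mu\big(a_\mu\otimes b_\mu^*+a_\mu^*\otimes b_\mu\big)\qquad\text{and}\qquad \sum_\mu\big(i\,a_\mu\otimes b_\mu-i\,a_\mu^*\otimes b_\mu^*\big)$$ defined on $\mathcal S(\mathbb R^d)\otimes\bigwedge(\mathbb C^d)$. Let $\mathcal B_\star$ be the space of smooth functions $f:\mathbb R^d\to\mathbb C$ that are bounded together with all their partial derivatives, and for $f\in\mathcal B_\star$ and $\psi\in\mathcal S(\mathbb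 R^d)\otimes\bigwedge(\mathbb C^d)$ let $$(f\star\psi)(x)=\frac1{(2\pi)^d}\int_{\mathbb R^d}dk\,f\big(x+\tfrac12\Theta k\big)\int_{\mathbb R^d}dy\,\psi(x+y)\,e^{i\langle k,y\rangle}.$$ Then for every $f\in\mathcal B_\star$ the map $\psi\mapsto f\star\psi$ extends to a bounded operator $L_\star(f)$ on $\mathcal H$, and for $\bullet=1,2$ the following hold. The operator $\mathcal D_\bullet$ is self-adjoint; there is exactly one nonnegative self-adjoint operator $\langle\mathcal D_\bullet\rangle=(\mathcal D_\bullet^2+1)^{1/2}$ with $\langle\mathcal D_\bullet\rangle^2=\mathcal D_\bullet^2+1$ (with equality of domains); $L_\star(f)$ maps $\mathrm{dom}\,\mathcal D_\bullet$ into itself, and $[\mathcal D_\bullet,L_\star(f)]$, defined on $\mathrm{dom}\,\mathcal D_\bullet$, extends to a bounded operator on $\mathcal H$, denoted by the same symbol; and both $L_\star(f)$ and $[\mathcal D_\bullet,L_\star(f)]$ belong to $\bigcap_{n\ge1}\mathrm{dom}\,\delta_\bullet^n$. Here $\delta_\bullet(T)=[\langle\mathcal D_\bullet\rangle,T]$,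 the domain $\mathrm{dom}\,\delta_\bullet$ is the set of bounded operators $T$ on $\mathcal H$ that map $\mathrm{dom}\,\langle\mathcal D_\bullet\rangle$ into itself and for which $[\langle\mathcal D_\bullet\rangle,T]$ extends to a bounded operator $\delta_\bullet(T)$, and $T\in\mathrm{dom}\,\delta_\bullet^{n+1}$ means that $T\in\mathrm{dom}\,\delta_\bullet$ and $\delta_\bullet(T)\in\mathrm{dom}\,\delta_\bullet^{n}$. -/

import Mathlib

open scoped ContDiff SchwartzMap

noncomputable section

namespace MoyalOscillator

open MeasureTheory

/-! ### The Hilbert space `L²(ℝᵈ) ⊗ ⋀(ℂᵈ)` -/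

/-- The Euclidean space `ℝᵈ`. -/
abbrev Pt (d : ℕ) : Type := EuclideanSpace ℝ (Fin d)

/-- The exterior algebra `⋀(ℂᵈ)` with its standard inner product, in coordinates with respect to
the orthonormal basis `e_I = e_{i₁} ∧ ⋯ ∧ e_{iₖ}`, `I = {i₁ < ⋯ < iₖ} ⊆ {1, …, d}`. -/
abbrev Fock (d : ℕ) : Type := EuclideanSpace ℂ (Finset (Fin d))

/-- `L²(ℝᵈ) ⊗ ⋀(ℂᵈ)`, realised as the space of square integrable `⋀(ℂᵈ)`-valued functions. -/
abbrev Hilb (d : ℕ) : Type := Lp (Fock d) 2 (volume : Measure (Pt d))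

/-- Schwartz functions with values in `⋀(ℂᵈ)`. -/
abbrev Spinor (d : ℕ) : Type := 𝓢(Pt d, Fock d)

/-! ### Fermionic operators -/

/-- The sign `(-1)^{#{ν ∈ J : ν < μ}}`. -/
def fermiSign {d : ℕ} (μ : Fin d) (J : Finset (Fin d)) : ℂ :=
  (-1) ^ (J.filter (· < μ)).card

/-- The annihilation operator `b_μ` on `⋀(ℂᵈ)` (contraction with the `μ`-th basis vector):
`b_μ e_I = ± e_{I ∖ {μ}}` if `μ ∈ I`, and `b_μ e_I = 0` otherwise. -/
def annih {d : ℕ} (μ : Fin d) : Fock d →L[ℂ] Fock d :=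
  LinearMap.toContinuousLinearMap
    { toFun := fun v => WithLp.toLp 2 fun J =>
        if μ ∈ J then 0 else fermiSign μ J * v (insert μ J)
      map_add' := by
        intro v w
        ext J
        by_cases h : μ ∈ J <;> simp [h, mul_add]
      map_smul' := by
        intro c v
        ext J
        by_cases h : μ ∈ J <;> simp [h, mul_left_comm] }

/-- The creation operator `b_μ^*` on `⋀(ℂᵈ)` (exterior multiplication by the `μ`-th basis vector):
`b_μ^* e_I = ± e_{I ∪ {μ}}` if `μ ∉ I`, and `b_μ^* e_I = 0` otherwise. -/
def creat {d : ℕ} (μ : Fin d) : Fock d →L[ℂ] Fock d :=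
  LinearMap.toContinuousLinearMap
    { toFun := fun v => WithLp.toLp 2 fun J =>
        if μ ∈ J then fermiSign μ J * v (J.erase μ) else 0
      map_add' := by
        intro v w
        ext J
        by_cases h : μ ∈ J <;> simp [h, mul_add]
      map_smul' := by
        intro c v
        ext J
        by_cases h : μ ∈ J <;> simp [h, mul_left_comm] }

/-! ### Bosonic operators on Schwartz functions -/

/-- The partial derivative `∂_μ`. -/
def partialOp {d : ℕ} (μ : Fin d) : Spinor d →L[ℂ] Spinor d :=
  LineDeriv.lineDerivOpCLM ℂ (Spinor d) (EuclideanSpace.single μ (1 : ℝ))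

/-- Multiplication by the coordinate `x_μ`. -/
def positionOp {d : ℕ} (μ : Fin d) : Spinor d →L[ℂ] Spinor d :=
  SchwartzMap.smulLeftCLM (Fock d) (fun x : Pt d => ((x μ : ℝ) : ℂ))

/-- The operator `1 ⊗ B` for an operator `B` on `⋀(ℂᵈ)`. -/
def fiberOp {d : ℕ} (B : Fock d →L[ℂ] Fock d) : Spinor d →L[ℂ] Spinor d :=
  SchwartzMap.postcompCLM B

/-- `a_μ = ∂_μ + Ω x_μ`. -/
def bosonA {d : ℕ} (Ω : ℝ) (μ : Fin d) : Spinor d →L[ℂ] Spinor d :=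
  partialOp μ + (Ω : ℂ) • positionOp μ

/-- `a_μ^* = -∂_μ + Ω x_μ`. -/
def bosonAStar {d : ℕ} (Ω : ℝ) (μ : Fin d) : Spinor d →L[ℂ] Spinor d :=
  -partialOp μ + (Ω : ℂ) • positionOp μ

/-! ### The Dirac operators -/

/-- The operator `𝔔₁ + 𝔔₁^*` on Schwartz functions, where `𝔔₁ = ∑_μ a_μ ⊗ b_μ^*`. -/
def diracCore₁ {d : ℕ} (Ω : ℝ) : Spinor d →L[ℂ] Spinor d :=
  (∑ μ, bosonA Ω μ ∘L fiberOp (creat μ)) + ∑ μ, bosonAStar Ω μ ∘L fiberOp (annih μ)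

/-- The operator `i 𝔔₂ - i 𝔔₂^*` on Schwartz functions, where `𝔔₂ = ∑_μ a_μ ⊗ b_μ`. -/
def diracCore₂ {d : ℕ} (Ω : ℝ) : Spinor d →L[ℂ] Spinor d :=
  Complex.I • (∑ μ, bosonA Ω μ ∘L fiberOp (annih μ)) -
    Complex.I • ∑ μ, bosonAStar Ω μ ∘L fiberOp (creat μ)

/-- An operator on Schwartz functions, regarded as a densely defined operator on the Hilbert
space whose domain is the (image in `L²` of the) Schwartz space. -/
def ofCore {d : ℕ} (D : Spinor d →L[ℂ] Spinor d) : Hilb d →ₗ.[ℂ] Hilb d where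
  domain := LinearMap.range (SchwartzMap.toLpCLM ℂ (Fock d) 2 (volume : Measure (Pt d))).toLinearMap
  toFun := (SchwartzMap.toLpCLM ℂ (Fock d) 2 (volume : Measure (Pt d))).toLinearMap ∘ₗ
    D.toLinearMap ∘ₗ
    (LinearEquiv.ofInjective (SchwartzMap.toLpCLM ℂ (Fock d) 2 (volume : Measure (Pt d))).toLinearMap
      (SchwartzMap.injective_toLp 2 (volume : Measure (Pt d)))).symm.toLinearMap

/-- The Dirac operator `𝒟₁`: the closure of `𝔔₁ + 𝔔₁^*` defined on Schwartz functions. -/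
def dirac₁ {d : ℕ} (Ω : ℝ) : Hilb d →ₗ.[ℂ] Hilb d := (ofCore (diracCore₁ Ω)).closure

/-- The Dirac operator `𝒟₂`: the closure of `i 𝔔₂ - i 𝔔₂^*` defined on Schwartz functions. -/
def dirac₂ {d : ℕ} (Ω : ℝ) : Hilb d →ₗ.[ℂ] Hilb d := (ofCore (diracCore₂ Ω)).closure

/-! ### Left Moyal multiplication -/

/-- The space `ℬ_⋆` of smooth bounded functions all of whose derivatives are bounded. -/
def IsSmoothBounded {d : ℕ} (f : Pt d → ℂ) : Prop :=
  ContDiff ℝ ∞ f ∧ ∀ n : ℕ, ∃ C : ℝ, ∀ x, ‖iteratedFDeriv ℝ n f x‖ ≤ C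

/-- The Moyal product
`(f ⋆ ψ)(x) = (2π)^{-d} ∫ dk ∫ dy f(x + Θk/2) ψ(x + y) e^{i⟨k, y⟩}` of a bounded function with a
Schwartz function. The inner integral is, for each `x`, a Schwartz function of `k`, so for bounded
continuous `f` both integrals converge absolutely. -/
def moyal {d : ℕ} (Θ : Matrix (Fin d) (Fin d) ℝ) (f : Pt d → ℂ) (ψ : Spinor d) (x : Pt d) :
    Fock d :=
  (((2 * Real.pi) ^ d)⁻¹ : ℝ) •
    ∫ k : Pt d, f (x + (2⁻¹ : ℝ) • Matrix.toEuclideanLin Θ k) •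
      ∫ y : Pt d, Complex.exp (Complex.I * ((inner ℝ k y : ℝ) : ℂ)) • ψ (x + y)

/-- The bounded operator `T` is the operator `L_⋆(f)` of left Moyal multiplication by `f`, i.e. the
(necessarily unique) continuous extension of `ψ ↦ f ⋆ ψ` from Schwartz functions to the Hilbert
space. -/
def IsLeftMoyal {d : ℕ} (Θ : Matrix (Fin d) (Fin d) ℝ) (f : Pt d → ℂ)
    (T : Hilb d →L[ℂ] Hilb d) : Prop :=
  ∀ ψ : Spinor d, T (ψ.toLp 2 (volume : Measure (Pt d))) =ᵐ[volume] moyal Θ f ψ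

/-! ### Unbounded operators: `⟨D⟩`, commutators, the derivation `δ` -/

section Abstract

variable {V : Type*} [NormedAddCommGroup V] [InnerProductSpace ℂ V]

/-- `ψ ∈ dom (A²)` and `A² ψ = φ`, where `dom (A²) = {ψ ∈ dom A : A ψ ∈ dom A}`. -/
def SqRel (A : V →ₗ.[ℂ] V) (ψ φ : V) : Prop :=
  ∃ χ : V, (ψ, χ) ∈ A.graph ∧ (χ, φ) ∈ A.graph

/-- `A = ⟨D⟩ = (D² + 1)^{1/2}`: `A` is self-adjoint and nonnegative, and `A² = D² + 1` as unbounded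
operators (equality of domains included). -/
def IsBracket [CompleteSpace V] (D A : V →ₗ.[ℂ] V) : Prop :=
  IsSelfAdjoint A ∧ (∀ ψ : A.domain, 0 ≤ (inner ℂ (ψ : V) (A ψ)).re) ∧
    ∀ ψ φ : V, SqRel A ψ φ ↔ SqRel D ψ (φ - ψ)

/-- The bounded operator `S` is (the bounded extension of) the commutator `[A, T]`: the bounded
operator `T` maps `dom A` to itself, and `A T ψ - T A ψ = S ψ` for all `ψ ∈ dom A`. For densely
defined `A` such an `S` is unique. -/
def IsCommutator (A : V →ₗ.[ℂ] V) (T S : V →L[ℂ] V) : Prop :=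
  ∀ ψ : A.domain, ∃ h : T (ψ : V) ∈ A.domain, A ⟨T (ψ : V), h⟩ - T (A ψ) = S (ψ : V)

/-- `T ∈ dom (δⁿ)` for `δ(T) = [A, T]`, where `dom δ` consists of the bounded operators `T` such
that `[A, T]` is defined on `dom A` and extends to a bounded operator; `T ∈ dom (δⁿ⁺¹)` means
`T ∈ dom δ` and `δ(T) ∈ dom (δⁿ)`. -/
def MemDomDeltaPow (A : V →ₗ.[ℂ] V) : ℕ → (V →L[ℂ] V) → Prop
  | 0, _ => True
  | n + 1, T => ∃ S : V →L[ℂ] V, IsCommutator A T S ∧ MemDomDeltaPow A n S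

end Abstract

end MoyalOscillator

end

/-!
Both Dirac operators have the form `∑ₖ Xₖ ⊗ Γₖ`, where `X` lists the operators `-i ∂_μ` and `Ω x_μ`
and the `Γₖ` are Clifford matrices. Hence `D²` is the harmonic oscillator `∑ₖ Xₖ²` plus a bounded
matrix. The Hermite functions span finite-dimensional invariant spaces, on which `D² + 1` is
surjective, and they are dense because the Gaussian determines its moments. So `D² + 1` has dense
range on the Schwartz functions, which gives the self-adjointness of `D` and the bounded operator
`S = ⟨D⟩⁻¹`.

Left Moyal multiplication by `f` is the pseudodifferential operator with symbol `f (x + B ξ)` for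
`B = -π Θ`. It is bounded by an argument of Calderón–Vaillancourt type: weighted local bounds,
averaged over all translates of a window. Its commutators with the `Xₖ` are again operators of this
kind, whose symbols are derivatives of `f`.

Since the `S Xₖ` are bounded, all iterates of `T ↦ ⟨D⟩⁻¹ [⟨D⟩², T]` are therefore bounded on
`L_⋆(f)` and on `[D, L_⋆(f)]`. The formula `(π / 2) S = ∫₀^∞ S² (1 + t² S²)⁻¹ dt` turns this into
the boundedness of the iterated commutators with `⟨D⟩`. An identity that involves `⟨D⟩` is
multiplied by powers of the bounded operator `S`, which removes the questions of domains.
-/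

namespace MoyalOscillator

open MeasureTheory

/-! ### Commutators with an invertible operator, in terms of its inverse -/

section Ring

variable {R : Type*} [Ring R] {S T T' U U' C C' : R}

/-- The relation `U = A⁻¹ [A², T]` for `A = S⁻¹`, written without the (possibly unbounded) inverse
of `S`. -/
def IsOrderOneCommutator (S T U : R) : Prop := T * (S * S) - S * S * T = S * U * (S * S)

/-- The relation `C = [A, T]` for `A = S⁻¹`, written without the (possibly unbounded) inverse
of `S`. -/
def IsInverseCommutator (S T C : R) : Prop := T * S - S * T = S * C * S

/-- All iterates of `T ↦ A⁻¹ [A², T]`, where `A = S⁻¹`, are defined on `T`. -/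
def IsSmoothFor (S T : R) : Prop :=
  ∃ u : ℕ → R, u 0 = T ∧ ∀ k, IsOrderOneCommutator S (u k) (u (k + 1))

theorem isOrderOneCommutator_zero_of_commute (h : Commute T (S * S)) :
    IsOrderOneCommutator S T 0 := by
  rw [IsOrderOneCommutator, h.eq, sub_self, mul_zero, zero_mul]

theorem isInverseCommutator_zero_of_commute (h : Commute T S) : IsInverseCommutator S T 0 := by
  rw [IsInverseCommutator, h.eq, sub_self, mul_zero, zero_mul]

theorem IsOrderOneCommutator.add (h : IsOrderOneCommutator S T U)
    (h' : IsOrderOneCommutator S T' U') : IsOrderOneCommutator S (T + T') (U + U') := by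
  rw [IsOrderOneCommutator] at *
  rw [mul_add S, add_mul (S * U), ← h, ← h']
  noncomm_ring

theorem IsInverseCommutator.add (h : IsInverseCommutator S T C)
    (h' : IsInverseCommutator S T' C') : IsInverseCommutator S (T + T') (C + C') := by
  rw [IsInverseCommutator] at *
  rw [mul_add S C, add_mul (S * C), ← h, ← h']
  noncomm_ring

theorem IsInverseCommutator.mul (h : IsInverseCommutator S T C)
    (h' : IsInverseCommutator S T' C') : IsInverseCommutator S (T * T') (T * C' + C * T') := by
  rw [IsInverseCommutator] at *
  calc T * T' * S - S * (T * T')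
      = T * (T' * S - S * T') + (T * S - S * T) * T' := by noncomm_ring
    _ = T * (S * C' * S) + S * C * S * T' := by rw [h, h']
    _ = (T * S - S * T) * (C' * S) + S * T * C' * S + S * C * (S * T') := by noncomm_ring
    _ = S * C * (T' * S - S * T') + S * T * C' * S + S * C * (S * T') := by
        rw [h, h']
        noncomm_ring
    _ = S * (T * C' + C * T') * S := by noncomm_ring

theorem IsOrderOneCommutator.mul (h : IsOrderOneCommutator S T U)
    (h' : IsOrderOneCommutator S T' U') (hC : IsInverseCommutator S T C) :
    IsOrderOneCommutator S (T * T') (U * T' - U * S * U' + T * U' + C * S * U') := by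
  rw [IsOrderOneCommutator] at *
  rw [IsInverseCommutator] at hC
  calc T * T' * (S * S) - S * S * (T * T')
      = T * (T' * (S * S) - S * S * T') + (T * (S * S) - S * S * T) * T' := by noncomm_ring
    _ = (T * S - S * T) * (U' * (S * S)) + S * T * (U' * (S * S)) + S * U * (S * S * T') := by
        rw [h, h']
        noncomm_ring
    _ = S * C * S * (U' * (S * S)) + S * T * (U' * (S * S)) +
          S * U * (T' * (S * S) - S * U' * (S * S)) := by
        rw [hC, ← h', sub_sub_cancel]
    _ = S * (U * T' - U * S * U' + T * U' + C * S * U') * (S * S) := by noncomm_ring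

theorem IsOrderOneCommutator.commutator (hcancel : ∀ X : R, S * X * S = 0 → X = 0)
    (h : IsOrderOneCommutator S T U) (hC : IsInverseCommutator S T C)
    (hC' : IsInverseCommutator S U C') : IsOrderOneCommutator S C C' := by
  rw [IsOrderOneCommutator] at *
  rw [IsInverseCommutator] at hC hC'
  refine sub_eq_zero.1 (hcancel _ ?_)
  calc S * (C * (S * S) - S * S * C - S * C' * (S * S)) * S
      = (S * C * S) * (S * S) - S * S * (S * C * S) - S * (S * C' * S) * (S * S) := by
        noncomm_ring
    _ = (T * (S * S) - S * S * T) * S - S * (T * (S * S) - S * S * T) -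
          S * (U * S - S * U) * (S * S) := by
        rw [← hC, ← hC']
        noncomm_ring
    _ = 0 := by
        rw [h]
        noncomm_ring

theorem IsSmoothFor.exists_isOrderOneCommutator (h : IsSmoothFor S T) :
    ∃ U, IsOrderOneCommutator S T U ∧ IsSmoothFor S U := by
  obtain ⟨u, rfl, hu⟩ := h
  exact ⟨u 1, hu 0, fun k => u (k + 1), rfl, fun k => hu (k + 1)⟩

theorem isSmoothFor_of_invariant {𝒜 : Set R}
    (h𝒜 : ∀ T ∈ 𝒜, ∃ U ∈ 𝒜, IsOrderOneCommutator S T U) (hT : T ∈ 𝒜) : IsSmoothFor S T := by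
  choose! next hnext hcomm using h𝒜
  have hmem : ∀ k, next^[k] T ∈ 𝒜 := fun k => by
    induction k with
    | zero => exact hT
    | succ k ih => rw [Function.iterate_succ_apply']; exact hnext _ ih
  refine ⟨fun k => next^[k] T, rfl, fun k => ?_⟩
  simp only [Function.iterate_succ_apply']
  exact hcomm _ (hmem k)

theorem isSmoothFor_of_commute (h : Commute T (S * S)) : IsSmoothFor S T := by
  refine isSmoothFor_of_invariant (𝒜 := {T, 0}) ?_ (by simp)
  rintro X (rfl | rfl)
  · exact ⟨0, by simp, isOrderOneCommutator_zero_of_commute h⟩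
  · exact ⟨0, by simp, isOrderOneCommutator_zero_of_commute (.zero_left _)⟩

theorem isSmoothFor_self : IsSmoothFor S S :=
  isSmoothFor_of_commute ((Commute.refl S).mul_right (.refl S))

end Ring

section Resolvent

variable {𝕜 R : Type*} [CommRing 𝕜] [Ring R] [Algebra 𝕜 R] {P E S T U V : R} {c t : 𝕜}

theorem commutator_mul_resolvent (hE : E = 1 - c • (P * E)) (hPE : Commute P E) :
    T * (P * E) - P * E * T = E * (T * P - P * T) * E := by
  symm
  calc E * (T * P - P * T) * E = E * T * (P * E) - E * P * T * E := by noncomm_ring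
    _ = E * T * (P * E) - P * E * T * E := by rw [hPE.eq]
    _ = (1 - c • (P * E)) * T * (P * E) - P * E * T * (1 - c • (P * E)) := by rw [← hE]
    _ = T * (P * E) - P * E * T := by
        simp only [sub_mul, mul_sub, one_mul, mul_one, smul_mul_assoc, mul_smul_comm, mul_assoc]
        abel

theorem resolvent_mul (hE : E = 1 - c • (P * E)) :
    E * T = T * E + c • (T * (P * E) - P * E * T) := by
  conv_lhs => rw [hE]
  conv_rhs => enter [1]; rw [hE]
  simp only [sub_mul, mul_sub, one_mul, mul_one, smul_mul_assoc, mul_smul_comm, smul_sub]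
  abel

/-- The summands are what remains of `E S U (S² E)`, the commutator itself, after moving the first
`E` past `U`. Every factor `t` in the second one is matched by a factor `S E`, which is `O(t⁻¹)`. -/
theorem commutator_sq_mul_resolvent (hE : E = 1 - t ^ 2 • (S * S * E)) (hSE : Commute S E)
    (h : IsOrderOneCommutator S T U) (h' : IsOrderOneCommutator S U V) :
    T * (S * S * E) - S * S * E * T = S * U * (S * S * E * E) +
      S * ((t • (S * E)) * V * ((t • (S * E)) * (S * S * E))) * S := by
  have hSSE : Commute (S * S) E := hSE.mul_left hSE
  have hES : ∀ X, E * (S * X) = S * (E * X) := fun X => by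
    rw [← mul_assoc, ← hSE.eq, mul_assoc]
  calc T * (S * S * E) - S * S * E * T = S * (E * U) * (S * S * E) := by
        rw [commutator_mul_resolvent hE hSSE, h]
        simp only [mul_assoc, hES]
    _ = S * (U * E + t ^ 2 • (E * (S * V * (S * S)) * E)) * (S * S * E) := by
        rw [resolvent_mul hE, commutator_mul_resolvent hE hSSE, h']
    _ = _ := by
        simp only [mul_add, add_mul, smul_mul_assoc, mul_smul_comm, smul_smul, sq, mul_assoc, hES,
          hSE.symm.eq]

end Resolvent

/-! ### Commutators with a square root -/

section SquareRoot

open Set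

theorem one_add_sq_mul_sq_pos (t s : ℝ) : 0 < 1 + t ^ 2 * s ^ 2 := by positivity

theorem continuous_inv_one_add_sq_mul_sq :
    Continuous fun p : ℝ × ℝ => (1 + p.1 ^ 2 * p.2 ^ 2)⁻¹ :=
  Continuous.inv₀ (by fun_prop) fun p => (one_add_sq_mul_sq_pos p.1 p.2).ne'

theorem continuous_inv_one_add_const_mul_sq (t : ℝ) :
    Continuous fun s : ℝ => (1 + t ^ 2 * s ^ 2)⁻¹ :=
  continuous_inv_one_add_sq_mul_sq.comp (Continuous.prodMk_right t)

theorem inv_one_add_sq_mul_sq_le_one (t s : ℝ) : (1 + t ^ 2 * s ^ 2)⁻¹ ≤ 1 :=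
  inv_le_one_of_one_le₀ (by nlinarith [mul_nonneg (sq_nonneg t) (sq_nonneg s)])

theorem abs_mul_inv_one_add_sq_mul_sq_le_one (t s : ℝ) :
    |t * s * (1 + t ^ 2 * s ^ 2)⁻¹| ≤ 1 := by
  have h := one_add_sq_mul_sq_pos t s
  rw [← div_eq_mul_inv, abs_div, abs_of_pos h, div_le_one h, abs_le]
  constructor <;> nlinarith [sq_nonneg (t * s - 1), sq_nonneg (t * s + 1)]

theorem sq_mul_inv_one_add_sq_mul_sq_le {s M : ℝ} (hs : s ^ 2 ≤ M) (t : ℝ) :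
    s ^ 2 * (1 + t ^ 2 * s ^ 2)⁻¹ ≤ (M + 1) * (1 + t ^ 2)⁻¹ := by
  rw [← div_eq_mul_inv, ← div_eq_mul_inv, div_le_div_iff₀ (by positivity) (by positivity)]
  have hM : 0 ≤ M := (sq_nonneg s).trans hs
  have : 0 ≤ M * (t ^ 2 * s ^ 2) := by positivity
  nlinarith

theorem tendsto_mul_sq_mul_inv_one_add_sq_mul_sq (s : ℝ) :
    Filter.Tendsto (fun t : ℝ => t * s ^ 2 * (1 + t ^ 2 * s ^ 2)⁻¹) Filter.atTop (nhds 0) := by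
  refine squeeze_zero' ?_ ?_ tendsto_inv_atTop_zero
  · filter_upwards [Filter.eventually_ge_atTop 0] with t ht
    have := one_add_sq_mul_sq_pos t s
    positivity
  · filter_upwards [Filter.eventually_gt_atTop 0] with t ht
    rw [← div_eq_mul_inv, div_le_iff₀ (one_add_sq_mul_sq_pos t s)]
    calc t * s ^ 2 ≤ t⁻¹ + t * s ^ 2 := le_add_of_nonneg_left (inv_nonneg.2 ht.le)
      _ = t⁻¹ * (1 + t ^ 2 * s ^ 2) := by field_simp

theorem tendsto_mul_arctan_mul {s : ℝ} (hs : 0 ≤ s) :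
    Filter.Tendsto (fun t : ℝ => s * Real.arctan (t * s)) Filter.atTop
      (nhds (s * (Real.pi / 2))) := by
  rcases hs.eq_or_lt with rfl | hs
  · simp
  · exact ((tendsto_nhds_of_tendsto_nhdsWithin Real.tendsto_arctan_atTop).comp
      (Filter.tendsto_id.atTop_mul_const hs)).const_mul s

theorem hasDerivAt_mul_arctan_mul (s t : ℝ) :
    HasDerivAt (fun t : ℝ => s * Real.arctan (t * s)) (s ^ 2 * (1 + t ^ 2 * s ^ 2)⁻¹) t := by
  refine ((((hasDerivAt_id t).mul_const s).arctan).const_mul s).congr_deriv ?_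
  simp only [id_eq, one_div, mul_pow]
  ring

theorem hasDerivAt_mul_sq_mul_inv_one_add_sq_mul_sq (s t : ℝ) :
    HasDerivAt (fun t : ℝ => t * s ^ 2 * (1 + t ^ 2 * s ^ 2)⁻¹)
      (2 * (s ^ 2 * (1 + t ^ 2 * s ^ 2)⁻¹ ^ 2) - s ^ 2 * (1 + t ^ 2 * s ^ 2)⁻¹) t := by
  have h0 := (one_add_sq_mul_sq_pos t s).ne'
  have hden : HasDerivAt (fun t : ℝ => 1 + t ^ 2 * s ^ 2) (2 * t * s ^ 2) t := by
    simpa using ((hasDerivAt_pow 2 t).mul_const (s ^ 2)).const_add 1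
  refine (((hasDerivAt_id t).mul_const (s ^ 2)).mul (hden.inv h0)).congr_deriv ?_
  simp only [id_eq, Pi.inv_apply]
  field_simp
  ring

theorem integral_sq_mul_inv_one_add_sq_mul_sq {s : ℝ} (hs : 0 ≤ s) :
    ∫ t in Ioi (0 : ℝ), s ^ 2 * (1 + t ^ 2 * s ^ 2)⁻¹ = Real.pi / 2 * s := by
  rw [integral_Ioi_of_hasDerivAt_of_nonneg' (fun t _ => hasDerivAt_mul_arctan_mul s t)
    (fun t _ => ?_) (tendsto_mul_arctan_mul hs)]
  · simp [mul_comm]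
  · have := one_add_sq_mul_sq_pos t s
    positivity

theorem integral_sq_mul_inv_one_add_sq_mul_sq_sq {s : ℝ} (hs : 0 ≤ s) :
    ∫ t in Ioi (0 : ℝ), s ^ 2 * (1 + t ^ 2 * s ^ 2)⁻¹ ^ 2 = Real.pi / 4 * s := by
  have hderiv : ∀ t ∈ Ici (0 : ℝ), HasDerivAt (fun t : ℝ => (t * s ^ 2 * (1 + t ^ 2 * s ^ 2)⁻¹ +
      s * Real.arctan (t * s)) / 2) (s ^ 2 * (1 + t ^ 2 * s ^ 2)⁻¹ ^ 2) t := fun t _ =>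
    (((hasDerivAt_mul_sq_mul_inv_one_add_sq_mul_sq s t).add
      (hasDerivAt_mul_arctan_mul s t)).div_const 2).congr_deriv (by ring)
  rw [integral_Ioi_of_hasDerivAt_of_nonneg' hderiv (fun t _ => ?_)
    (((tendsto_mul_sq_mul_inv_one_add_sq_mul_sq s).add (tendsto_mul_arctan_mul hs)).div_const 2)]
  · simp only [zero_mul, Real.arctan_zero, mul_zero, zero_add, zero_div, sub_zero]
    ring
  · have := one_add_sq_mul_sq_pos t s
    positivity

variable {𝔅 : Type*} [CStarAlgebra 𝔅] {S T U V : 𝔅}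

/-- `(1 + t² S²)⁻¹`, which for `A = S⁻¹` is `A² (A² + t²)⁻¹`: the operators that occur in the
integral formula `(π / 2) S = ∫₀^∞ S² (1 + t² S²)⁻¹ dt` for the square root. -/
noncomputable def invOneAddSq (S : 𝔅) (t : ℝ) : 𝔅 :=
  cfc (fun s : ℝ => (1 + t ^ 2 * s ^ 2)⁻¹) S

/-- The part of the commutator of `T` with `S² (1 + t² S²)⁻¹` in which both the first and the
second iterate of `T ↦ A⁻¹ [A², T]`, `A = S⁻¹`, enter; `V` is the second iterate. -/
noncomputable def commutatorRemainder (S V : 𝔅) (t : ℝ) : 𝔅 :=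
  (t • (S * invOneAddSq S t)) * V * ((t • (S * invOneAddSq S t)) * (S * S * invOneAddSq S t))

theorem sq_le_norm_sq_of_mem_spectrum {s : ℝ} (hs : s ∈ spectrum ℝ S) : s ^ 2 ≤ ‖S‖ ^ 2 := by
  rcases subsingleton_or_nontrivial 𝔅 with _ | _
  · simp [spectrum.of_subsingleton] at hs
  · exact sq_le_sq.2 (by simpa using spectrum.norm_le_norm_of_mem hs)

theorem continuous_invOneAddSq (S : 𝔅) : Continuous (invOneAddSq S) := by
  refine continuous_iff_continuousAt.2 fun t => continuousAt_cfc_fun ?_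
    (.of_forall fun t => (continuous_inv_one_add_const_mul_sq t).continuousOn)
  have : CompactSpace (spectrum ℝ S) := isCompact_iff_compactSpace.1 (spectrum.isCompact S)
  rw [tendstoUniformlyOn_iff_tendstoUniformly_comp_coe]
  refine Continuous.tendstoUniformly (fun t (s : spectrum ℝ S) => (1 + t ^ 2 * (s : ℝ) ^ 2)⁻¹) ?_ t
  exact continuous_inv_one_add_sq_mul_sq.comp
    (continuous_fst.prodMk (continuous_subtype_val.comp continuous_snd))

theorem norm_sq_mul_inv_one_add_sq_mul_sq_le {s : ℝ} (hs : s ∈ spectrum ℝ S) (t : ℝ) :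
    ‖s ^ 2 * (1 + t ^ 2 * s ^ 2)⁻¹‖ ≤ (‖S‖ ^ 2 + 1) * (1 + t ^ 2)⁻¹ := by
  have := one_add_sq_mul_sq_pos t s
  rw [Real.norm_of_nonneg (by positivity)]
  exact sq_mul_inv_one_add_sq_mul_sq_le (sq_le_norm_sq_of_mem_spectrum hs) t

theorem norm_sq_mul_inv_one_add_sq_mul_sq_sq_le {s : ℝ} (hs : s ∈ spectrum ℝ S) (t : ℝ) :
    ‖s ^ 2 * (1 + t ^ 2 * s ^ 2)⁻¹ ^ 2‖ ≤ (‖S‖ ^ 2 + 1) * (1 + t ^ 2)⁻¹ := by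
  refine le_trans ?_ (norm_sq_mul_inv_one_add_sq_mul_sq_le hs t)
  have := one_add_sq_mul_sq_pos t s
  rw [sq (1 + t ^ 2 * s ^ 2)⁻¹, ← mul_assoc, norm_mul]
  refine mul_le_of_le_one_right (norm_nonneg _) ?_
  rw [Real.norm_of_nonneg (by positivity)]
  exact inv_one_add_sq_mul_sq_le_one t s

theorem integrable_const_mul_inv_one_add_sq (c : ℝ) :
    Integrable (fun t : ℝ => c * (1 + t ^ 2)⁻¹) (volume.restrict (Ioi 0)) :=
  (integrable_inv_one_add_sq.const_mul c).restrict

theorem commute_invOneAddSq (S : 𝔅) (t : ℝ) : Commute S (invOneAddSq S t) :=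
  ((Commute.refl S).cfc_real _).symm

theorem cfc_sq_mul_inv_one_add_sq (hS : IsSelfAdjoint S) (t : ℝ) :
    cfc (fun s : ℝ => s ^ 2 * (1 + t ^ 2 * s ^ 2)⁻¹) S = S * S * invOneAddSq S t := by
  have hc := (continuous_inv_one_add_const_mul_sq t).continuousOn (s := spectrum ℝ S)
  rw [cfc_mul (fun s : ℝ => s ^ 2) (fun s : ℝ => (1 + t ^ 2 * s ^ 2)⁻¹) S (by fun_prop) hc,
    cfc_pow_id S, sq, invOneAddSq]

theorem cfc_sq_mul_inv_one_add_sq_sq (hS : IsSelfAdjoint S) (t : ℝ) :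
    cfc (fun s : ℝ => s ^ 2 * (1 + t ^ 2 * s ^ 2)⁻¹ ^ 2) S =
      S * S * invOneAddSq S t * invOneAddSq S t := by
  have hc := (continuous_inv_one_add_const_mul_sq t).continuousOn (s := spectrum ℝ S)
  rw [← cfc_sq_mul_inv_one_add_sq hS, invOneAddSq, ← cfc_mul _ _ _ (by fun_prop) hc]
  simp only [sq, mul_assoc]

theorem invOneAddSq_eq (hS : IsSelfAdjoint S) (t : ℝ) :
    invOneAddSq S t = 1 - t ^ 2 • (S * S * invOneAddSq S t) := by
  have hc := (continuous_inv_one_add_const_mul_sq t).continuousOn (s := spectrum ℝ S)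
  rw [← cfc_sq_mul_inv_one_add_sq hS, ← cfc_smul _ _ _ (by fun_prop), ← cfc_one ℝ S,
    ← cfc_sub _ _ _ (by fun_prop) (by fun_prop), invOneAddSq]
  congr 1
  ext s
  have := (one_add_sq_mul_sq_pos t s).ne'
  simp only [Pi.one_apply, smul_eq_mul]
  field_simp
  ring

theorem norm_smul_mul_invOneAddSq_le_one (hS : IsSelfAdjoint S) (t : ℝ) :
    ‖t • (S * invOneAddSq S t)‖ ≤ 1 := by
  have hc := (continuous_inv_one_add_const_mul_sq t).continuousOn (s := spectrum ℝ S)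
  have hcfc : t • (S * invOneAddSq S t) = cfc (fun s : ℝ => t * s * (1 + t ^ 2 * s ^ 2)⁻¹) S := by
    rw [cfc_mul (fun s : ℝ => t * s) (fun s : ℝ => (1 + t ^ 2 * s ^ 2)⁻¹) S (by fun_prop) hc,
      cfc_const_mul_id t S, smul_mul_assoc, invOneAddSq]
  rw [hcfc]
  exact norm_cfc_le zero_le_one fun s _ => abs_mul_inv_one_add_sq_mul_sq_le_one t s

theorem norm_sq_mul_invOneAddSq_le (hS : IsSelfAdjoint S) (t : ℝ) :
    ‖S * S * invOneAddSq S t‖ ≤ (‖S‖ ^ 2 + 1) * (1 + t ^ 2)⁻¹ := by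
  rw [← cfc_sq_mul_inv_one_add_sq hS]
  exact norm_cfc_le (by positivity) fun s hs => norm_sq_mul_inv_one_add_sq_mul_sq_le hs t

theorem norm_sq_mul_invOneAddSq_sq_le (hS : IsSelfAdjoint S) (t : ℝ) :
    ‖S * S * invOneAddSq S t * invOneAddSq S t‖ ≤ (‖S‖ ^ 2 + 1) * (1 + t ^ 2)⁻¹ := by
  rw [← cfc_sq_mul_inv_one_add_sq_sq hS]
  exact norm_cfc_le (by positivity) fun s hs => norm_sq_mul_inv_one_add_sq_mul_sq_sq_le hs t

theorem norm_commutatorRemainder_le (hS : IsSelfAdjoint S) (V : 𝔅) (t : ℝ) :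
    ‖commutatorRemainder S V t‖ ≤ ‖V‖ * (‖S‖ ^ 2 + 1) * (1 + t ^ 2)⁻¹ := by
  have h1 := norm_smul_mul_invOneAddSq_le_one hS t
  rw [mul_assoc ‖V‖]
  refine (norm_mul_le _ _).trans (mul_le_mul ((norm_mul_le _ _).trans ?_)
    ((norm_mul_le _ _).trans ?_) (norm_nonneg _) (norm_nonneg _))
  · exact mul_le_of_le_one_left (norm_nonneg _) h1
  · exact (mul_le_of_le_one_left (norm_nonneg _) h1).trans (norm_sq_mul_invOneAddSq_le hS t)

theorem integrable_sq_mul_invOneAddSq (hS : IsSelfAdjoint S) :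
    Integrable (fun t => S * S * invOneAddSq S t) (volume.restrict (Ioi 0)) := by
  have := continuous_invOneAddSq S
  exact (integrable_const_mul_inv_one_add_sq _).mono' (by fun_prop)
    (.of_forall (norm_sq_mul_invOneAddSq_le hS))

theorem integrable_sq_mul_invOneAddSq_sq (hS : IsSelfAdjoint S) :
    Integrable (fun t => S * S * invOneAddSq S t * invOneAddSq S t)
      (volume.restrict (Ioi 0)) := by
  have := continuous_invOneAddSq S
  exact (integrable_const_mul_inv_one_add_sq _).mono' (by fun_prop)
    (.of_forall (norm_sq_mul_invOneAddSq_sq_le hS))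

theorem integrable_commutatorRemainder (hS : IsSelfAdjoint S) (V : 𝔅) :
    Integrable (commutatorRemainder S V) (volume.restrict (Ioi 0)) := by
  have := continuous_invOneAddSq S
  refine (integrable_const_mul_inv_one_add_sq _).mono' ?_
    (.of_forall (norm_commutatorRemainder_le hS V))
  unfold commutatorRemainder
  fun_prop

variable [PartialOrder 𝔅] [StarOrderedRing 𝔅]

theorem integral_sq_mul_invOneAddSq (hS : 0 ≤ S) :
    ∫ t in Ioi (0 : ℝ), S * S * invOneAddSq S t = (Real.pi / 2) • S := by
  have hc := continuous_inv_one_add_sq_mul_sq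
  simp_rw [← cfc_sq_mul_inv_one_add_sq (IsSelfAdjoint.of_nonneg hS)]
  rw [← cfc_integral (fun t s : ℝ => s ^ 2 * (1 + t ^ 2 * s ^ 2)⁻¹) _ S
    (Continuous.continuousOn (by unfold Function.uncurry; fun_prop))
    (.of_forall fun t s hs => norm_sq_mul_inv_one_add_sq_mul_sq_le hs t)
    (integrable_const_mul_inv_one_add_sq _).2, ← cfc_const_mul_id (Real.pi / 2) S]
  exact cfc_congr fun s hs =>
    integral_sq_mul_inv_one_add_sq_mul_sq (spectrum_nonneg_of_nonneg hS hs)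

theorem integral_sq_mul_invOneAddSq_sq (hS : 0 ≤ S) :
    ∫ t in Ioi (0 : ℝ), S * S * invOneAddSq S t * invOneAddSq S t = (Real.pi / 4) • S := by
  have hc := continuous_inv_one_add_sq_mul_sq
  simp_rw [← cfc_sq_mul_inv_one_add_sq_sq (IsSelfAdjoint.of_nonneg hS)]
  rw [← cfc_integral (fun t s : ℝ => s ^ 2 * (1 + t ^ 2 * s ^ 2)⁻¹ ^ 2) _ S
    (Continuous.continuousOn (by unfold Function.uncurry; fun_prop))
    (.of_forall fun t s hs => norm_sq_mul_inv_one_add_sq_mul_sq_sq_le hs t)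
    (integrable_const_mul_inv_one_add_sq _).2, ← cfc_const_mul_id (Real.pi / 4) S]
  exact cfc_congr fun s hs =>
    integral_sq_mul_inv_one_add_sq_mul_sq_sq (spectrum_nonneg_of_nonneg hS hs)

theorem pi_div_two_smul_commutator (hS : 0 ≤ S) (h : IsOrderOneCommutator S T U)
    (h' : IsOrderOneCommutator S U V) :
    (Real.pi / 2) • (T * S - S * T) = S * U * ((Real.pi / 4) • S) +
      S * (∫ t in Ioi (0 : ℝ), commutatorRemainder S V t) * S := by
  have hS' := IsSelfAdjoint.of_nonneg hS
  have hint := integrable_sq_mul_invOneAddSq hS'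
  have hint_sq := integrable_sq_mul_invOneAddSq_sq hS'
  have hint_rem := integrable_commutatorRemainder hS' V
  rw [smul_sub, ← mul_smul_comm, ← smul_mul_assoc, ← integral_sq_mul_invOneAddSq hS,
    ← integral_sq_mul_invOneAddSq_sq hS, ← integral_const_mul_of_integrable hint,
    ← integral_mul_const_of_integrable hint,
    ← integral_sub (hint.const_mul _) (hint.mul_const _),
    ← integral_const_mul_of_integrable hint_sq, ← integral_const_mul_of_integrable hint_rem,
    ← integral_mul_const_of_integrable (hint_rem.const_mul _),
    ← integral_add (hint_sq.const_mul _) ((hint_rem.const_mul _).mul_const _)]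
  exact integral_congr_ae (.of_forall fun t => commutator_sq_mul_resolvent
    (invOneAddSq_eq hS' t) (commute_invOneAddSq S t) h h')

theorem IsOrderOneCommutator.exists_isInverseCommutator (hS : 0 ≤ S)
    (h : IsOrderOneCommutator S T U) (h' : IsOrderOneCommutator S U V) :
    ∃ C, IsInverseCommutator S T C := by
  refine ⟨(2 / Real.pi) • ((Real.pi / 4) • U +
    ∫ t in Ioi (0 : ℝ), commutatorRemainder S V t), ?_⟩
  have hpi : 2 / Real.pi * (Real.pi / 2) = 1 := by field_simp
  calc T * S - S * T = (2 / Real.pi) • ((Real.pi / 2) • (T * S - S * T)) := by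
        rw [smul_smul, hpi, one_smul]
    _ = _ := by
        simp only [pi_div_two_smul_commutator hS h h', mul_smul_comm, smul_mul_assoc, mul_add,
          add_mul]

theorem IsSmoothFor.exists_isInverseCommutator (hS : 0 ≤ S)
    (hcancel : ∀ X : 𝔅, S * X * S = 0 → X = 0) (h : IsSmoothFor S T) :
    ∃ C, IsSmoothFor S C ∧ IsInverseCommutator S T C := by
  obtain ⟨u, rfl, hu⟩ := h
  choose C hC using fun k => (hu k).exists_isInverseCommutator hS (hu (k + 1))
  exact ⟨C 0, ⟨C, rfl, fun k => (hu k).commutator hcancel (hC k) (hC (k + 1))⟩, hC 0⟩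

end SquareRoot

/-! ### The algebra of smooth elements -/

section SmoothSubalgebra

variable {𝔅 : Type*} [CStarAlgebra 𝔅] [PartialOrder 𝔅] [StarOrderedRing 𝔅] {S T : 𝔅}

theorem isSmoothFor_of_mem_adjoin (hS : 0 ≤ S) (hcancel : ∀ X : 𝔅, S * X * S = 0 → X = 0)
    (h : T ∈ Algebra.adjoin ℂ {T : 𝔅 | IsSmoothFor S T}) : IsSmoothFor S T := by
  set 𝒦 := Algebra.adjoin ℂ {T : 𝔅 | IsSmoothFor S T}
  have hS𝒦 : S ∈ 𝒦 := Algebra.subset_adjoin isSmoothFor_self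
  suffices ∀ T ∈ 𝒦, (∃ U ∈ 𝒦, IsOrderOneCommutator S T U) ∧ ∃ C ∈ 𝒦, IsInverseCommutator S T C from
    isSmoothFor_of_invariant (fun T hT => (this T hT).1) h
  intro T hT
  induction hT using Algebra.adjoin_induction with
  | mem T hT =>
    obtain ⟨U, hTU, hU⟩ := IsSmoothFor.exists_isOrderOneCommutator hT
    obtain ⟨C, hC, hTC⟩ := IsSmoothFor.exists_isInverseCommutator hS hcancel hT
    exact ⟨⟨U, Algebra.subset_adjoin hU, hTU⟩, C, Algebra.subset_adjoin hC, hTC⟩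
  | algebraMap c =>
    exact ⟨⟨0, zero_mem _, isOrderOneCommutator_zero_of_commute (Algebra.commutes _ _)⟩,
      0, zero_mem _, isInverseCommutator_zero_of_commute (Algebra.commutes _ _)⟩
  | add T T' _ _ h h' =>
    obtain ⟨⟨U, hU, hTU⟩, C, hC, hTC⟩ := h
    obtain ⟨⟨U', hU', hTU'⟩, C', hC', hTC'⟩ := h'
    exact ⟨⟨U + U', add_mem hU hU', hTU.add hTU'⟩, C + C', add_mem hC hC', hTC.add hTC'⟩
  | mul T T' hT hT' h h' =>
    obtain ⟨⟨U, hU, hTU⟩, C, hC, hTC⟩ := h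
    obtain ⟨⟨U', hU', hTU'⟩, C', hC', hTC'⟩ := h'
    exact ⟨⟨_, add_mem (add_mem (sub_mem (mul_mem hU hT') (mul_mem (mul_mem hU hS𝒦) hU'))
        (mul_mem hT hU')) (mul_mem (mul_mem hC hS𝒦) hU'), hTU.mul hTU' hTC⟩,
      _, add_mem (mul_mem hT hC') (mul_mem hC hT'), hTC.mul hTC'⟩

/-- The smooth elements form an algebra. For `A = S⁻¹` this is the algebra `⋂ₙ dom δⁿ`,
`δ = [A, ·]`. -/
def smoothSubalgebra (hS : 0 ≤ S) (hcancel : ∀ X : 𝔅, S * X * S = 0 → X = 0) :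
    Subalgebra ℂ 𝔅 where
  carrier := {T | IsSmoothFor S T}
  mul_mem' ha hb := isSmoothFor_of_mem_adjoin hS hcancel
    (mul_mem (Algebra.subset_adjoin ha) (Algebra.subset_adjoin hb))
  add_mem' ha hb := isSmoothFor_of_mem_adjoin hS hcancel
    (add_mem (Algebra.subset_adjoin ha) (Algebra.subset_adjoin hb))
  algebraMap_mem' c := isSmoothFor_of_mem_adjoin hS hcancel (Subalgebra.algebraMap_mem _ c)

theorem isSmoothFor_of_mem_span (hS : 0 ≤ S) (hcancel : ∀ X : 𝔅, S * X * S = 0 → X = 0)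
    {𝒢 : Set 𝔅} (h𝒢 : ∀ G ∈ 𝒢, ∃ U ∈ Submodule.span (smoothSubalgebra hS hcancel) 𝒢,
      IsOrderOneCommutator S G U)
    (hT : T ∈ Submodule.span (smoothSubalgebra hS hcancel) 𝒢) : IsSmoothFor S T := by
  have hS𝒦 : S ∈ smoothSubalgebra hS hcancel := isSmoothFor_self
  have hmul : ∀ {K X : 𝔅}, K ∈ smoothSubalgebra hS hcancel →
      X ∈ Submodule.span (smoothSubalgebra hS hcancel) 𝒢 →
      K * X ∈ Submodule.span (smoothSubalgebra hS hcancel) 𝒢 := fun {K X} hK hX =>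
    Submodule.smul_mem _ (⟨K, hK⟩ : smoothSubalgebra hS hcancel) hX
  refine isSmoothFor_of_invariant (fun T hT => ?_) hT
  induction hT using Submodule.span_induction with
  | mem T hT => exact h𝒢 T hT
  | zero => exact ⟨0, zero_mem _, isOrderOneCommutator_zero_of_commute (.zero_left _)⟩
  | add T T' _ _ h h' =>
    obtain ⟨U, hU, hTU⟩ := h
    obtain ⟨U', hU', hTU'⟩ := h'
    exact ⟨U + U', add_mem hU hU', hTU.add hTU'⟩
  | smul K T hT h =>
    obtain ⟨U', hU', hTU'⟩ := h
    obtain ⟨U, hU, hU𝒦⟩ := IsSmoothFor.exists_isOrderOneCommutator (S := S) K.2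
    obtain ⟨C, hC, hKC⟩ := IsSmoothFor.exists_isInverseCommutator hS hcancel K.2
    exact ⟨_, add_mem (add_mem (sub_mem (hmul hU𝒦 hT) (hmul (mul_mem hU𝒦 hS𝒦) hU'))
      (hmul K.2 hU')) (hmul (mul_mem hC hS𝒦) hU'), hU.mul hTU' hKC⟩

end SmoothSubalgebra

/-! ### Self-adjointness and the bracket of an operator given on a core -/

section UnboundedOperator

variable {V : Type*} [NormedAddCommGroup V]

theorem exists_domain_of_mem_graph [Module ℂ V] {A : V →ₗ.[ℂ] V} {x y : V}
    (h : (x, y) ∈ A.graph) : ∃ hx : x ∈ A.domain, A ⟨x, hx⟩ = y := by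
  obtain ⟨z, rfl, hz⟩ := (LinearPMap.mem_graph_iff A).1 h
  exact ⟨z.2, hz⟩

theorem mem_graph_inverse_toPMap [Module ℂ V] {S : V →ₗ[ℂ] V} (hS : Function.Injective S)
    {x y : V} : (x, y) ∈ (S.toPMap ⊤).inverse.graph ↔ x = S y := by
  have hker : LinearMap.ker (S.toPMap ⊤).toFun = ⊥ :=
    LinearMap.ker_eq_bot.2 fun a b hab => Subtype.ext (hS hab)
  rw [LinearPMap.inverse_graph hker]
  simp [LinearPMap.mem_graph_iff, eq_comm]

variable [InnerProductSpace ℂ V]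

theorem IsInverseCommutator.isCommutator {A : V →ₗ.[ℂ] V} {S T C : V →L[ℂ] V}
    (h : IsInverseCommutator S T C) (hA : ∀ x y, (x, y) ∈ A.graph ↔ x = S y) :
    IsCommutator A T C := by
  intro ψ
  have hψ : (ψ : V) = S (A ψ) := (hA _ _).1 (A.mem_graph ψ)
  have hTS : T (S (A ψ)) = S (T (A ψ) + C (S (A ψ))) := by
    have hcomm : T (S (A ψ)) - S (T (A ψ)) = S (C (S (A ψ))) := congr($h (A ψ))
    rw [map_add, ← hcomm, add_sub_cancel]
  rw [← hψ] at hTS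
  obtain ⟨hdom, happly⟩ := exists_domain_of_mem_graph ((hA _ _).2 hTS)
  exact ⟨hdom, by rw [happly, add_sub_cancel_left]⟩

variable [CompleteSpace V]

theorem mem_graph_adjoint_iff {A : V →ₗ.[ℂ] V} (hdense : Dense (A.domain : Set V)) {x y : V} :
    (x, y) ∈ A.adjoint.graph ↔ ∀ a b, (a, b) ∈ A.graph → inner ℂ b x = inner ℂ a y := by
  simp only [LinearPMap.adjoint_graph_eq_graph_adjoint hdense, Submodule.mem_adjoint_iff,
    sub_eq_zero]

theorem mem_graph_iff_of_isSelfAdjoint {A : V →ₗ.[ℂ] V} (hA : IsSelfAdjoint A) {x y : V} :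
    (x, y) ∈ A.graph ↔ ∀ a b, (a, b) ∈ A.graph → inner ℂ b x = inner ℂ a y := by
  rw [← mem_graph_adjoint_iff hA.dense_domain, LinearPMap.isSelfAdjoint_def.1 hA]

theorem isSelfAdjoint_of_surjective {A : V →ₗ.[ℂ] V} (hdense : Dense (A.domain : Set V))
    (hsymm : ∀ x y x' y', (x, y) ∈ A.graph → (x', y') ∈ A.graph → inner ℂ y x' = inner ℂ x y')
    (c : ℂ) (hc : ∀ z, ∃ x y, (x, y) ∈ A.graph ∧ y + c • x = z)
    (hc_conj : ∀ z, ∃ x y, (x, y) ∈ A.graph ∧ y + (starRingEnd ℂ) c • x = z) :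
    IsSelfAdjoint A := by
  refine LinearPMap.isSelfAdjoint_def.2 (LinearPMap.eq_of_eq_graph (Submodule.ext ?_))
  rintro ⟨y, z⟩
  rw [mem_graph_adjoint_iff hdense]
  refine ⟨fun hyz => ?_, fun hyz a b hab => hsymm _ _ _ _ hab hyz⟩
  obtain ⟨w, v, hwv, hw⟩ := hc (z + c • y)
  obtain ⟨x, u, hxu, hx⟩ := hc_conj (y - w)
  have hzero : inner ℂ (y - w) (y - w) = 0 := by
    have hxw : inner ℂ x (z + c • y) = inner ℂ x (v + c • w) := by rw [hw]
    simp only [inner_add_right, inner_smul_right] at hxw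
    nth_rewrite 1 [← hx]
    simp only [inner_add_left, inner_sub_right, inner_smul_left, hyz _ _ hxu,
      hsymm _ _ _ _ hxu hwv, Complex.conj_conj]
    linear_combination hxw
  obtain rfl : y = w := sub_eq_zero.1 (inner_self_eq_zero.1 hzero)
  rwa [← add_right_cancel hw]

theorem isSelfAdjoint_inverse_toPMap {S : V →L[ℂ] V} (hS : Function.Injective S)
    (hrange : DenseRange S) (hsymm : (S : V →ₗ[ℂ] V).IsSymmetric) :
    IsSelfAdjoint ((S : V →ₗ[ℂ] V).toPMap ⊤).inverse := by
  have hgraph := fun x y : V => mem_graph_inverse_toPMap (S := (S : V →ₗ[ℂ] V)) hS (x := x) (y := y)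
  refine isSelfAdjoint_of_surjective (hrange.mono ?_) ?_ 0
    (fun z => ⟨S z, z, (hgraph _ _).2 rfl, by simp⟩)
    (fun z => ⟨S z, z, (hgraph _ _).2 rfl, by simp⟩)
  · rintro _ ⟨ψ, rfl⟩
    exact LinearPMap.mem_domain_of_mem_graph ((hgraph _ _).2 rfl)
  · intro x y x' y' hxy hxy'
    rw [(hgraph _ _).1 hxy, (hgraph _ _).1 hxy']
    exact (hsymm y y').symm

/-- The inverse `χ ↦ φ` of `A` is defined everywhere and symmetric, hence bounded by
Hellinger–Toeplitz, and it is the nonnegative square root of `R`. -/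
theorem mem_graph_of_sqRel_iff {A : V →ₗ.[ℂ] V} (hA : IsSelfAdjoint A)
    (hpos : ∀ ψ : A.domain, 0 ≤ (inner ℂ (ψ : V) (A ψ)).re) {R : V →L[ℂ] V}
    (hsq : ∀ ψ φ, SqRel A ψ φ ↔ ψ = R φ) (φ : V) : (CFC.sqrt R φ, φ) ∈ A.graph := by
  choose S hRS hS using fun φ => (hsq (R φ) φ).2 rfl
  have hinj : ∀ {x x' y : V}, (x, y) ∈ A.graph → (x', y) ∈ A.graph → x = x' := by
    intro x x' y hxy hxy'
    have hsub := A.graph.sub_mem hxy hxy'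
    simp only [Prod.mk_sub_mk, sub_self] at hsub
    have := (hsq _ 0).1 ⟨0, hsub, A.graph.zero_mem⟩
    rwa [map_zero, sub_eq_zero] at this
  let L : V →ₗ[ℂ] V :=
    { toFun := S
      map_add' := fun x y => hinj (hS _) (A.graph.add_mem (hS x) (hS y))
      map_smul' := fun c x => hinj (hS _) (A.graph.smul_mem c (hS x)) }
  have hsymm : L.IsSymmetric := fun x y =>
    ((mem_graph_iff_of_isSelfAdjoint hA).1 (hS y) _ _ (hS x)).symm
  let B : V →L[ℂ] V := ⟨L, hsymm.continuous⟩
  have hB : 0 ≤ B := by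
    rw [ContinuousLinearMap.nonneg_iff_isPositive]
    refine ⟨hsymm, fun x => ?_⟩
    obtain ⟨hx, hAx⟩ := exists_domain_of_mem_graph (hS x)
    rw [ContinuousLinearMap.reApplyInnerSelf_apply]
    have := hpos ⟨S x, hx⟩
    rwa [hAx] at this
  have hBR : B * B = R := by
    ext φ
    exact hinj (hS _) (hRS φ)
  rw [CFC.sqrt_unique hBR hB]
  exact hS φ

end UnboundedOperator

section CoreOperator

variable {V : Type*} [NormedAddCommGroup V] [InnerProductSpace ℂ V]
  {𝒮 : Type*} [AddCommGroup 𝒮] [Module ℂ 𝒮]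

theorem inner_sq_add_one {j : 𝒮 →ₗ[ℂ] V} {D₀ : 𝒮 →ₗ[ℂ] 𝒮}
    (hsymm : ∀ φ ψ, inner ℂ (j (D₀ φ)) (j ψ) = inner ℂ (j φ) (j (D₀ ψ))) (ψ : 𝒮) :
    inner ℂ (j ψ) (j (D₀ (D₀ ψ) + ψ)) = ((‖j (D₀ ψ)‖ ^ 2 + ‖j ψ‖ ^ 2 : ℝ) : ℂ) := by
  rw [map_add, inner_add_right, ← hsymm, inner_self_eq_norm_sq_to_K, inner_self_eq_norm_sq_to_K]
  push_cast
  rfl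

/-- `D` is the closure of the symmetric operator `D₀`, which is defined on the space `𝒮` mapped
into `V` by `j`, and `D₀² + 1` has dense range. Together these make `D` self-adjoint, with core
`j 𝒮`. -/
structure IsClosureOf (j : 𝒮 →ₗ[ℂ] V) (D₀ : 𝒮 →ₗ[ℂ] 𝒮) (D : V →ₗ.[ℂ] V) : Prop where
  dense : DenseRange j
  symm : ∀ φ ψ, inner ℂ (j (D₀ φ)) (j ψ) = inner ℂ (j φ) (j (D₀ ψ))
  dense_sq : DenseRange (j ∘ₗ (D₀ * D₀ + 1))
  graph_eq : (D.graph : Set (V × V)) = closure (Set.range fun ψ => (j ψ, j (D₀ ψ)))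

namespace IsClosureOf

variable {j : 𝒮 →ₗ[ℂ] V} {D₀ : 𝒮 →ₗ[ℂ] 𝒮} {D : V →ₗ.[ℂ] V}

theorem norm_sq_add_norm_sq_le (h : IsClosureOf j D₀ D) (ψ : 𝒮) :
    ‖j (D₀ ψ)‖ ^ 2 + ‖j ψ‖ ^ 2 ≤ ‖j ψ‖ * ‖j (D₀ (D₀ ψ) + ψ)‖ := by
  have := norm_inner_le_norm (𝕜 := ℂ) (j ψ) (j (D₀ (D₀ ψ) + ψ))
  rw [inner_sq_add_one h.symm, Complex.norm_real, Real.norm_of_nonneg (by positivity)] at this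
  exact this

theorem norm_le (h : IsClosureOf j D₀ D) (ψ : 𝒮) :
    ‖j ψ‖ ≤ 1 * ‖(j ∘ₗ (D₀ * D₀ + 1)) ψ‖ := by
  have := h.norm_sq_add_norm_sq_le ψ
  change ‖j ψ‖ ≤ 1 * ‖j (D₀ (D₀ ψ) + ψ)‖
  by_contra! hlt
  nlinarith [sq_nonneg ‖j (D₀ ψ)‖, norm_nonneg (j ψ), norm_nonneg (j (D₀ (D₀ ψ) + ψ))]

theorem norm_apply_le (h : IsClosureOf j D₀ D) (ψ : 𝒮) :
    ‖(j ∘ₗ D₀) ψ‖ ≤ 1 * ‖(j ∘ₗ (D₀ * D₀ + 1)) ψ‖ := by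
  have hsq := h.norm_sq_add_norm_sq_le ψ
  have hle := h.norm_le ψ
  change ‖j (D₀ ψ)‖ ≤ 1 * ‖j (D₀ (D₀ ψ) + ψ)‖
  change ‖j ψ‖ ≤ 1 * ‖j (D₀ (D₀ ψ) + ψ)‖ at hle
  rw [one_mul] at *
  refine le_of_sq_le_sq ?_ (norm_nonneg _)
  nlinarith [sq_nonneg ‖j ψ‖, norm_nonneg (j ψ), norm_nonneg (j (D₀ (D₀ ψ) + ψ))]

theorem denseRange_sq_add_one (h : IsClosureOf j D₀ D) :
    DenseRange fun ψ => j (D₀ (D₀ ψ) + ψ) :=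
  h.dense_sq

theorem isClosed_graph (h : IsClosureOf j D₀ D) : IsClosed (D.graph : Set (V × V)) := by
  rw [h.graph_eq]; exact isClosed_closure

theorem mem_graph (h : IsClosureOf j D₀ D) (ψ : 𝒮) : (j ψ, j (D₀ ψ)) ∈ D.graph := by
  rw [← SetLike.mem_coe, h.graph_eq]
  exact subset_closure ⟨ψ, rfl⟩

theorem graph_induction (h : IsClosureOf j D₀ D) {P : V → V → Prop}
    (hP : IsClosed {p : V × V | P p.1 p.2}) (hcore : ∀ ψ, P (j ψ) (j (D₀ ψ))) {x y : V}
    (hxy : (x, y) ∈ D.graph) : P x y := by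
  rw [← SetLike.mem_coe, h.graph_eq] at hxy
  exact closure_minimal (s := Set.range fun ψ => (j ψ, j (D₀ ψ)))
    (by rintro _ ⟨ψ, rfl⟩; exact hcore ψ) hP hxy

theorem inner_graph (h : IsClosureOf j D₀ D) {x y x' y' : V} (hxy : (x, y) ∈ D.graph)
    (hxy' : (x', y') ∈ D.graph) : inner ℂ y x' = inner ℂ x y' := by
  refine h.graph_induction (P := fun x y => inner ℂ y x' = inner ℂ x y')
    (isClosed_eq (by fun_prop) (by fun_prop)) (fun ψ => ?_) hxy
  refine h.graph_induction (P := fun x' y' => inner ℂ (j (D₀ ψ)) x' = inner ℂ (j ψ) y')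
    (isClosed_eq (by fun_prop) (by fun_prop)) (fun ψ' => h.symm ψ ψ') hxy'

theorem inner_commutator_of_core (h : IsClosureOf j D₀ D) {T C : V →L[ℂ] V}
    (hTC : ∀ φ ψ, inner ℂ (j (D₀ φ)) (T (j ψ)) - inner ℂ (j φ) (T (j (D₀ ψ))) =
      inner ℂ (j φ) (C (j ψ))) {x y x' y' : V} (hxy : (x, y) ∈ D.graph)
    (hxy' : (x', y') ∈ D.graph) : inner ℂ y (T x') - inner ℂ x (T y') = inner ℂ x (C x') := by
  refine h.graph_induction (P := fun x y => inner ℂ y (T x') - inner ℂ x (T y') =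
    inner ℂ x (C x')) (isClosed_eq (by fun_prop) (by fun_prop)) (fun φ => ?_) hxy
  exact h.graph_induction (P := fun x' y' => inner ℂ (j (D₀ φ)) (T x') -
    inner ℂ (j φ) (T y') = inner ℂ (j φ) (C x')) (isClosed_eq (by fun_prop) (by fun_prop))
    (fun ψ => hTC φ ψ) hxy'

theorem dense_domain (h : IsClosureOf j D₀ D) : Dense (D.domain : Set V) :=
  h.dense.mono (by
    rintro _ ⟨ψ, rfl⟩
    exact (exists_domain_of_mem_graph (h.mem_graph ψ)).1)

end IsClosureOf

variable [CompleteSpace V]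

/-- The bounded operator `(D² + 1)⁻¹`, as the extension of `j (D₀² ψ + ψ) ↦ j ψ`; meaningful when
`IsClosureOf j D₀ D` for some `D`. -/
noncomputable def sqResolvent (j : 𝒮 →ₗ[ℂ] V) (D₀ : 𝒮 →ₗ[ℂ] 𝒮) : V →L[ℂ] V :=
  j.extendOfNorm (j ∘ₗ (D₀ * D₀ + 1))

/-- The bounded operator `D (D² + 1)⁻¹`, as the extension of `j (D₀² ψ + ψ) ↦ j (D₀ ψ)`. -/
noncomputable def mulSqResolvent (j : 𝒮 →ₗ[ℂ] V) (D₀ : 𝒮 →ₗ[ℂ] 𝒮) : V →L[ℂ] V :=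
  (j ∘ₗ D₀).extendOfNorm (j ∘ₗ (D₀ * D₀ + 1))

namespace IsClosureOf

variable {j : 𝒮 →ₗ[ℂ] V} {D₀ : 𝒮 →ₗ[ℂ] 𝒮} {D : V →ₗ.[ℂ] V}

theorem sqResolvent_apply (h : IsClosureOf j D₀ D) (ψ : 𝒮) :
    sqResolvent j D₀ (j (D₀ (D₀ ψ) + ψ)) = j ψ :=
  LinearMap.extendOfNorm_eq h.dense_sq ⟨1, h.norm_le⟩ ψ

theorem mulSqResolvent_apply (h : IsClosureOf j D₀ D) (ψ : 𝒮) :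
    mulSqResolvent j D₀ (j (D₀ (D₀ ψ) + ψ)) = j (D₀ ψ) :=
  LinearMap.extendOfNorm_eq h.dense_sq ⟨1, h.norm_apply_le⟩ ψ

theorem mem_graph_resolvent (h : IsClosureOf j D₀ D) (φ : V) :
    (sqResolvent j D₀ φ, mulSqResolvent j D₀ φ) ∈ D.graph := by
  refine h.denseRange_sq_add_one.induction_on
    (p := fun φ => (sqResolvent j D₀ φ, mulSqResolvent j D₀ φ) ∈ D.graph) φ ?_ fun ψ => ?_
  · exact h.isClosed_graph.preimage (by fun_prop)
  · rw [h.sqResolvent_apply, h.mulSqResolvent_apply]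
    exact h.mem_graph ψ

theorem mem_graph_mulSqResolvent (h : IsClosureOf j D₀ D) (φ : V) :
    (mulSqResolvent j D₀ φ, φ - sqResolvent j D₀ φ) ∈ D.graph := by
  refine h.denseRange_sq_add_one.induction_on
    (p := fun φ => (mulSqResolvent j D₀ φ, φ - sqResolvent j D₀ φ) ∈ D.graph) φ ?_ fun ψ => ?_
  · exact h.isClosed_graph.preimage (by fun_prop)
  · rw [h.sqResolvent_apply, h.mulSqResolvent_apply, map_add, add_sub_cancel_right]
    exact h.mem_graph _

theorem isSelfAdjoint (h : IsClosureOf j D₀ D) : IsSelfAdjoint D := by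
  have key : ∀ c : ℂ, c * c = -1 → ∀ z, ∃ x y, (x, y) ∈ D.graph ∧ y + c • x = z := by
    intro c hc z
    refine ⟨_, _, D.graph.sub_mem (h.mem_graph_mulSqResolvent z)
      (D.graph.smul_mem c (h.mem_graph_resolvent z)), ?_⟩
    simp only [Prod.smul_fst, Prod.smul_snd, smul_sub, smul_smul, hc]
    module
  refine isSelfAdjoint_of_surjective h.dense_domain
    (fun _ _ _ _ hxy hxy' => h.inner_graph hxy hxy') Complex.I (key _ Complex.I_mul_I) (key _ ?_)
  simp

theorem sqRel_iff (h : IsClosureOf j D₀ D) (ψ φ : V) :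
    SqRel D ψ (φ - ψ) ↔ ψ = sqResolvent j D₀ φ := by
  constructor
  · rintro ⟨χ, hψχ, hχφ⟩
    set v := ψ - sqResolvent j D₀ φ
    set w := χ - mulSqResolvent j D₀ φ
    have hvw : (v, w) ∈ D.graph := D.graph.sub_mem hψχ (h.mem_graph_resolvent φ)
    have hwv : (w, -v) ∈ D.graph := by
      have hsub := D.graph.sub_mem hχφ (h.mem_graph_mulSqResolvent φ)
      rwa [Prod.mk_sub_mk, sub_sub_sub_cancel_left, ← neg_sub ψ] at hsub
    have hinner := h.inner_graph hvw hwv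
    rw [inner_neg_right, inner_self_eq_norm_sq_to_K, inner_self_eq_norm_sq_to_K] at hinner
    have hnorm : ‖w‖ ^ 2 = -‖v‖ ^ 2 := by exact_mod_cast hinner
    have hv : ‖v‖ ^ 2 = 0 := by nlinarith [sq_nonneg ‖v‖, sq_nonneg ‖w‖]
    exact sub_eq_zero.1 (norm_eq_zero.1 (pow_eq_zero_iff two_ne_zero |>.1 hv))
  · rintro rfl
    exact ⟨_, h.mem_graph_resolvent φ, h.mem_graph_mulSqResolvent φ⟩

theorem sqResolvent_injective (h : IsClosureOf j D₀ D) :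
    Function.Injective (sqResolvent j D₀) := by
  refine (injective_iff_map_eq_zero _).2 fun φ hφ => ?_
  have hmul : mulSqResolvent j D₀ φ = 0 :=
    D.graph_fst_eq_zero_snd (h.mem_graph_resolvent φ) hφ
  have hsub := D.graph_fst_eq_zero_snd (h.mem_graph_mulSqResolvent φ) hmul
  rwa [hφ, sub_zero] at hsub

theorem sqResolvent_nonneg (h : IsClosureOf j D₀ D) : 0 ≤ sqResolvent j D₀ := by
  rw [ContinuousLinearMap.nonneg_iff_isPositive]
  refine ⟨fun x y => ?_, fun x => ?_⟩
  · simp only [ContinuousLinearMap.coe_coe]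
    have hx := h.inner_graph (h.mem_graph_resolvent x) (h.mem_graph_mulSqResolvent y)
    have hy := h.inner_graph (h.mem_graph_mulSqResolvent x) (h.mem_graph_resolvent y)
    rw [inner_sub_right] at hx
    rw [inner_sub_left] at hy
    linear_combination -hy - hx
  · rw [ContinuousLinearMap.reApplyInnerSelf_apply]
    have hinner := h.inner_graph (h.mem_graph_resolvent x) (h.mem_graph_mulSqResolvent x)
    rw [inner_sub_right, eq_sub_iff_add_eq, inner_self_eq_norm_sq_to_K,
      inner_self_eq_norm_sq_to_K] at hinner
    rw [← hinner]
    norm_cast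
    positivity

theorem inner_sqResolvent (h : IsClosureOf j D₀ D) (φ : 𝒮) (v : V) :
    inner ℂ (j (D₀ (D₀ φ) + φ)) (sqResolvent j D₀ v) = inner ℂ (j φ) v := by
  have hsymm := ((ContinuousLinearMap.nonneg_iff_isPositive _).1 h.sqResolvent_nonneg).isSymmetric
  rw [← h.sqResolvent_apply φ]
  exact (hsymm _ v).symm

end IsClosureOf

/-- The bounded operator `(D² + 1)^{-1/2}`: the inverse of `⟨D⟩`, in terms of which the domains of
`δⁿ` are described. -/
noncomputable def bracketInv (j : 𝒮 →ₗ[ℂ] V) (D₀ : 𝒮 →ₗ[ℂ] 𝒮) : V →L[ℂ] V :=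
  CFC.sqrt (sqResolvent j D₀)

namespace IsClosureOf

variable {j : 𝒮 →ₗ[ℂ] V} {D₀ : 𝒮 →ₗ[ℂ] 𝒮} {D : V →ₗ.[ℂ] V}

theorem bracketInv_nonneg : 0 ≤ bracketInv j D₀ := CFC.sqrt_nonneg _

theorem bracketInv_mul_self (h : IsClosureOf j D₀ D) :
    bracketInv j D₀ * bracketInv j D₀ = sqResolvent j D₀ :=
  CFC.sqrt_mul_sqrt_self _ h.sqResolvent_nonneg

theorem bracketInv_apply_apply (h : IsClosureOf j D₀ D) (φ : V) :
    bracketInv j D₀ (bracketInv j D₀ φ) = sqResolvent j D₀ φ := by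
  rw [← h.bracketInv_mul_self]; rfl

theorem isPositive_bracketInv : (bracketInv j D₀).IsPositive :=
  (ContinuousLinearMap.nonneg_iff_isPositive _).1 bracketInv_nonneg

theorem inner_bracketInv (φ ψ : V) :
    inner ℂ (bracketInv j D₀ φ) ψ = inner ℂ φ (bracketInv j D₀ ψ) :=
  isPositive_bracketInv.isSymmetric φ ψ

theorem bracketInv_injective (h : IsClosureOf j D₀ D) : Function.Injective (bracketInv j D₀) := by
  intro x y hxy
  apply h.sqResolvent_injective
  rw [← h.bracketInv_apply_apply, ← h.bracketInv_apply_apply, hxy]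

theorem denseRange_sqResolvent (h : IsClosureOf j D₀ D) : DenseRange (sqResolvent j D₀) :=
  h.dense.mono (by
    rintro _ ⟨ψ, rfl⟩
    exact ⟨_, h.sqResolvent_apply ψ⟩)

theorem denseRange_bracketInv (h : IsClosureOf j D₀ D) : DenseRange (bracketInv j D₀) :=
  h.denseRange_sqResolvent.mono (by
    rintro _ ⟨ψ, rfl⟩
    exact ⟨_, h.bracketInv_apply_apply ψ⟩)

theorem bracketInv_cancel (h : IsClosureOf j D₀ D) (X : V →L[ℂ] V)
    (hX : bracketInv j D₀ * X * bracketInv j D₀ = 0) : X = 0 := by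
  refine ContinuousLinearMap.coeFn_injective
    (h.denseRange_bracketInv.equalizer (by fun_prop) (by fun_prop) (funext fun φ => ?_))
  apply h.bracketInv_injective
  simpa using congr($hX φ)

theorem mem_graph_of_isBracket (h : IsClosureOf j D₀ D) {A : V →ₗ.[ℂ] V} (hA : IsBracket D A)
    (φ : V) : (bracketInv j D₀ φ, φ) ∈ A.graph :=
  mem_graph_of_sqRel_iff hA.1 hA.2.1 (fun ψ φ => (hA.2.2 ψ φ).trans (h.sqRel_iff ψ φ)) φ

theorem mem_graph_iff_of_isBracket (h : IsClosureOf j D₀ D) {A : V →ₗ.[ℂ] V} (hA : IsBracket D A)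
    {x y : V} : (x, y) ∈ A.graph ↔ x = bracketInv j D₀ y := by
  refine ⟨fun hxy => ?_, fun hxy => hxy ▸ h.mem_graph_of_isBracket hA y⟩
  have hsub := A.graph.sub_mem hxy (h.mem_graph_of_isBracket hA y)
  simp only [Prod.mk_sub_mk, sub_self] at hsub
  have hzero := (hA.2.2 _ 0).1 ⟨0, hsub, A.graph.zero_mem⟩
  rw [h.sqRel_iff, map_zero] at hzero
  exact sub_eq_zero.1 hzero

theorem isBracket_inverse_bracketInv (h : IsClosureOf j D₀ D) :
    IsBracket D ((bracketInv j D₀ : V →ₗ[ℂ] V).toPMap ⊤).inverse := by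
  have hgraph : ∀ x y, (x, y) ∈ ((bracketInv j D₀ : V →ₗ[ℂ] V).toPMap ⊤).inverse.graph ↔
      x = bracketInv j D₀ y := fun x y => mem_graph_inverse_toPMap h.bracketInv_injective
  refine ⟨isSelfAdjoint_inverse_toPMap h.bracketInv_injective h.denseRange_bracketInv
    isPositive_bracketInv.isSymmetric, fun ψ => ?_, fun ψ φ => ?_⟩
  · rw [(hgraph _ _).1 (LinearPMap.mem_graph _ ψ)]
    exact isPositive_bracketInv.2 _
  · rw [h.sqRel_iff]
    simp only [SqRel, hgraph]
    constructor
    · rintro ⟨χ, rfl, rfl⟩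
      exact h.bracketInv_apply_apply φ
    · rintro rfl
      exact ⟨_, (h.bracketInv_apply_apply φ).symm, rfl⟩

theorem existsUnique_isBracket (h : IsClosureOf j D₀ D) : ∃! A, IsBracket D A :=
  ⟨_, h.isBracket_inverse_bracketInv, fun _ hA => LinearPMap.eq_of_eq_graph (Submodule.ext
    fun _ => (h.mem_graph_iff_of_isBracket hA).trans
      (mem_graph_inverse_toPMap h.bracketInv_injective).symm)⟩

theorem memDomDeltaPow_of_isSmoothFor (h : IsClosureOf j D₀ D) {A : V →ₗ.[ℂ] V}
    (hA : IsBracket D A) (n : ℕ) {T : V →L[ℂ] V} (hT : IsSmoothFor (bracketInv j D₀) T) :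
    MemDomDeltaPow A n T := by
  induction n generalizing T with
  | zero => trivial
  | succ n ih =>
    obtain ⟨C, hC, hTC⟩ := hT.exists_isInverseCommutator (S := bracketInv j D₀)
      bracketInv_nonneg h.bracketInv_cancel
    exact ⟨C, hTC.isCommutator fun _ _ => h.mem_graph_iff_of_isBracket hA, ih hC⟩

theorem isCommutator_of_core (h : IsClosureOf j D₀ D) {T C : V →L[ℂ] V}
    (hTC : ∀ φ ψ, inner ℂ (j (D₀ φ)) (T (j ψ)) - inner ℂ (j φ) (T (j (D₀ ψ))) =
      inner ℂ (j φ) (C (j ψ))) : IsCommutator D T C := by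
  intro ψ
  have hgraph : (T (ψ : V), T (D ψ) + C ψ) ∈ D.graph :=
    (mem_graph_iff_of_isSelfAdjoint h.isSelfAdjoint).2 fun a b hab => by
      rw [inner_add_right, ← h.inner_commutator_of_core hTC hab (D.mem_graph ψ), add_sub_cancel]
  obtain ⟨hdom, happly⟩ := exists_domain_of_mem_graph hgraph
  exact ⟨hdom, by rw [happly, add_sub_cancel_left]⟩

end IsClosureOf

end CoreOperator

/-! ### Operators with bounded commutators with the generators of an oscillator -/

section Oscillator

variable {V : Type*} [NormedAddCommGroup V] [InnerProductSpace ℂ V]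
  {𝒮 : Type*} [AddCommGroup 𝒮] [Module ℂ 𝒮] {κ : Type*}

/-- `D₀² = ∑ X_k² + N` for symmetric generators `X_k` with scalar commutators `[X_i, X_k] = c_ik`,
and a potential `N` that commutes with them and is bounded for the norm of `V`. `N₀` is the
potential as an operator on the core. -/
structure IsOscillator [Fintype κ] (j : 𝒮 →ₗ[ℂ] V) (D₀ : 𝒮 →ₗ[ℂ] 𝒮) (D : V →ₗ.[ℂ] V)
    (X : κ → 𝒮 →ₗ[ℂ] 𝒮) (c : κ → κ → ℂ) (N₀ : 𝒮 →ₗ[ℂ] 𝒮) (N : V →L[ℂ] V) : Prop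
    extends IsClosureOf j D₀ D where
  symm_gen : ∀ k φ ψ, inner ℂ (j (X k φ)) (j ψ) = inner ℂ (j φ) (j (X k ψ))
  comm_gen : ∀ i k ψ, X i (X k ψ) - X k (X i ψ) = c i k • ψ
  sq_eq : ∀ ψ, D₀ (D₀ ψ) = (∑ k, X k (X k ψ)) + N₀ ψ
  comm_pot : ∀ k ψ, N₀ (X k ψ) = X k (N₀ ψ)
  pot_eq : ∀ ψ, j (N₀ ψ) = N (j ψ)

/-- `T'` is the commutator `[X, T]` in the sense of forms on the core, where `X` is symmetric; `T`
need not map the core to the domain of the closure of `X`. -/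
def IsWeakCommutator (j : 𝒮 →ₗ[ℂ] V) (X : 𝒮 →ₗ[ℂ] 𝒮) (T T' : V →L[ℂ] V) : Prop :=
  ∀ φ ψ, inner ℂ (j (X φ)) (T (j ψ)) - inner ℂ (j φ) (T (j (X ψ))) = inner ℂ (j φ) (T' (j ψ))

theorem IsWeakCommutator.inner_sq {j : 𝒮 →ₗ[ℂ] V} {X : 𝒮 →ₗ[ℂ] 𝒮} {T T' T'' : V →L[ℂ] V}
    (h : IsWeakCommutator j X T T') (h' : IsWeakCommutator j X T' T'') (φ ψ : 𝒮) :
    inner ℂ (j (X (X φ))) (T (j ψ)) - inner ℂ (j φ) (T (j (X (X ψ)))) =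
      2 * inner ℂ (j (X φ)) (T' (j ψ)) - inner ℂ (j φ) (T'' (j ψ)) := by
  linear_combination h (X φ) ψ + h φ (X ψ) - h' φ ψ

namespace IsOscillator

variable [Fintype κ] {j : 𝒮 →ₗ[ℂ] V} {D₀ : 𝒮 →ₗ[ℂ] 𝒮} {D : V →ₗ.[ℂ] V} {X : κ → 𝒮 →ₗ[ℂ] 𝒮}
  {c : κ → κ → ℂ} {N₀ : 𝒮 →ₗ[ℂ] 𝒮} {N : V →L[ℂ] V}

theorem sum_norm_gen_sq (h : IsOscillator j D₀ D X c N₀ N) (ψ : 𝒮) :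
    ∑ i, ‖j (X i ψ)‖ ^ 2 = ‖j (D₀ ψ)‖ ^ 2 - (inner ℂ (j ψ) (N (j ψ))).re := by
  have hinner : ∑ i, inner ℂ (j (X i ψ)) (j (X i ψ)) =
      inner ℂ (j (D₀ ψ)) (j (D₀ ψ)) - inner ℂ (j ψ) (N (j ψ)) := by
    simp_rw [h.symm_gen, h.symm]
    rw [← inner_sum, ← map_sum, h.sq_eq, map_add, inner_add_right, h.pot_eq]
    ring
  have hre := congr(Complex.re $hinner)
  rw [Complex.re_sum, Complex.sub_re] at hre
  simpa only [inner_self_eq_norm_sq_to_K, ← Complex.ofReal_pow, Complex.ofReal_re,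
    Complex.coe_algebraMap] using hre

theorem norm_gen_sq_le (h : IsOscillator j D₀ D X c N₀ N) (k : κ) (ψ : 𝒮) :
    ‖j (X k ψ)‖ ^ 2 ≤ ‖j (D₀ ψ)‖ ^ 2 + ‖N‖ * ‖j ψ‖ ^ 2 := by
  have hpot : |(inner ℂ (j ψ) (N (j ψ))).re| ≤ ‖N‖ * ‖j ψ‖ ^ 2 :=
    calc |(inner ℂ (j ψ) (N (j ψ))).re| ≤ ‖j ψ‖ * ‖N (j ψ)‖ :=
          (Complex.abs_re_le_norm _).trans (norm_inner_le_norm _ _)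
      _ ≤ ‖j ψ‖ * (‖N‖ * ‖j ψ‖) := by gcongr; exact N.le_opNorm _
      _ = ‖N‖ * ‖j ψ‖ ^ 2 := by ring
  have hsum := h.sum_norm_gen_sq ψ
  have hsingle := Finset.single_le_sum (f := fun i => ‖j (X i ψ)‖ ^ 2) (fun i _ => by positivity)
    (Finset.mem_univ k)
  linarith [neg_abs_le (inner ℂ (j ψ) (N (j ψ))).re]

theorem sq_gen (h : IsOscillator j D₀ D X c N₀ N) (k : κ) (ψ : 𝒮) :
    D₀ (D₀ (X k ψ)) = X k (D₀ (D₀ ψ)) + ∑ i, (2 * c i k) • X i ψ := by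
  have hswap : ∀ i ψ, X i (X k ψ) = X k (X i ψ) + c i k • ψ := fun i ψ => by
    rw [← h.comm_gen i k ψ]; abel
  have hsq : ∀ i, X i (X i (X k ψ)) = X k (X i (X i ψ)) + (2 * c i k) • X i ψ := fun i => by
    rw [hswap, map_add, map_smul, hswap]
    module
  rw [h.sq_eq, h.sq_eq, map_add, map_sum, h.comm_pot]
  simp_rw [hsq]
  rw [Finset.sum_add_distrib]
  abel

theorem inner_pot (h : IsOscillator j D₀ D X c N₀ N) (φ : 𝒮) (v : V) :
    inner ℂ (N (j φ)) v = inner ℂ (j φ) (N v) := by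
  refine h.dense.induction_on (p := fun v => inner ℂ (N (j φ)) v = inner ℂ (j φ) (N v)) v
    (isClosed_eq (by fun_prop) (by fun_prop)) fun ψ => ?_
  have hN : ∀ ψ, N (j ψ) = j (D₀ (D₀ ψ)) - ∑ k, j (X k (X k ψ)) := fun ψ => by
    rw [h.sq_eq, map_add, h.pot_eq, map_sum]; abel
  rw [hN, hN, inner_sub_left, inner_sub_right, sum_inner, inner_sum]
  simp_rw [h.symm, h.symm_gen]

theorem inner_sq_add_one_of_weak (h : IsOscillator j D₀ D X c N₀ N) {T : V →L[ℂ] V}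
    {T' T'' : κ → V →L[ℂ] V} (hT' : ∀ k, IsWeakCommutator j (X k) T (T' k))
    (hT'' : ∀ k, IsWeakCommutator j (X k) (T' k) (T'' k)) (φ ψ : 𝒮) :
    inner ℂ (j (D₀ (D₀ φ) + φ)) (T (j ψ)) - inner ℂ (j φ) (T (j (D₀ (D₀ ψ) + ψ))) =
      (∑ k, 2 * inner ℂ (j (X k φ)) (T' k (j ψ))) +
        inner ℂ (j φ) ((N * T - T * N - ∑ k, T'' k) (j ψ)) := by
  have hgen := Finset.sum_congr (rfl : (Finset.univ : Finset κ) = _) fun k _ =>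
    (hT' k).inner_sq (hT'' k) φ ψ
  rw [Finset.sum_sub_distrib, Finset.sum_sub_distrib] at hgen
  simp only [h.sq_eq, map_add, map_sum, h.pot_eq, inner_add_left, inner_add_right, inner_sub_right,
    sum_inner, inner_sum, sub_apply, sum_apply, mul_apply_eq_comp]
  linear_combination hgen + h.inner_pot φ (T (j ψ))

end IsOscillator

variable [CompleteSpace V]

/-- The bounded operator `X (D² + 1)^{-1/2}`, as the extension of
`(D² + 1)^{-1/2} j (D₀² ψ + ψ) ↦ j (X ψ)`. -/
noncomputable def genBracketInv (j : 𝒮 →ₗ[ℂ] V) (D₀ X : 𝒮 →ₗ[ℂ] 𝒮) : V →L[ℂ] V :=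
  (j ∘ₗ X).extendOfNorm ((bracketInv j D₀).toLinearMap ∘ₗ j ∘ₗ (D₀ * D₀ + 1))

/-- The bounded operator `(D² + 1)^{-1/2} X`, as the adjoint of `X (D² + 1)^{-1/2}`; this is
meaningful for symmetric `X`. -/
noncomputable def bracketInvGen (j : 𝒮 →ₗ[ℂ] V) (D₀ X : 𝒮 →ₗ[ℂ] 𝒮) : V →L[ℂ] V :=
  ContinuousLinearMap.adjoint (genBracketInv j D₀ X)

theorem IsClosureOf.norm_bracketInv_sq {j : 𝒮 →ₗ[ℂ] V} {D₀ : 𝒮 →ₗ[ℂ] 𝒮} {D : V →ₗ.[ℂ] V}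
    (h : IsClosureOf j D₀ D) (ψ : 𝒮) :
    ‖bracketInv j D₀ (j (D₀ (D₀ ψ) + ψ))‖ ^ 2 = ‖j (D₀ ψ)‖ ^ 2 + ‖j ψ‖ ^ 2 := by
  have hinner := inner_bracketInv (j := j) (D₀ := D₀)
    (bracketInv j D₀ (j (D₀ (D₀ ψ) + ψ))) (j (D₀ (D₀ ψ) + ψ))
  rw [h.bracketInv_apply_apply, h.sqResolvent_apply, inner_sq_add_one h.symm,
    inner_self_eq_norm_sq_to_K] at hinner
  exact Complex.ofReal_injective (by rw [Complex.ofReal_pow]; exact hinner.symm)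

theorem IsClosureOf.denseRange_bracketInv_sq_add_one {j : 𝒮 →ₗ[ℂ] V} {D₀ : 𝒮 →ₗ[ℂ] 𝒮}
    {D : V →ₗ.[ℂ] V} (h : IsClosureOf j D₀ D) :
    DenseRange ((bracketInv j D₀).toLinearMap ∘ₗ j ∘ₗ (D₀ * D₀ + 1)) :=
  h.denseRange_bracketInv.comp h.dense_sq (bracketInv j D₀).continuous

namespace IsOscillator

variable [Fintype κ] {j : 𝒮 →ₗ[ℂ] V} {D₀ : 𝒮 →ₗ[ℂ] 𝒮} {D : V →ₗ.[ℂ] V} {X : κ → 𝒮 →ₗ[ℂ] 𝒮}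
  {c : κ → κ → ℂ} {N₀ : 𝒮 →ₗ[ℂ] 𝒮} {N : V →L[ℂ] V}

theorem norm_gen_le (h : IsOscillator j D₀ D X c N₀ N) (k : κ) (ψ : 𝒮) :
    ‖(j ∘ₗ X k) ψ‖ ≤ (1 + ‖N‖) *
      ‖((bracketInv j D₀).toLinearMap ∘ₗ j ∘ₗ (D₀ * D₀ + 1)) ψ‖ := by
  change ‖j (X k ψ)‖ ≤ (1 + ‖N‖) * ‖bracketInv j D₀ (j (D₀ (D₀ ψ) + ψ))‖
  refine le_of_sq_le_sq ?_ (by positivity)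
  have hN := norm_nonneg N
  calc ‖j (X k ψ)‖ ^ 2 ≤ ‖j (D₀ ψ)‖ ^ 2 + ‖N‖ * ‖j ψ‖ ^ 2 := h.norm_gen_sq_le k ψ
    _ ≤ (1 + ‖N‖) ^ 2 * ‖j (D₀ ψ)‖ ^ 2 + (1 + ‖N‖) ^ 2 * ‖j ψ‖ ^ 2 := by
        gcongr
        · exact le_mul_of_one_le_left (sq_nonneg _) (by nlinarith)
        · nlinarith
    _ = ((1 + ‖N‖) * ‖bracketInv j D₀ (j (D₀ (D₀ ψ) + ψ))‖) ^ 2 := by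
        rw [mul_pow, h.norm_bracketInv_sq, mul_add]

theorem genBracketInv_apply (h : IsOscillator j D₀ D X c N₀ N) (k : κ) (ψ : 𝒮) :
    genBracketInv j D₀ (X k) (bracketInv j D₀ (j (D₀ (D₀ ψ) + ψ))) = j (X k ψ) :=
  LinearMap.extendOfNorm_eq h.denseRange_bracketInv_sq_add_one ⟨_, h.norm_gen_le k⟩ ψ

theorem inner_bracketInv_bracketInvGen (h : IsOscillator j D₀ D X c N₀ N) (k : κ) (φ : 𝒮) (v : V) :
    inner ℂ (bracketInv j D₀ (j (D₀ (D₀ φ) + φ))) (bracketInvGen j D₀ (X k) v) =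
      inner ℂ (j (X k φ)) v := by
  rw [bracketInvGen, ContinuousLinearMap.adjoint_inner_right, h.genBracketInv_apply]

theorem bracketInvGen_apply (h : IsOscillator j D₀ D X c N₀ N) (k : κ) (ψ : 𝒮) :
    bracketInvGen j D₀ (X k) (j ψ) = bracketInv j D₀ (j (X k ψ)) := by
  refine h.denseRange_bracketInv_sq_add_one.eq_of_inner_left ℂ fun φ => ?_
  change inner ℂ _ (bracketInv j D₀ (j (D₀ (D₀ φ) + φ))) =
    inner ℂ _ (bracketInv j D₀ (j (D₀ (D₀ φ) + φ)))
  rw [← inner_conj_symm, h.inner_bracketInv_bracketInvGen, h.symm_gen,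
    IsClosureOf.inner_bracketInv, h.bracketInv_apply_apply, h.sqResolvent_apply, inner_conj_symm]

theorem isOrderOneCommutator_bracketInvGen (h : IsOscillator j D₀ D X c N₀ N) (k : κ) :
    IsOrderOneCommutator (bracketInv j D₀) (bracketInvGen j D₀ (X k))
      (bracketInv j D₀ * ∑ i, (2 * c i k) • bracketInvGen j D₀ (X i)) := by
  rw [IsOrderOneCommutator, h.bracketInv_mul_self]
  refine ContinuousLinearMap.coeFn_injective
    (h.denseRange_sq_add_one.equalizer (by fun_prop) (by fun_prop) (funext fun ψ => ?_))
  have hcomm : ∀ v, sqResolvent j D₀ (bracketInv j D₀ v) = bracketInv j D₀ (sqResolvent j D₀ v) :=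
    fun v => by rw [← h.bracketInv_apply_apply, ← h.bracketInv_apply_apply]
  have hgen : X k (D₀ (D₀ ψ) + ψ) = (D₀ (D₀ (X k ψ)) + X k ψ) - ∑ i, (2 * c i k) • X i ψ := by
    rw [h.sq_gen, map_add]; abel
  simp only [Function.comp_apply, sub_apply, mul_apply_eq_comp, h.sqResolvent_apply,
    h.bracketInvGen_apply, sum_apply, smul_apply]
  rw [hgen, map_sub, hcomm, map_sub, h.sqResolvent_apply, map_sub, sub_sub_cancel,
    h.bracketInv_apply_apply, ← hcomm, map_sum, map_sum]
  simp only [map_smul]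

theorem exists_isOrderOneCommutator_of_mem_span (h : IsOscillator j D₀ D X c N₀ N) {T : V →L[ℂ] V}
    (hT : T ∈ Submodule.span ℂ (Set.range fun k => bracketInvGen j D₀ (X k))) :
    ∃ U ∈ Submodule.span ℂ (Set.range fun k => bracketInvGen j D₀ (X k)),
      IsOrderOneCommutator (bracketInv j D₀) T (bracketInv j D₀ * U) := by
  induction hT using Submodule.span_induction with
  | mem T hT =>
    obtain ⟨k, rfl⟩ := hT
    exact ⟨_, sum_mem fun i _ => Submodule.smul_mem _ _ (Submodule.subset_span ⟨i, rfl⟩),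
      h.isOrderOneCommutator_bracketInvGen k⟩
  | zero => exact ⟨0, zero_mem _, by simp [IsOrderOneCommutator]⟩
  | add T T' _ _ hT hT' =>
    obtain ⟨U, hU, hTU⟩ := hT
    obtain ⟨U', hU', hTU'⟩ := hT'
    exact ⟨U + U', add_mem hU hU', by rw [mul_add]; exact hTU.add hTU'⟩
  | smul z T _ hT =>
    obtain ⟨U, hU, hTU⟩ := hT
    refine ⟨z • U, Submodule.smul_mem _ _ hU, ?_⟩
    rw [IsOrderOneCommutator] at hTU ⊢
    simp only [smul_mul_assoc, mul_smul_comm, ← smul_sub, hTU]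

theorem isSmoothFor_bracketInvGen (h : IsOscillator j D₀ D X c N₀ N) (k : κ) :
    IsSmoothFor (bracketInv j D₀) (bracketInvGen j D₀ (X k)) := by
  set S := bracketInv j D₀
  set W := Submodule.span ℂ (Set.range fun k => bracketInvGen j D₀ (X k))
  refine isSmoothFor_of_invariant (𝒜 := {T | ∃ n : ℕ, ∃ B ∈ W, T = S ^ n * B}) ?_
    ⟨0, _, Submodule.subset_span ⟨k, rfl⟩, by simp⟩
  rintro _ ⟨n, B, hB, rfl⟩
  obtain ⟨U, hU, hBU⟩ : ∃ U ∈ W, IsOrderOneCommutator S B (S * U) :=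
    h.exists_isOrderOneCommutator_of_mem_span hB
  refine ⟨_, ⟨n + 1, U, hU, rfl⟩, ?_⟩
  rw [IsOrderOneCommutator] at hBU ⊢
  have hcomm : S * S * S ^ n = S ^ n * (S * S) := by rw [← sq, ← pow_add, ← pow_add, add_comm]
  calc S ^ n * B * (S * S) - S * S * (S ^ n * B)
      = S ^ n * (B * (S * S) - S * S * B) := by rw [← mul_assoc (S * S), hcomm]; noncomm_ring
    _ = S * (S ^ (n + 1) * U) * (S * S) := by
        rw [hBU, pow_succ']
        simp only [← mul_assoc, (Commute.self_pow S n).eq]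

theorem isOrderOneCommutator_of_weak (h : IsOscillator j D₀ D X c N₀ N) {T : V →L[ℂ] V}
    {T' T'' : κ → V →L[ℂ] V} (hT' : ∀ k, IsWeakCommutator j (X k) T (T' k))
    (hT'' : ∀ k, IsWeakCommutator j (X k) (T' k) (T'' k)) :
    IsOrderOneCommutator (bracketInv j D₀) T
      ((∑ k, (2 : ℂ) • (bracketInvGen j D₀ (X k) * T' k)) +
        bracketInv j D₀ * (N * T - T * N - ∑ k, T'' k)) := by
  rw [IsOrderOneCommutator, h.bracketInv_mul_self]
  refine ContinuousLinearMap.coeFn_injective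
    (h.denseRange_sq_add_one.equalizer (by fun_prop) (by fun_prop) (funext fun ψ => ?_))
  refine h.denseRange_sq_add_one.eq_of_inner_right ℂ fun φ => ?_
  have hcore := h.inner_sq_add_one_of_weak hT' hT'' φ ψ
  set K := N * T - T * N - ∑ k, T'' k
  simp only [Function.comp_apply, sub_apply, mul_apply_eq_comp, h.sqResolvent_apply, sum_apply,
    smul_apply, add_apply, map_add (bracketInv j D₀), inner_sub_right, inner_add_right,
    h.inner_sqResolvent, h.bracketInv_apply_apply]
  rw [← IsClosureOf.inner_bracketInv, inner_sum]
  simp_rw [inner_smul_right, h.inner_bracketInv_bracketInvGen]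
  exact hcore

/-- By `isOrderOneCommutator_of_weak`, `𝒢` generates a module over the algebra of smooth operators
that is stable under `T ↦ ⟨D⟩⁻¹ [⟨D⟩², T]`. -/
theorem isSmoothFor_of_weak (h : IsOscillator j D₀ D X c N₀ N) {𝒢 : Set (V →L[ℂ] V)}
    (hX : ∀ T ∈ 𝒢, ∀ k, ∃ T' ∈ 𝒢, IsWeakCommutator j (X k) T T')
    (hN : ∀ T ∈ 𝒢, N * T - T * N ∈ 𝒢) {T : V →L[ℂ] V} (hT : T ∈ Submodule.span ℂ 𝒢) :
    IsSmoothFor (bracketInv j D₀) T := by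
  have hS := IsClosureOf.bracketInv_nonneg (j := j) (D₀ := D₀)
  let 𝒦 := smoothSubalgebra hS h.bracketInv_cancel
  have hmul : ∀ {K T : V →L[ℂ] V}, K ∈ 𝒦 → T ∈ Submodule.span 𝒦 𝒢 → K * T ∈ Submodule.span 𝒦 𝒢 :=
    fun {K _} hK hT => Submodule.smul_mem _ (⟨K, hK⟩ : 𝒦) hT
  refine isSmoothFor_of_mem_span hS h.bracketInv_cancel (𝒢 := 𝒢) (fun G hG => ?_) ?_
  · choose T' hT' hT'w using hX G hG
    choose T'' hT'' hT''w using fun k => hX (T' k) (hT' k) k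
    refine ⟨_, ?_, h.isOrderOneCommutator_of_weak hT'w hT''w⟩
    refine add_mem (sum_mem fun k _ => ?_) (hmul isSmoothFor_self
      (sub_mem (Submodule.subset_span (hN G hG))
        (sum_mem fun k _ => Submodule.subset_span (hT'' k))))
    rw [← smul_mul_assoc]
    exact hmul (Subalgebra.smul_mem _ (h.isSmoothFor_bracketInvGen k) 2)
      (Submodule.subset_span (hT' k))
  · exact Submodule.span_subset_span ℂ 𝒦 𝒢 hT

end IsOscillator

end Oscillator

/-! ### Canonical anticommutation relations -/

section Fermions

variable {d : ℕ}

theorem annih_apply (μ : Fin d) (v : Fock d) (J : Finset (Fin d)) :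
    annih μ v J = if μ ∈ J then 0 else fermiSign μ J * v (insert μ J) := rfl

theorem creat_apply (μ : Fin d) (v : Fock d) (J : Finset (Fin d)) :
    creat μ v J = if μ ∈ J then fermiSign μ J * v (J.erase μ) else 0 := rfl

theorem fermiSign_insert {μ ν : Fin d} {J : Finset (Fin d)} (hν : ν ∉ J) :
    fermiSign μ (insert ν J) = (if ν < μ then -1 else 1) * fermiSign μ J := by
  unfold fermiSign
  rw [Finset.filter_insert]
  split_ifs with h
  · rw [Finset.card_insert_of_notMem (by simp [hν]), pow_succ]
    ring
  · rw [one_mul]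

theorem fermiSign_erase {μ ν : Fin d} {J : Finset (Fin d)} (hν : ν ∈ J) :
    fermiSign μ (J.erase ν) = (if ν < μ then -1 else 1) * fermiSign μ J := by
  have h := fermiSign_insert (μ := μ) (Finset.notMem_erase ν J)
  rw [Finset.insert_erase hν] at h
  rw [h, ← mul_assoc]
  split_ifs <;> simp

theorem fermiSign_mul_self (μ : Fin d) (J : Finset (Fin d)) :
    fermiSign μ J * fermiSign μ J = 1 := by
  unfold fermiSign
  rw [← mul_pow, neg_one_mul, neg_neg, one_pow]

theorem conj_fermiSign (μ : Fin d) (J : Finset (Fin d)) :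
    (starRingEnd ℂ) (fermiSign μ J) = fermiSign μ J := by
  simp [fermiSign]

theorem sign_lt_add_sign_gt {μ ν : Fin d} (h : μ ≠ ν) :
    (if μ < ν then (-1 : ℂ) else 1) + (if ν < μ then (-1 : ℂ) else 1) = 0 := by
  rcases lt_or_gt_of_ne h with h | h <;> simp [h, h.not_gt]

theorem annih_annih_of_notMem {μ ν : Fin d} {J : Finset (Fin d)} (hμν : μ ≠ ν) (hμ : μ ∉ J)
    (hν : ν ∉ J) (v : Fock d) :
    annih μ (annih ν v) J = (if μ < ν then -1 else 1) *
      (fermiSign μ J * fermiSign ν J * v (insert μ (insert ν J))) := by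
  rw [annih_apply, if_neg hμ, annih_apply, if_neg (by simp [hμν.symm, hν]), fermiSign_insert hμ,
    Finset.insert_comm ν μ]
  ring

theorem annih_mul_annih_add (μ ν : Fin d) : annih μ * annih ν + annih ν * annih μ = 0 := by
  ext v J
  change annih μ (annih ν v) J + annih ν (annih μ v) J = 0
  rcases eq_or_ne μ ν with rfl | hμν
  · simp [annih_apply]
  by_cases hμ : μ ∈ J
  · simp [annih_apply, hμ]
  by_cases hν : ν ∈ J
  · simp [annih_apply, hν]
  rw [annih_annih_of_notMem hμν hμ hν, annih_annih_of_notMem hμν.symm hν hμ, Finset.insert_comm ν]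
  linear_combination fermiSign μ J * fermiSign ν J * v (insert μ (insert ν J)) *
    sign_lt_add_sign_gt hμν

theorem annih_mul_creat_add_self (μ : Fin d) : annih μ * creat μ + creat μ * annih μ = 1 := by
  ext v J
  change annih μ (creat μ v) J + creat μ (annih μ v) J = v J
  by_cases hμ : μ ∈ J
  · simp only [annih_apply, creat_apply, hμ, if_true, Finset.notMem_erase, if_false,
      Finset.insert_erase hμ, fermiSign_erase hμ, lt_irrefl]
    linear_combination v J * fermiSign_mul_self μ J
  · simp only [annih_apply, creat_apply, hμ, if_false, Finset.mem_insert_self, if_true,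
      Finset.erase_insert hμ, fermiSign_insert hμ, lt_irrefl]
    linear_combination v J * fermiSign_mul_self μ J

theorem annih_mul_creat_add_of_ne {μ ν : Fin d} (hμν : μ ≠ ν) :
    annih μ * creat ν + creat ν * annih μ = 0 := by
  ext v J
  change annih μ (creat ν v) J + creat ν (annih μ v) J = 0
  by_cases hμ : μ ∈ J
  · simp [annih_apply, creat_apply, hμ, hμν]
  by_cases hν : ν ∈ J
  · rw [annih_apply, if_neg hμ, creat_apply, if_pos (Finset.mem_insert_of_mem hν), creat_apply,
      if_pos hν, annih_apply, if_neg (by simp [hμ]), fermiSign_insert hμ, fermiSign_erase hν,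
      Finset.erase_insert_of_ne hμν]
    linear_combination fermiSign μ J * fermiSign ν J * v (insert μ (J.erase ν)) *
      sign_lt_add_sign_gt hμν
  · simp [annih_apply, creat_apply, hν, hμν.symm]

theorem annih_mul_creat_add (μ ν : Fin d) :
    annih μ * creat ν + creat ν * annih μ = if μ = ν then 1 else 0 := by
  split_ifs with h
  · rw [h, annih_mul_creat_add_self]
  · exact annih_mul_creat_add_of_ne h

theorem inner_creat_left (μ : Fin d) (v w : Fock d) :
    inner ℂ (creat μ v) w = inner ℂ v (annih μ w) := by
  have hcreat : ∀ J, w J * (starRingEnd ℂ) (creat μ v J) =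
      if μ ∈ J then w J * (fermiSign μ J * (starRingEnd ℂ) (v (J.erase μ))) else 0 := fun J => by
    rw [creat_apply]
    split_ifs <;> simp [conj_fermiSign]
  have hannih : ∀ J, annih μ w J * (starRingEnd ℂ) (v J) =
      if μ ∉ J then fermiSign μ J * w (insert μ J) * (starRingEnd ℂ) (v J) else 0 := fun J => by
    rw [annih_apply]
    split_ifs <;> simp_all
  simp only [PiLp.inner_apply, RCLike.inner_apply, hcreat, hannih]
  rw [← Finset.sum_filter, ← Finset.sum_filter]
  refine Finset.sum_nbij' (fun J => J.erase μ) (fun J => insert μ J) (by simp) (by simp)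
    (fun J hJ => Finset.insert_erase (Finset.mem_filter.1 hJ).2)
    (fun J hJ => Finset.erase_insert (Finset.mem_filter.1 hJ).2) fun J hJ => ?_
  have hμ := (Finset.mem_filter.1 hJ).2
  rw [Finset.insert_erase hμ, fermiSign_erase hμ, if_neg (lt_irrefl μ)]
  ring

theorem inner_annih_left (μ : Fin d) (v w : Fock d) :
    inner ℂ (annih μ v) w = inner ℂ v (creat μ w) := by
  rw [← inner_conj_symm, ← inner_creat_left, inner_conj_symm]

theorem creat_mul_creat_add (μ ν : Fin d) : creat μ * creat ν + creat ν * creat μ = 0 := by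
  ext1 v
  refine ext_inner_right ℂ fun w => ?_
  have hannih := congr(inner ℂ v ($(annih_mul_annih_add ν μ) w))
  change inner ℂ v (annih ν (annih μ w) + annih μ (annih ν w)) = inner ℂ v 0 at hannih
  change inner ℂ (creat μ (creat ν v) + creat ν (creat μ v)) w = inner ℂ 0 w
  simpa only [inner_add_left, inner_add_right, inner_creat_left, inner_zero_left,
    inner_zero_right] using hannih

/-- Self-adjoint operators that satisfy the Clifford relations `{Γ_i, Γ_k} = 2 δ_ik`. -/
structure IsClifford {E : Type*} [NormedAddCommGroup E] [InnerProductSpace ℂ E] {κ : Type*}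
    [DecidableEq κ] (Γ : κ → E →L[ℂ] E) : Prop where
  symm : ∀ k v w, inner ℂ (Γ k v) w = inner ℂ v (Γ k w)
  rel : ∀ i k, Γ i * Γ k + Γ k * Γ i = if i = k then (2 : ℂ) • 1 else 0

/-- The field operator `z b_μ^* + z̄ b_μ`. -/
noncomputable def fermiField (z : ℂ) (μ : Fin d) : Fock d →L[ℂ] Fock d :=
  z • creat μ + (starRingEnd ℂ) z • annih μ

theorem inner_fermiField_left (z : ℂ) (μ : Fin d) (v w : Fock d) :
    inner ℂ (fermiField z μ v) w = inner ℂ v (fermiField z μ w) := by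
  simp only [fermiField, smul_apply, add_apply, inner_add_left, inner_smul_left, inner_add_right,
    inner_smul_right, inner_creat_left, inner_annih_left, Complex.conj_conj]
  ring

theorem fermiField_mul_fermiField_add (z w : ℂ) (μ ν : Fin d) :
    fermiField z μ * fermiField w ν + fermiField w ν * fermiField z μ =
      if μ = ν then (z * (starRingEnd ℂ) w + (starRingEnd ℂ) z * w) • 1 else 0 := by
  calc fermiField z μ * fermiField w ν + fermiField w ν * fermiField z μ
      = (z * w) • (creat μ * creat ν + creat ν * creat μ) +
        ((starRingEnd ℂ) z * (starRingEnd ℂ) w) • (annih μ * annih ν + annih ν * annih μ) +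
        ((starRingEnd ℂ) z * w) • (annih μ * creat ν + creat ν * annih μ) +
        (z * (starRingEnd ℂ) w) • (annih ν * creat μ + creat μ * annih ν) := by
        simp only [fermiField, mul_add, add_mul, smul_mul_assoc, mul_smul_comm]
        module
    _ = if μ = ν then (z * (starRingEnd ℂ) w + (starRingEnd ℂ) z * w) • 1 else 0 := by
        rw [creat_mul_creat_add, annih_mul_annih_add, annih_mul_creat_add, annih_mul_creat_add]
        rcases eq_or_ne μ ν with rfl | hμν
        · simp only [if_true]
          module
        · simp only [if_neg hμν, if_neg hμν.symm]
          module

/-- The field operators `z₁ b_μ^* + z̄₁ b_μ` and `z₂ b_μ^* + z̄₂ b_μ` as one family: the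
coefficients of `∂_μ` and of `x_μ` in both Dirac operators have this form. -/
noncomputable def clifford (z₁ z₂ : ℂ) : Fin d ⊕ Fin d → Fock d →L[ℂ] Fock d
  | .inl μ => fermiField z₁ μ
  | .inr μ => fermiField z₂ μ

theorem isClifford_clifford {z₁ z₂ : ℂ} (h₁ : z₁ * (starRingEnd ℂ) z₁ = 1)
    (h₂ : z₂ * (starRingEnd ℂ) z₂ = 1)
    (h₁₂ : z₁ * (starRingEnd ℂ) z₂ + (starRingEnd ℂ) z₁ * z₂ = 0) :
    IsClifford (clifford (d := d) z₁ z₂) where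
  symm k v w := by cases k <;> exact inner_fermiField_left _ _ _ _
  rel i k := by
    have h₁₁ : z₁ * (starRingEnd ℂ) z₁ + (starRingEnd ℂ) z₁ * z₁ = 2 := by
      linear_combination 2 * h₁
    have h₂₂ : z₂ * (starRingEnd ℂ) z₂ + (starRingEnd ℂ) z₂ * z₂ = 2 := by
      linear_combination 2 * h₂
    have h₂₁ : z₂ * (starRingEnd ℂ) z₁ + (starRingEnd ℂ) z₂ * z₁ = 0 := by
      linear_combination h₁₂
    rcases i with μ | μ <;> rcases k with ν | ν <;>
    simp [clifford, fermiField_mul_fermiField_add, h₁₁, h₂₂, h₂₁, h₁₂]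

end Fermions

/-! ### The generators of the oscillator on Schwartz spinors -/

section Generators

variable {d : ℕ}

/-- The embedding of Schwartz spinors into `L²(ℝᵈ) ⊗ ⋀(ℂᵈ)`, the core map `j` of the abstract
oscillator. -/
noncomputable def toHilb : Spinor d →ₗ[ℂ] Hilb d :=
  (SchwartzMap.toLpCLM ℂ (Fock d) 2 (volume : Measure (Pt d))).toLinearMap

theorem denseRange_toHilb : DenseRange (toHilb (d := d)) :=
  SchwartzMap.denseRange_toLpCLM (by norm_num)

theorem coeFn_toHilb (ψ : Spinor d) : toHilb ψ =ᵐ[volume] ψ := ψ.coeFn_toLp 2 volume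

theorem inner_toHilb (φ ψ : Spinor d) :
    inner ℂ (toHilb φ) (toHilb ψ) = ∫ x, inner ℂ (φ x) (ψ x) :=
  SchwartzMap.inner_toL2_toL2_eq φ ψ volume

theorem hasTemperateGrowth_coord (μ : Fin d) :
    Function.HasTemperateGrowth fun x : Pt d => ((x μ : ℝ) : ℂ) :=
  (Complex.ofRealCLM ∘L EuclideanSpace.proj (𝕜 := ℝ) μ).hasTemperateGrowth

theorem positionOp_apply (μ : Fin d) (ψ : Spinor d) (x : Pt d) :
    positionOp μ ψ x = ((x μ : ℝ) : ℂ) • ψ x :=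
  SchwartzMap.smulLeftCLM_apply_apply (hasTemperateGrowth_coord μ) ψ x

theorem partialOp_apply (μ : Fin d) (ψ : Spinor d) (x : Pt d) :
    partialOp μ ψ x = fderiv ℝ ψ x (EuclideanSpace.single μ 1) :=
  SchwartzMap.lineDerivOp_apply_eq_fderiv _ _ _

theorem fiberOp_apply (B : Fock d →L[ℂ] Fock d) (ψ : Spinor d) (x : Pt d) :
    fiberOp B ψ x = B (ψ x) := rfl

theorem fiberOp_fiberOp (B C : Fock d →L[ℂ] Fock d) (ψ : Spinor d) :
    fiberOp B (fiberOp C ψ) = fiberOp (B * C) ψ := rfl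

theorem positionOp_comm (μ ν : Fin d) (ψ : Spinor d) :
    positionOp μ (positionOp ν ψ) = positionOp ν (positionOp μ ψ) := by
  ext1 x
  simp only [positionOp_apply, smul_smul, mul_comm]

theorem partialOp_comm (μ ν : Fin d) (ψ : Spinor d) :
    partialOp μ (partialOp ν ψ) = partialOp ν (partialOp μ ψ) := by
  ext1 x
  have hdiff : DifferentiableAt ℝ (fderiv ℝ ψ) x :=
    ((ψ.smooth 2).fderiv_right (m := 1) (by norm_num)).differentiable (by norm_num) x
  have hsecond (μ ν : Fin d) : partialOp μ (partialOp ν ψ) x =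
      fderiv ℝ (fderiv ℝ ψ) x (EuclideanSpace.single μ 1) (EuclideanSpace.single ν 1) := by
    have hcoe : (partialOp ν ψ : Pt d → Fock d) =
        fun y => fderiv ℝ ψ y (EuclideanSpace.single ν 1) := funext (partialOp_apply ν ψ)
    rw [partialOp_apply, hcoe, fderiv_clm_apply hdiff (by fun_prop)]
    simp
  rw [hsecond, hsecond]
  exact ((ψ.smooth 2).contDiffAt.isSymmSndFDerivAt (by simp)) _ _

theorem partialOp_positionOp (μ ν : Fin d) (ψ : Spinor d) :
    partialOp μ (positionOp ν ψ) - positionOp ν (partialOp μ ψ) = if μ = ν then ψ else 0 := by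
  ext1 x
  have hcoord : HasFDerivAt (fun x : Pt d => ((x ν : ℝ) : ℂ))
      (Complex.ofRealCLM ∘L EuclideanSpace.proj (𝕜 := ℝ) ν) x :=
    (Complex.ofRealCLM ∘L EuclideanSpace.proj (𝕜 := ℝ) ν).hasFDerivAt
  have hcoe : (positionOp ν ψ : Pt d → Fock d) =
      (fun x : Pt d => ((x ν : ℝ) : ℂ)) • (ψ : Pt d → Fock d) := funext (positionOp_apply ν ψ)
  rw [sub_apply, partialOp_apply, positionOp_apply, partialOp_apply, hcoe,
    (hcoord.smul (ψ.differentiableAt (x := x)).hasFDerivAt).fderiv]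
  rcases eq_or_ne μ ν with rfl | hμν
  · simp
  · simp [hμν, hμν.symm]

theorem fiberOp_positionOp (B : Fock d →L[ℂ] Fock d) (μ : Fin d) (ψ : Spinor d) :
    fiberOp B (positionOp μ ψ) = positionOp μ (fiberOp B ψ) := by
  ext1 x
  simp only [fiberOp_apply, positionOp_apply, map_smul]

theorem fiberOp_partialOp (B : Fock d →L[ℂ] Fock d) (μ : Fin d) (ψ : Spinor d) :
    fiberOp B (partialOp μ ψ) = partialOp μ (fiberOp B ψ) := by
  ext1 x
  have hcoe : (fiberOp B ψ : Pt d → Fock d) = (B.restrictScalars ℝ) ∘ ψ := rfl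
  rw [fiberOp_apply, partialOp_apply, partialOp_apply, hcoe,
    ((B.restrictScalars ℝ).hasFDerivAt.comp x ψ.differentiableAt.hasFDerivAt).fderiv]
  rfl

theorem inner_positionOp (μ : Fin d) (φ ψ : Spinor d) :
    inner ℂ (toHilb (positionOp μ φ)) (toHilb ψ) =
      inner ℂ (toHilb φ) (toHilb (positionOp μ ψ)) := by
  rw [inner_toHilb, inner_toHilb]
  congr 1 with x
  rw [positionOp_apply, positionOp_apply, inner_smul_left, inner_smul_right, Complex.conj_ofReal]

theorem inner_partialOp (μ : Fin d) (φ ψ : Spinor d) :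
    inner ℂ (toHilb (partialOp μ φ)) (toHilb ψ) = -inner ℂ (toHilb φ) (toHilb (partialOp μ ψ)) := by
  rw [inner_toHilb, inner_toHilb, eq_comm, neg_eq_iff_eq_neg]
  exact SchwartzMap.integral_bilinear_lineDerivOp_right_eq_neg_left (μ := volume) φ ψ
    (isBoundedBilinearMap_inner (𝕜 := ℂ) (E := Fock d)).toContinuousLinearMap
    (EuclideanSpace.single μ (1 : ℝ))

theorem inner_fiberOp {B B' : Fock d →L[ℂ] Fock d}
    (h : ∀ v w, inner ℂ (B v) w = inner ℂ v (B' w)) (φ ψ : Spinor d) :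
    inner ℂ (toHilb (fiberOp B φ)) (toHilb ψ) = inner ℂ (toHilb φ) (toHilb (fiberOp B' ψ)) := by
  rw [inner_toHilb, inner_toHilb]
  congr 1 with x
  exact h _ _

/-- The bounded operator `1 ⊗ B` on `L²(ℝᵈ) ⊗ ⋀(ℂᵈ)`, extending `fiberOp B`. -/
noncomputable def fiberHilb (B : Fock d →L[ℂ] Fock d) : Hilb d →L[ℂ] Hilb d :=
  ContinuousLinearMap.compLpL 2 (volume : Measure (Pt d)) B

theorem toHilb_fiberOp (B : Fock d →L[ℂ] Fock d) (ψ : Spinor d) :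
    toHilb (fiberOp B ψ) = fiberHilb B (toHilb ψ) := by
  apply Lp.ext
  filter_upwards [coeFn_toHilb (fiberOp B ψ), coeFn_toHilb ψ,
    ContinuousLinearMap.coeFn_compLpL (p := 2) (μ := volume) B (toHilb ψ)] with x hx hψ hB
  exact hx.trans ((congrArg B hψ.symm).trans hB.symm)

/-- The generators of the harmonic oscillator: the momenta `-i ∂_μ` (index `.inl μ`) and the scaled
positions `Ω x_μ` (index `.inr μ`). -/
noncomputable def gen (Ω : ℝ) : Fin d ⊕ Fin d → Spinor d →L[ℂ] Spinor d
  | .inl μ => (-Complex.I) • partialOp μ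
  | .inr μ => (Ω : ℂ) • positionOp μ

/-- The scalars `c_ik` of the canonical commutation relations `[X_i, X_k] = c_ik` between the
operators `X = gen Ω`. -/
noncomputable def genComm (Ω : ℝ) : Fin d ⊕ Fin d → Fin d ⊕ Fin d → ℂ
  | .inl μ, .inr ν => if μ = ν then -Complex.I * Ω else 0
  | .inr μ, .inl ν => if ν = μ then Complex.I * Ω else 0
  | _, _ => 0

theorem gen_comm (Ω : ℝ) (i k : Fin d ⊕ Fin d) (ψ : Spinor d) :
    gen Ω i (gen Ω k ψ) - gen Ω k (gen Ω i ψ) = genComm Ω i k • ψ := by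
  have hcanonical (μ ν : Fin d) :
      gen Ω (.inl μ) (gen Ω (.inr ν) ψ) - gen Ω (.inr ν) (gen Ω (.inl μ) ψ) =
        (if μ = ν then -Complex.I * Ω else 0) • ψ := by
    simp only [gen, smul_apply, map_smul]
    rw [smul_comm (Ω : ℂ) (-Complex.I), ← smul_sub, ← smul_sub, partialOp_positionOp]
    split_ifs
    · rw [smul_smul]
    · simp
  rcases i with μ | μ <;> rcases k with ν | ν
  · simp only [gen, smul_apply, map_smul, genComm]
    rw [partialOp_comm, sub_self, zero_smul]
  · exact hcanonical μ ν
  · rw [← neg_sub, hcanonical, genComm, ← neg_smul]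
    split_ifs <;> simp
  · simp only [gen, smul_apply, map_smul, genComm]
    rw [positionOp_comm, sub_self, zero_smul]

theorem inner_gen (Ω : ℝ) (k : Fin d ⊕ Fin d) (φ ψ : Spinor d) :
    inner ℂ (toHilb (gen Ω k φ)) (toHilb ψ) = inner ℂ (toHilb φ) (toHilb (gen Ω k ψ)) := by
  rcases k with μ | μ
  · simp only [gen, smul_apply, map_smul, inner_smul_left, inner_smul_right, inner_partialOp]
    simp
  · simp only [gen, smul_apply, map_smul, inner_smul_left, inner_smul_right, inner_positionOp]
    simp

theorem fiberOp_gen (Ω : ℝ) (B : Fock d →L[ℂ] Fock d) (k : Fin d ⊕ Fin d) (ψ : Spinor d) :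
    fiberOp B (gen Ω k ψ) = gen Ω k (fiberOp B ψ) := by
  rcases k with μ | μ
  · simp only [gen, smul_apply, map_smul, fiberOp_partialOp]
  · simp only [gen, smul_apply, map_smul, fiberOp_positionOp]

/-- The Dirac operator `∑_k X_k ⊗ Γ_k` with `X = gen Ω`; both Dirac operators of the theorem have
this form for a Clifford family `Γ`. -/
noncomputable def diracOf (Ω : ℝ) (Γ : Fin d ⊕ Fin d → Fock d →L[ℂ] Fock d) :
    Spinor d →L[ℂ] Spinor d :=
  ∑ k, gen Ω k ∘L fiberOp (Γ k)

theorem diracOf_apply (Ω : ℝ) (Γ : Fin d ⊕ Fin d → Fock d →L[ℂ] Fock d) (ψ : Spinor d) :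
    diracOf Ω Γ ψ = ∑ k, gen Ω k (fiberOp (Γ k) ψ) := by
  simp [diracOf, sum_apply]

/-- The zeroth order part of the square of `diracOf Ω Γ`, namely `½ ∑_{i,k} [X_i, X_k] Γ_i Γ_k`; the
relation `c_ki = -c_ik` is absorbed in the order of the two Clifford generators. -/
noncomputable def diracPot (Ω : ℝ) (Γ : Fin d ⊕ Fin d → Fock d →L[ℂ] Fock d) :
    Fock d →L[ℂ] Fock d :=
  ∑ i, ∑ k, (-(genComm Ω i k) / 2) • (Γ k * Γ i)

theorem fiberOp_sum {ι : Type*} (s : Finset ι) (B : ι → Fock d →L[ℂ] Fock d) (ψ : Spinor d) :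
    fiberOp (∑ i ∈ s, B i) ψ = ∑ i ∈ s, fiberOp (B i) ψ := by
  ext1 x
  simp [fiberOp_apply, sum_apply]

theorem fiberOp_add (B C : Fock d →L[ℂ] Fock d) (ψ : Spinor d) :
    fiberOp (B + C) ψ = fiberOp B ψ + fiberOp C ψ := rfl

theorem fiberOp_smul (c : ℂ) (B : Fock d →L[ℂ] Fock d) (ψ : Spinor d) :
    fiberOp (c • B) ψ = c • fiberOp B ψ := rfl

theorem diracOf_diracOf_eq_sum (Ω : ℝ) (Γ : Fin d ⊕ Fin d → Fock d →L[ℂ] Fock d) (ψ : Spinor d) :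
    diracOf Ω Γ (diracOf Ω Γ ψ) = ∑ i, ∑ k, gen Ω i (gen Ω k (fiberOp (Γ i * Γ k) ψ)) := by
  simp only [diracOf_apply, map_sum, fiberOp_gen, fiberOp_fiberOp]
  exact Finset.sum_comm

theorem gen_gen_fiberOp_symmetrize (Ω : ℝ) {Γ : Fin d ⊕ Fin d → Fock d →L[ℂ] Fock d}
    (hΓ : IsClifford Γ) (i k : Fin d ⊕ Fin d) (ψ : Spinor d) :
    gen Ω i (gen Ω k (fiberOp (Γ i * Γ k) ψ)) + gen Ω k (gen Ω i (fiberOp (Γ k * Γ i) ψ)) =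
      (if i = k then (2 : ℂ) • gen Ω i (gen Ω i ψ) else 0) +
        (-genComm Ω i k) • fiberOp (Γ k * Γ i) ψ := by
  calc gen Ω i (gen Ω k (fiberOp (Γ i * Γ k) ψ)) + gen Ω k (gen Ω i (fiberOp (Γ k * Γ i) ψ))
      = gen Ω i (gen Ω k (fiberOp (Γ i * Γ k + Γ k * Γ i) ψ)) -
          (gen Ω i (gen Ω k (fiberOp (Γ k * Γ i) ψ)) -
            gen Ω k (gen Ω i (fiberOp (Γ k * Γ i) ψ))) := by
        simp only [fiberOp_add, map_add]
        abel
    _ = (if i = k then (2 : ℂ) • gen Ω i (gen Ω i ψ) else 0) +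
          (-genComm Ω i k) • fiberOp (Γ k * Γ i) ψ := by
        rw [gen_comm, hΓ.rel, neg_smul, ← sub_eq_add_neg]
        split_ifs with hik
        · subst hik
          rw [fiberOp_smul, map_smul, map_smul]
          rfl
        · have hzero : fiberOp (0 : Fock d →L[ℂ] Fock d) ψ = 0 := rfl
          rw [hzero, map_zero, map_zero]

theorem diracOf_diracOf (Ω : ℝ) {Γ : Fin d ⊕ Fin d → Fock d →L[ℂ] Fock d} (hΓ : IsClifford Γ)
    (ψ : Spinor d) :
    diracOf Ω Γ (diracOf Ω Γ ψ) = (∑ k, gen Ω k (gen Ω k ψ)) + fiberOp (diracPot Ω Γ) ψ := by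
  have hpot : (2 : ℂ) • fiberOp (diracPot Ω Γ) ψ =
      ∑ i, ∑ k, (-genComm Ω i k) • fiberOp (Γ k * Γ i) ψ := by
    simp only [diracPot, fiberOp_sum, fiberOp_smul, Finset.smul_sum, smul_smul,
      mul_div_cancel₀ _ (two_ne_zero (α := ℂ))]
  apply smul_right_injective (Spinor d) (two_ne_zero (α := ℂ))
  calc (2 : ℂ) • diracOf Ω Γ (diracOf Ω Γ ψ)
      = ∑ i, ∑ k, (gen Ω i (gen Ω k (fiberOp (Γ i * Γ k) ψ)) +
          gen Ω k (gen Ω i (fiberOp (Γ k * Γ i) ψ))) := by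
        rw [diracOf_diracOf_eq_sum, two_smul]
        simp only [Finset.sum_add_distrib]
        congr 1
        exact Finset.sum_comm
    _ = (2 : ℂ) • ((∑ k, gen Ω k (gen Ω k ψ)) + fiberOp (diracPot Ω Γ) ψ) := by
        simp only [gen_gen_fiberOp_symmetrize Ω hΓ, Finset.sum_add_distrib, Finset.sum_ite_eq,
          Finset.mem_univ, if_true]
        rw [smul_add, ← Finset.smul_sum, hpot]

theorem inner_diracOf (Ω : ℝ) {Γ : Fin d ⊕ Fin d → Fock d →L[ℂ] Fock d} (hΓ : IsClifford Γ)
    (φ ψ : Spinor d) :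
    inner ℂ (toHilb (diracOf Ω Γ φ)) (toHilb ψ) = inner ℂ (toHilb φ) (toHilb (diracOf Ω Γ ψ)) := by
  simp only [diracOf_apply, map_sum, sum_inner, inner_sum]
  refine Finset.sum_congr rfl fun k _ => ?_
  rw [inner_gen, inner_fiberOp (hΓ.symm k), fiberOp_gen]

theorem diracCore₁_eq (Ω : ℝ) :
    diracCore₁ (d := d) Ω = diracOf Ω (clifford Complex.I 1) := by
  ext1 ψ
  simp only [diracOf_apply, Fintype.sum_sum_type, clifford, gen, diracCore₁, bosonA, bosonAStar,
    fermiField, fiberOp_add, fiberOp_smul, add_apply, sum_apply, ContinuousLinearMap.comp_apply,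
    smul_apply, neg_apply, map_add, map_smul, ← Finset.sum_add_distrib]
  refine Finset.sum_congr rfl fun μ _ => ?_
  simp only [Complex.conj_I, map_one]
  linear_combination (norm := module) Complex.I_mul_I • partialOp μ (fiberOp (creat μ) ψ) -
    Complex.I_mul_I • partialOp μ (fiberOp (annih μ) ψ)

theorem diracCore₂_eq (Ω : ℝ) :
    diracCore₂ (d := d) Ω = diracOf Ω (clifford (-1) (-Complex.I)) := by
  ext1 ψ
  simp only [diracOf_apply, Fintype.sum_sum_type, clifford, gen, diracCore₂, bosonA, bosonAStar,
    fermiField, fiberOp_add, fiberOp_smul, add_apply, sub_apply, sum_apply,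
    ContinuousLinearMap.comp_apply, smul_apply, neg_apply, map_add, map_smul,
    ← Finset.sum_add_distrib, Finset.smul_sum, ← Finset.sum_sub_distrib]
  refine Finset.sum_congr rfl fun μ _ => ?_
  simp only [Complex.conj_I, map_one, map_neg]
  module

theorem mem_graph_ofCore_iff (D : Spinor d →L[ℂ] Spinor d) (p : Hilb d × Hilb d) :
    p ∈ (ofCore D).graph ↔ ∃ ψ, (toHilb ψ, toHilb (D ψ)) = p := by
  have hvalue (ψ) (h : toHilb ψ ∈ (ofCore D).domain) : ofCore D ⟨toHilb ψ, h⟩ = toHilb (D ψ) := by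
    change toHilb (D ((LinearEquiv.ofInjective toHilb _).symm ⟨toHilb ψ, h⟩)) = _
    congr 2
    exact (LinearEquiv.symm_apply_eq _).2 (Subtype.ext rfl)
  rw [LinearPMap.mem_graph_iff]
  constructor
  · rintro ⟨⟨x, ψ, rfl⟩, hfst, hsnd⟩
    exact ⟨ψ, Prod.ext hfst ((hvalue ψ _).symm.trans hsnd)⟩
  · rintro ⟨ψ, rfl⟩
    exact ⟨⟨toHilb ψ, ⟨ψ, rfl⟩⟩, rfl, hvalue ψ _⟩

theorem isClosureOf_ofCore {D : Spinor d →L[ℂ] Spinor d}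
    (hsymm : ∀ φ ψ, inner ℂ (toHilb (D φ)) (toHilb ψ) = inner ℂ (toHilb φ) (toHilb (D ψ)))
    (hdense : DenseRange (toHilb ∘ₗ (D.toLinearMap * D.toLinearMap + 1))) :
    IsClosureOf toHilb D.toLinearMap (ofCore D).closure where
  dense := denseRange_toHilb
  symm := hsymm
  dense_sq := hdense
  graph_eq := by
    have hgraph : ((ofCore D).graph : Set (Hilb d × Hilb d)) =
        Set.range fun ψ => (toHilb ψ, toHilb (D ψ)) :=
      Set.ext fun p => mem_graph_ofCore_iff D p
    have hdom : Dense ((ofCore D).domain : Set (Hilb d)) := denseRange_toHilb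
    have hformal : (ofCore D).IsFormalAdjoint (ofCore D) := by
      intro x y
      obtain ⟨φ, hφ⟩ := (mem_graph_ofCore_iff D _).1 ((ofCore D).mem_graph x)
      obtain ⟨ψ, hψ⟩ := (mem_graph_ofCore_iff D _).1 ((ofCore D).mem_graph y)
      simp only [Prod.mk.injEq] at hφ hψ
      rw [← hφ.1, ← hφ.2, ← hψ.1, ← hψ.2]
      exact hsymm φ ψ
    have hclosable : (ofCore D).IsClosable :=
      LinearPMap.isClosable_iff_exists_closed_extension.2
        ⟨_, LinearPMap.adjoint_isClosed hdom, hformal.le_adjoint hdom⟩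
    rw [← hclosable.graph_closure_eq_closure_graph, Submodule.topologicalClosure_coe, hgraph]
    rfl

theorem isOscillator_diracOf (Ω : ℝ) {Γ : Fin d ⊕ Fin d → Fock d →L[ℂ] Fock d}
    (hΓ : IsClifford Γ)
    (hdense : DenseRange
      (toHilb ∘ₗ ((diracOf Ω Γ).toLinearMap * (diracOf Ω Γ).toLinearMap + 1))) :
    IsOscillator toHilb (diracOf Ω Γ).toLinearMap (ofCore (diracOf Ω Γ)).closure
      (fun k => (gen Ω k).toLinearMap) (genComm Ω) (fiberOp (diracPot Ω Γ)).toLinearMap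
      (fiberHilb (diracPot Ω Γ)) where
  toIsClosureOf := isClosureOf_ofCore (inner_diracOf Ω hΓ) hdense
  symm_gen := inner_gen Ω
  comm_gen := gen_comm Ω
  sq_eq := diracOf_diracOf Ω hΓ
  comm_pot := fiberOp_gen Ω _
  pot_eq := toHilb_fiberOp _

end Generators

/-! ### Gaussians -/

section Gaussian

variable {E : Type*} [NormedAddCommGroup E]

theorem exists_forall_one_add_pow_mul_exp_neg_le {a : ℝ} (ha : 0 < a) (N : ℕ) :
    ∃ C : ℝ, ∀ r : ℝ, 0 ≤ r → (1 + r) ^ N * Real.exp (-a * r ^ 2) ≤ C := by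
  refine ⟨N.factorial * Real.exp (1 + 1 / (4 * a)), fun r hr => ?_⟩
  have hpow : (1 + r) ^ N ≤ N.factorial * Real.exp (1 + r) := by
    have := Real.pow_div_factorial_le_exp (1 + r) (by positivity) N
    rwa [div_le_iff₀ (by positivity), mul_comm] at this
  have hexponent : 1 + r + -a * r ^ 2 ≤ 1 + 1 / (4 * a) := by
    have hsquare : 1 / (4 * a) - r + a * r ^ 2 = a * (r - 1 / (2 * a)) ^ 2 := by
      field_simp
      ring
    have hnonneg : 0 ≤ a * (r - 1 / (2 * a)) ^ 2 := by positivity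
    linarith
  calc (1 + r) ^ N * Real.exp (-a * r ^ 2)
      ≤ N.factorial * Real.exp (1 + r) * Real.exp (-a * r ^ 2) := by gcongr
    _ = N.factorial * Real.exp (1 + r + -a * r ^ 2) := by rw [mul_assoc, ← Real.exp_add]
    _ ≤ N.factorial * Real.exp (1 + 1 / (4 * a)) := by gcongr

theorem exists_norm_iteratedFDeriv_exp_comp_le [NormedSpace ℝ E] {f : E → ℝ}
    (hf : f.HasTemperateGrowth) (n : ℕ) :
    ∃ (m : ℕ) (C : ℝ), 0 ≤ C ∧ ∀ x, ‖iteratedFDeriv ℝ n (Real.exp ∘ f) x‖ ≤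
      C * (1 + ‖x‖) ^ m * Real.exp (f x) := by
  obtain ⟨m, K, hK, hbound⟩ := hf.norm_iteratedFDeriv_le_uniform n
  refine ⟨m * n, n.factorial * (1 + K) ^ n, by positivity, fun x => ?_⟩
  have hone : 1 ≤ (1 + K) * (1 + ‖x‖) ^ m :=
    one_le_mul_of_one_le_of_one_le (by linarith) (one_le_pow₀ (by linarith [norm_nonneg x]))
  calc ‖iteratedFDeriv ℝ n (Real.exp ∘ f) x‖
      ≤ n.factorial * Real.exp (f x) * ((1 + K) * (1 + ‖x‖) ^ m) ^ n := by
        refine norm_iteratedFDeriv_comp_le (N := ∞) Real.contDiff_exp hf.1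
          (by exact_mod_cast le_top) x (fun i _ => ?_) fun i hi hin => ?_
        · rw [norm_iteratedFDeriv_eq_norm_iteratedDeriv, iteratedDeriv_eq_iterate,
            Real.iter_deriv_exp, Real.norm_of_nonneg (Real.exp_pos _).le]
        · calc ‖iteratedFDeriv ℝ i f x‖ ≤ K * (1 + ‖x‖) ^ m := hbound i hin x
            _ ≤ (1 + K) * (1 + ‖x‖) ^ m := by
              gcongr
              linarith
            _ ≤ ((1 + K) * (1 + ‖x‖) ^ m) ^ i := le_self_pow₀ hone (by omega)
    _ = n.factorial * (1 + K) ^ n * (1 + ‖x‖) ^ (m * n) * Real.exp (f x) := by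
        rw [mul_pow, pow_mul]
        ring

variable [InnerProductSpace ℝ E]

/-- The Gaussian `exp (-a |x|²)` as a Schwartz function. -/
noncomputable def gaussian (a : ℝ) (ha : 0 < a) : 𝓢(E, ℝ) where
  toFun x := Real.exp (-a * ‖x‖ ^ 2)
  smooth' := Real.contDiff_exp.comp (contDiff_const.mul (contDiff_norm_sq ℝ))
  decay' k n := by
    obtain ⟨m, K, hK, hderiv⟩ := exists_norm_iteratedFDeriv_exp_comp_le
      ((Function.HasTemperateGrowth.const (-a)).mul (Function.hasTemperateGrowth_norm_sq E)) n
    obtain ⟨C, hC⟩ := exists_forall_one_add_pow_mul_exp_neg_le ha (k + m)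
    refine ⟨K * C, fun x => ?_⟩
    calc ‖x‖ ^ k * ‖iteratedFDeriv ℝ n (fun x : E => Real.exp (-a * ‖x‖ ^ 2)) x‖
        ≤ (1 + ‖x‖) ^ k * (K * (1 + ‖x‖) ^ m * Real.exp (-a * ‖x‖ ^ 2)) := by
          gcongr
          · linarith
          · exact hderiv x
      _ = K * ((1 + ‖x‖) ^ (k + m) * Real.exp (-a * ‖x‖ ^ 2)) := by ring
      _ ≤ K * C := by
          gcongr
          exact hC _ (norm_nonneg x)

theorem gaussian_apply {a : ℝ} (ha : 0 < a) (x : E) :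
    gaussian a ha x = Real.exp (-a * ‖x‖ ^ 2) := rfl

end Gaussian

/-! ### Hermite functions -/

section Hermite

variable {d : ℕ}

/-- The ground states `exp (-Ω |x|² / 2) v` of the oscillator, as a linear function of the
vector `v`. -/
noncomputable def groundState (Ω : ℝ) (hΩ : 0 < Ω) : Fock d →ₗ[ℂ] Spinor d where
  toFun v := SchwartzMap.postcompCLM (𝕜 := ℝ) (ContinuousLinearMap.toSpanSingleton ℝ v)
    (gaussian (Ω / 2) (half_pos hΩ))
  map_add' v w := by ext1 x; exact smul_add (gaussian (Ω / 2) (half_pos hΩ) x) v w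
  map_smul' c v := by ext1 x; exact smul_comm (gaussian (Ω / 2) (half_pos hΩ) x) c v

theorem groundState_apply {Ω : ℝ} (hΩ : 0 < Ω) (v : Fock d) (x : Pt d) :
    groundState Ω hΩ v x = Real.exp (-(Ω / 2) * ‖x‖ ^ 2) • v := rfl

theorem bosonA_groundState {Ω : ℝ} (hΩ : 0 < Ω) (μ : Fin d) (v : Fock d) :
    bosonA Ω μ (groundState Ω hΩ v) = 0 := by
  ext1 x
  have hderiv : HasFDerivAt (groundState Ω hΩ v)
      ((Real.exp (-(Ω / 2) * ‖x‖ ^ 2) • (-(Ω / 2)) • ((2 : ℕ) • (innerSL ℝ x))).smulRight v) x :=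
    (((hasStrictFDerivAt_norm_sq x).hasFDerivAt.const_mul (-(Ω / 2))).exp).smul_const v
  have hinner : (inner ℝ x (EuclideanSpace.single μ (1 : ℝ)) : ℝ) = x μ := by
    simp [EuclideanSpace.inner_single_right]
  change partialOp μ (groundState Ω hΩ v) x + (Ω : ℂ) • positionOp μ (groundState Ω hΩ v) x = 0
  rw [partialOp_apply, positionOp_apply, hderiv.fderiv, groundState_apply]
  simp only [ContinuousLinearMap.smulRight_apply, smul_apply, innerSL_apply_apply, hinner,
    smul_eq_mul, smul_smul, nsmul_eq_mul]
  rw [← Complex.ofReal_mul, Complex.coe_smul, smul_smul, ← add_smul]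
  convert zero_smul ℝ v
  push_cast
  ring

theorem bosonA_positionOp (Ω : ℝ) (μ ν : Fin d) (ψ : Spinor d) :
    bosonA Ω μ (positionOp ν ψ) = positionOp ν (bosonA Ω μ ψ) + if μ = ν then ψ else 0 := by
  rw [← partialOp_positionOp]
  simp only [bosonA, add_apply, smul_apply, map_add, map_smul, positionOp_comm μ ν]
  abel

/-- Polynomials of degree at most `n` times the Gaussian ground states: finite-dimensional spaces
that every `diracOf Ω Γ ∘ diracOf Ω Γ` leaves invariant. -/
noncomputable def hermite (Ω : ℝ) (hΩ : 0 < Ω) : ℕ → Submodule ℂ (Spinor d)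
  | 0 => LinearMap.range (groundState Ω hΩ)
  | n + 1 => hermite Ω hΩ n ⊔ ⨆ μ : Fin d, (hermite Ω hΩ n).map (positionOp μ).toLinearMap

variable {Ω : ℝ} (hΩ : 0 < Ω)

theorem hermite_le_succ (n : ℕ) : hermite (d := d) Ω hΩ n ≤ hermite Ω hΩ (n + 1) := le_sup_left

theorem positionOp_mem_hermite {n : ℕ} {ψ : Spinor d} (hψ : ψ ∈ hermite Ω hΩ n) (μ : Fin d) :
    positionOp μ ψ ∈ hermite Ω hΩ (n + 1) :=
  Submodule.mem_sup_right (Submodule.mem_iSup_of_mem μ (Submodule.mem_map_of_mem hψ))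

theorem hermite_succ_le {n : ℕ} {P : Submodule ℂ (Spinor d)} (hle : hermite Ω hΩ n ≤ P)
    (hposition : ∀ ψ ∈ hermite Ω hΩ n, ∀ μ, positionOp μ ψ ∈ P) : hermite Ω hΩ (n + 1) ≤ P :=
  sup_le hle (iSup_le fun μ => Submodule.map_le_iff_le_comap.2 fun ψ hψ => hposition ψ hψ μ)

instance finiteDimensional_hermite (n : ℕ) :
    FiniteDimensional ℂ (hermite (d := d) Ω hΩ n) := by
  induction n with
  | zero => exact inferInstanceAs (FiniteDimensional ℂ (LinearMap.range (groundState Ω hΩ)))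
  | succ n ih =>
    exact inferInstanceAs (FiniteDimensional ℂ ↥(hermite Ω hΩ n ⊔
      ⨆ μ : Fin d, (hermite Ω hΩ n).map (positionOp μ).toLinearMap))

theorem fiberOp_mem_hermite (B : Fock d →L[ℂ] Fock d) (n : ℕ) :
    ∀ ψ ∈ hermite Ω hΩ n, fiberOp B ψ ∈ hermite Ω hΩ n := by
  induction n with
  | zero =>
    rintro _ ⟨v, rfl⟩
    exact ⟨B v, by ext1 x; simp [fiberOp_apply, groundState_apply]⟩
  | succ n ih =>
    refine hermite_succ_le hΩ (P := (hermite Ω hΩ (n + 1)).comap (fiberOp B).toLinearMap)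
      (fun ψ hψ => hermite_le_succ hΩ n (ih ψ hψ)) fun ψ hψ μ => ?_
    change fiberOp B (positionOp μ ψ) ∈ hermite Ω hΩ (n + 1)
    rw [fiberOp_positionOp]
    exact positionOp_mem_hermite hΩ (ih ψ hψ) μ

theorem bosonA_eq_zero_of_mem_hermite_zero (μ : Fin d) {ψ : Spinor d} (hψ : ψ ∈ hermite Ω hΩ 0) :
    bosonA Ω μ ψ = 0 := by
  obtain ⟨v, rfl⟩ := hψ
  exact bosonA_groundState hΩ μ v

theorem bosonA_mem_hermite (μ : Fin d) (n : ℕ) :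
    ∀ ψ ∈ hermite Ω hΩ (n + 1), bosonA Ω μ ψ ∈ hermite Ω hΩ n := by
  suffices hstep : ∀ n, (∀ ψ ∈ hermite Ω hΩ n, bosonA Ω μ ψ ∈ hermite Ω hΩ n) →
      (∀ ψ ∈ hermite Ω hΩ n, ∀ ν, positionOp ν (bosonA Ω μ ψ) ∈ hermite Ω hΩ n) →
      ∀ ψ ∈ hermite Ω hΩ (n + 1), bosonA Ω μ ψ ∈ hermite Ω hΩ n by
    induction n with
    | zero =>
      refine hstep 0 (fun ψ hψ => ?_) (fun ψ hψ ν => ?_) <;>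
        simp [bosonA_eq_zero_of_mem_hermite_zero hΩ μ hψ]
    | succ n ih =>
      exact hstep (n + 1) (fun ψ hψ => hermite_le_succ hΩ n (ih ψ hψ))
        fun ψ hψ ν => positionOp_mem_hermite hΩ (ih ψ hψ) ν
  intro n hbosonA hposition
  refine hermite_succ_le hΩ (P := (hermite Ω hΩ n).comap (bosonA Ω μ).toLinearMap) hbosonA
    fun ψ hψ ν => ?_
  change bosonA Ω μ (positionOp ν ψ) ∈ hermite Ω hΩ n
  rw [bosonA_positionOp]
  refine add_mem (hposition ψ hψ ν) ?_
  split_ifs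
  · exact hψ
  · exact zero_mem _

theorem gen_sq_add_gen_sq (μ : Fin d) (ψ : Spinor d) :
    gen Ω (.inl μ) (gen Ω (.inl μ) ψ) + gen Ω (.inr μ) (gen Ω (.inr μ) ψ) =
      (2 * Ω : ℂ) • positionOp μ (bosonA Ω μ ψ) - bosonA Ω μ (bosonA Ω μ ψ) + (Ω : ℂ) • ψ := by
  have hcomm : partialOp μ (positionOp μ ψ) = ψ + positionOp μ (partialOp μ ψ) :=
    sub_eq_iff_eq_add.1 ((partialOp_positionOp μ μ ψ).trans (if_pos rfl))
  simp only [gen, bosonA, add_apply, smul_apply, map_add, map_smul, hcomm]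
  linear_combination (norm := module) Complex.I_mul_I • partialOp μ (partialOp μ ψ)

theorem diracOf_diracOf_mem_hermite {Γ : Fin d ⊕ Fin d → Fock d →L[ℂ] Fock d}
    (hΓ : IsClifford Γ) (n : ℕ) (ψ : Spinor d) (hψ : ψ ∈ hermite Ω hΩ n) :
    diracOf Ω Γ (diracOf Ω Γ ψ) ∈ hermite Ω hΩ n := by
  rw [diracOf_diracOf Ω hΓ, Fintype.sum_sum_type, ← Finset.sum_add_distrib]
  refine add_mem (Submodule.sum_mem _ fun μ _ => ?_) (fiberOp_mem_hermite hΩ _ n ψ hψ)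
  rw [gen_sq_add_gen_sq]
  refine add_mem ?_ (Submodule.smul_mem _ _ hψ)
  cases n with
  | zero => simp [bosonA_eq_zero_of_mem_hermite_zero hΩ μ hψ]
  | succ n =>
    have hA : bosonA Ω μ ψ ∈ hermite Ω hΩ n := bosonA_mem_hermite hΩ μ n ψ hψ
    refine sub_mem (Submodule.smul_mem _ _ (positionOp_mem_hermite hΩ hA μ)) ?_
    exact hermite_le_succ hΩ n (bosonA_mem_hermite hΩ μ n _ (hermite_le_succ hΩ n hA))

theorem eq_zero_of_diracOf_sq_add_one_eq_zero {Γ : Fin d ⊕ Fin d → Fock d →L[ℂ] Fock d}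
    (hΓ : IsClifford Γ) {φ : Spinor d} (hφ : diracOf Ω Γ (diracOf Ω Γ φ) + φ = 0) : φ = 0 := by
  have hinner := inner_sq_add_one (D₀ := (diracOf Ω Γ).toLinearMap) (inner_diracOf Ω hΓ) φ
  change inner ℂ _ (toHilb (diracOf Ω Γ (diracOf Ω Γ φ) + φ)) = _ at hinner
  rw [hφ, map_zero, inner_zero_right, eq_comm, Complex.ofReal_eq_zero] at hinner
  have hnorm : ‖toHilb φ‖ = 0 := by
    nlinarith [sq_nonneg ‖toHilb (diracOf Ω Γ φ)‖, sq_nonneg ‖toHilb φ‖]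
  exact SchwartzMap.injective_toLp 2 (volume : Measure (Pt d))
    ((norm_eq_zero.1 hnorm).trans (map_zero toHilb).symm)

theorem exists_diracOf_sq_add_one_eq {Γ : Fin d ⊕ Fin d → Fock d →L[ℂ] Fock d}
    (hΓ : IsClifford Γ) (n : ℕ) (ψ : Spinor d) (hψ : ψ ∈ hermite Ω hΩ n) :
    ∃ φ, diracOf Ω Γ (diracOf Ω Γ φ) + φ = ψ := by
  let A : Spinor d →ₗ[ℂ] Spinor d := (diracOf Ω Γ).toLinearMap * (diracOf Ω Γ).toLinearMap + 1
  have hA : ∀ φ ∈ hermite Ω hΩ n, A φ ∈ hermite Ω hΩ n := fun φ hφ =>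
    add_mem (diracOf_diracOf_mem_hermite hΩ hΓ n φ hφ) hφ
  have hinj : Function.Injective (A.restrict hA) := by
    rw [injective_iff_map_eq_zero]
    exact fun φ hφ => Subtype.ext
      (eq_zero_of_diracOf_sq_add_one_eq_zero hΓ (congrArg Subtype.val hφ))
  obtain ⟨φ, hφ⟩ := (LinearMap.injective_iff_surjective.1 hinj) ⟨ψ, hψ⟩
  exact ⟨φ, congrArg Subtype.val hφ⟩

end Hermite

/-! ### Density of the Hermite functions -/

section Moments

open FourierTransform

theorem integral_exp_mul_eq_zero {α : Type*} [MeasurableSpace α] {ν : Measure α} {h z : α → ℂ}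
    (hmeas : AEStronglyMeasurable h ν) (hz : AEStronglyMeasurable z ν)
    (hexp : Integrable (fun x => Real.exp ‖z x‖ * ‖h x‖) ν)
    (hmoment : ∀ n : ℕ, ∫ x, z x ^ n * h x ∂ν = 0) : ∫ x, Complex.exp (z x) * h x ∂ν = 0 := by
  have hseries : ∀ x, HasSum (fun n : ℕ => z x ^ n / (n.factorial : ℂ) * h x)
      (Complex.exp (z x) * h x) := fun x => by
    have hsum := NormedSpace.expSeries_div_hasSum_exp (z x)
    rw [← Complex.exp_eq_exp_ℂ] at hsum
    exact hsum.mul_right _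
  have hbound : ∀ (n : ℕ) (x : α), ‖z x ^ n / (n.factorial : ℂ) * h x‖ ≤
      ‖z x‖ ^ n / (n.factorial : ℝ) * ‖h x‖ := fun n x => by
    rw [norm_mul, norm_div, norm_pow, Complex.norm_natCast]
  have hsummable : ∀ x, Summable fun n : ℕ => ‖z x‖ ^ n / (n.factorial : ℝ) * ‖h x‖ :=
    fun x => (Real.summable_pow_div_factorial _).mul_right _
  have hdominated :
      Integrable (fun x => ∑' n : ℕ, ‖z x‖ ^ n / (n.factorial : ℝ) * ‖h x‖) ν := by
    refine hexp.congr (ae_of_all _ fun x => ?_)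
    simp only [tsum_mul_right, Real.exp_eq_exp_ℝ, NormedSpace.exp_eq_tsum_div]
  have hsum := hasSum_integral_of_dominated_convergence _
    (fun n => by fun_prop) (fun n => ae_of_all _ (hbound n))
    (ae_of_all _ hsummable) hdominated (ae_of_all _ hseries)
  have hterm : ∀ n : ℕ, ∫ x, z x ^ n / (n.factorial : ℂ) * h x ∂ν = 0 := fun n => by
    simp only [div_mul_eq_mul_div, integral_div, hmoment, zero_div]
  simp only [hterm] at hsum
  exact hsum.unique hasSum_zero

variable {E : Type*} [NormedAddCommGroup E] [InnerProductSpace ℝ E] [FiniteDimensional ℝ E]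
  [MeasurableSpace E] [BorelSpace E]

theorem ae_eq_zero_of_fourier_eq_zero {h : E → ℂ} (hint : Integrable h) (hzero : ∀ ξ, 𝓕 h ξ = 0) :
    ∀ᵐ x, h x = 0 := by
  refine ae_eq_zero_of_integral_contDiff_smul_eq_zero hint.locallyIntegrable fun g hg hsupp => ?_
  let G : 𝓢(E, ℂ) := SchwartzMap.postcompCLM (𝕜 := ℝ) Complex.ofRealCLM (hsupp.toSchwartzMap hg)
  have hG : ∀ x, 𝓕 (𝓕⁻ G : 𝓢(E, ℂ)) x = g x := fun x => by
    rw [FourierTransform.fourier_fourierInv_eq G]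
    rfl
  calc ∫ x, g x • h x = ∫ x, h x • 𝓕 (⇑(𝓕⁻ G : 𝓢(E, ℂ))) x := by
        congr 1 with x
        rw [← SchwartzMap.fourier_coe, hG, Complex.real_smul, smul_eq_mul, mul_comm]
    _ = ∫ ξ, 𝓕 h ξ • (𝓕⁻ G : 𝓢(E, ℂ)) ξ := by
        have hflip := VectorFourier.integral_fourierIntegral_smul_eq_flip (L := innerₗ E)
          (μ := volume) (ν := volume) Real.continuous_fourierChar continuous_inner hint
          (𝓕⁻ G : 𝓢(E, ℂ)).integrable
        rw [flip_innerₗ] at hflip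
        exact hflip.symm
    _ = 0 := by simp only [hzero, zero_smul, integral_zero]

theorem ae_eq_zero_of_moments_eq_zero {h : E → ℂ} (hmeas : AEStronglyMeasurable h)
    (hexp : ∀ c : ℝ, 0 ≤ c → Integrable fun x => Real.exp (c * ‖x‖) * ‖h x‖)
    (hmoment : ∀ (ξ : E) (n : ℕ), ∫ x, ((inner ℝ ξ x : ℝ) : ℂ) ^ n * h x = 0) :
    ∀ᵐ x, h x = 0 := by
  have hint : Integrable h := (hexp 0 le_rfl).mono' hmeas (ae_of_all _ fun x => by simp)
  refine ae_eq_zero_of_fourier_eq_zero hint fun ξ => ?_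
  let z : E → ℂ := fun x => ((-2 * Real.pi * inner ℝ ξ x : ℝ) : ℂ) * Complex.I
  have hz : Continuous z := by fun_prop
  have hznorm : ∀ x, ‖z x‖ ≤ 2 * Real.pi * ‖ξ‖ * ‖x‖ := fun x => by
    rw [norm_mul, Complex.norm_I, mul_one, Complex.norm_real, Real.norm_eq_abs, abs_mul, abs_mul,
      abs_neg, abs_of_pos Real.pi_pos, Nat.abs_ofNat, mul_assoc _ ‖ξ‖]
    exact mul_le_mul_of_nonneg_left (abs_real_inner_le_norm ξ x) (by positivity)
  have hzint : Integrable fun x => Real.exp ‖z x‖ * ‖h x‖ := by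
    refine (hexp (2 * Real.pi * ‖ξ‖) (by positivity)).mono'
      ((Real.continuous_exp.comp hz.norm).aestronglyMeasurable.mul hmeas.norm)
      (ae_of_all _ fun x => ?_)
    rw [Real.norm_of_nonneg (by positivity)]
    gcongr
    exact hznorm x
  have hzmoment : ∀ n : ℕ, ∫ x, z x ^ n * h x = 0 := fun n => by
    have hpow : ∀ x, z x ^ n * h x =
        (-2 * Real.pi * Complex.I) ^ n * (((inner ℝ ξ x : ℝ) : ℂ) ^ n * h x) := fun x => by
      rw [← mul_assoc, ← mul_pow]
      congr 2
      simp only [z]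
      push_cast
      ring
    simp only [hpow, integral_const_mul, hmoment, mul_zero]
  calc 𝓕 h ξ = ∫ x, Complex.exp (z x) * h x := by
        rw [Real.fourier_eq']
        congr 1 with x
        rw [smul_eq_mul, real_inner_comm]
    _ = 0 := integral_exp_mul_eq_zero hmeas hz.aestronglyMeasurable hzint hzmoment

end Moments

section HermiteDensity

variable {d : ℕ}

/-- Multiplication of Schwartz spinors by the linear function `⟨ξ, ·⟩`. -/
noncomputable def linearOp (ξ : Pt d) : Spinor d →L[ℂ] Spinor d :=
  ∑ μ, ((ξ μ : ℝ) : ℂ) • positionOp μ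

theorem linearOp_apply (ξ : Pt d) (ψ : Spinor d) (x : Pt d) :
    linearOp ξ ψ x = ((inner ℝ ξ x : ℝ) : ℂ) • ψ x := by
  have hinner : (inner ℝ ξ x : ℝ) = ∑ μ, ξ μ * x μ := by
    simp [PiLp.inner_apply, mul_comm]
  rw [hinner, Complex.ofReal_sum, Finset.sum_smul]
  simp only [linearOp, sum_apply, smul_apply, positionOp_apply, smul_smul, Complex.ofReal_mul]

theorem linearOp_pow_apply (ξ : Pt d) (n : ℕ) (ψ : Spinor d) (x : Pt d) :
    ((linearOp ξ)^[n] ψ) x = ((inner ℝ ξ x : ℝ) : ℂ) ^ n • ψ x := by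
  induction n with
  | zero => simp
  | succ n ih => rw [Function.iterate_succ_apply', linearOp_apply, ih, smul_smul, pow_succ']

theorem exp_mul_gaussian_le {Ω : ℝ} (hΩ : 0 < Ω) (c r : ℝ) :
    Real.exp (c * r) * Real.exp (-(Ω / 2) * r ^ 2) ≤
      Real.exp (c ^ 2 / Ω) * Real.exp (-(Ω / 4) * r ^ 2) := by
  rw [← Real.exp_add, ← Real.exp_add, Real.exp_le_exp]
  have hsquare : c ^ 2 / Ω - c * r + Ω / 4 * r ^ 2 = (Ω / 2 * r - c) ^ 2 / Ω := by
    field_simp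
    ring
  have hnonneg : 0 ≤ (Ω / 2 * r - c) ^ 2 / Ω := by positivity
  nlinarith

theorem integrable_exp_mul_norm_gaussian_mul_inner {Ω : ℝ} (hΩ : 0 < Ω) (φ : Hilb d)
    (v : Fock d) (c : ℝ) :
    Integrable fun x => Real.exp (c * ‖x‖) *
      ‖((Real.exp (-(Ω / 2) * ‖x‖ ^ 2) : ℝ) : ℂ) * inner ℂ v (φ x)‖ := by
  have hΩ4 : 0 < Ω / 4 := by positivity
  have hL2 : MemLp (fun x => gaussian (E := Pt d) (Ω / 4) hΩ4 x) 2 volume :=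
    SchwartzMap.memLp _ 2 volume
  have hint : Integrable fun x => gaussian (E := Pt d) (Ω / 4) hΩ4 x * ‖φ x‖ :=
    hL2.integrable_mul (Lp.memLp φ).norm
  have hexpc : Continuous fun x : Pt d => Real.exp (c * ‖x‖) := by fun_prop
  have hgauss : Continuous fun x : Pt d => ((Real.exp (-(Ω / 2) * ‖x‖ ^ 2) : ℝ) : ℂ) := by fun_prop
  have hφ : AEStronglyMeasurable (fun x => inner ℂ v (φ x)) volume :=
    (Lp.aestronglyMeasurable φ).const_inner
  refine (hint.const_mul (Real.exp (c ^ 2 / Ω) * ‖v‖)).mono'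
    (hexpc.aestronglyMeasurable.mul (hgauss.aestronglyMeasurable.mul hφ).norm)
    (ae_of_all _ fun x => ?_)
  rw [gaussian_apply, Real.norm_of_nonneg (by positivity), norm_mul, Complex.norm_real,
    Real.norm_of_nonneg (Real.exp_pos _).le, ← mul_assoc]
  calc Real.exp (c * ‖x‖) * Real.exp (-(Ω / 2) * ‖x‖ ^ 2) * ‖inner ℂ v (φ x)‖
      ≤ Real.exp (c ^ 2 / Ω) * Real.exp (-(Ω / 4) * ‖x‖ ^ 2) * (‖v‖ * ‖φ x‖) :=
        mul_le_mul (exp_mul_gaussian_le hΩ _ _) (norm_inner_le_norm v (φ x)) (norm_nonneg _)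
          (by positivity)
    _ = Real.exp (c ^ 2 / Ω) * ‖v‖ * (Real.exp (-(Ω / 4) * ‖x‖ ^ 2) * ‖φ x‖) := by ring

theorem linearOp_pow_mem_hermite {Ω : ℝ} (hΩ : 0 < Ω) (ξ : Pt d) (n : ℕ) (v : Fock d) :
    (linearOp ξ)^[n] (groundState Ω hΩ v) ∈ hermite Ω hΩ n := by
  induction n with
  | zero => exact ⟨v, rfl⟩
  | succ n ih =>
    rw [Function.iterate_succ_apply', linearOp, sum_apply]
    exact Submodule.sum_mem _ fun μ _ => Submodule.smul_mem _ _ (positionOp_mem_hermite hΩ ih μ)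

theorem eq_zero_of_orthogonal_hermite {Ω : ℝ} (hΩ : 0 < Ω) (φ : Hilb d)
    (horth : ∀ n, ∀ ψ ∈ hermite Ω hΩ n, inner ℂ (toHilb ψ) φ = 0) : φ = 0 := by
  have hweak (v : Fock d) :
      ∀ᵐ x, ((Real.exp (-(Ω / 2) * ‖x‖ ^ 2) : ℝ) : ℂ) * inner ℂ v (φ x) = 0 := by
    have hgauss : Continuous fun x : Pt d => ((Real.exp (-(Ω / 2) * ‖x‖ ^ 2) : ℝ) : ℂ) := by
      fun_prop
    refine ae_eq_zero_of_moments_eq_zero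
      (hgauss.aestronglyMeasurable.mul (Lp.aestronglyMeasurable φ).const_inner)
      (fun c _ => integrable_exp_mul_norm_gaussian_mul_inner hΩ φ v c) fun ξ n => ?_
    rw [← horth n _ (linearOp_pow_mem_hermite hΩ ξ n v), L2.inner_def]
    refine integral_congr_ae ?_
    filter_upwards [coeFn_toHilb ((linearOp ξ)^[n] (groundState Ω hΩ v))] with x hx
    rw [hx, linearOp_pow_apply, groundState_apply, inner_smul_left, inner_smul_left_eq_smul]
    simp
  have hcoord : ∀ᵐ x, ∀ J, φ x J = 0 := by
    rw [ae_all_iff]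
    intro J
    filter_upwards [hweak (EuclideanSpace.single J 1)] with x hx
    simpa [EuclideanSpace.inner_single_left, Real.exp_ne_zero] using hx
  refine Lp.eq_zero_iff_ae_eq_zero.2 ?_
  filter_upwards [hcoord] with x hx
  ext J
  exact hx J

theorem denseRange_diracOf_sq_add_one {Ω : ℝ} (hΩ : 0 < Ω)
    {Γ : Fin d ⊕ Fin d → Fock d →L[ℂ] Fock d} (hΓ : IsClifford Γ) :
    DenseRange (toHilb ∘ₗ ((diracOf Ω Γ).toLinearMap * (diracOf Ω Γ).toLinearMap + 1)) := by
  let A := toHilb ∘ₗ ((diracOf Ω Γ).toLinearMap * (diracOf Ω Γ).toLinearMap + 1)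
  change Dense (LinearMap.range A : Set (Hilb d))
  rw [Submodule.dense_iff_topologicalClosure_eq_top, Submodule.topologicalClosure_eq_top_iff,
    Submodule.eq_bot_iff]
  intro φ hφ
  refine eq_zero_of_orthogonal_hermite hΩ φ fun n ψ hψ => ?_
  obtain ⟨χ, rfl⟩ := exists_diracOf_sq_add_one_eq hΩ hΓ n ψ hψ
  exact (Submodule.mem_orthogonal _ _).1 hφ _ ⟨χ, rfl⟩

end HermiteDensity

/-! ### Smooth functions with bounded derivatives -/

section SmoothBounded

variable {d : ℕ}

namespace IsSmoothBounded

variable {f : Pt d → ℂ}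

theorem hasTemperateGrowth (hf : IsSmoothBounded f) : f.HasTemperateGrowth :=
  ⟨hf.1, fun n => (hf.2 n).elim fun C hC => ⟨0, C, by simpa using hC⟩⟩

theorem exists_norm_le (hf : IsSmoothBounded f) : ∃ C, ∀ x, ‖f x‖ ≤ C :=
  (hf.2 0).imp fun C hC x => by simpa using hC x

theorem continuous (hf : IsSmoothBounded f) : Continuous f := hf.1.continuous

theorem differentiable (hf : IsSmoothBounded f) : Differentiable ℝ f :=
  hf.1.differentiable (by simp)

theorem const_smul (hf : IsSmoothBounded f) (c : ℂ) : IsSmoothBounded (fun x => c • f x) := by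
  refine ⟨hf.1.const_smul c, fun n => ?_⟩
  obtain ⟨C, hC⟩ := hf.2 n
  refine ⟨‖c‖ * C, fun x => ?_⟩
  have hsmooth : ContDiffAt ℝ n f x := (hf.1.of_le (by exact_mod_cast le_top)).contDiffAt
  change ‖iteratedFDeriv ℝ n (c • f) x‖ ≤ _
  rw [iteratedFDeriv_const_smul_apply hsmooth, norm_smul]
  exact mul_le_mul_of_nonneg_left (hC x) (norm_nonneg _)

theorem fderiv_apply (hf : IsSmoothBounded f) (m : Pt d) :
    IsSmoothBounded (fun x => fderiv ℝ f x m) := by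
  have hsmooth : ContDiff ℝ ∞ (fderiv ℝ f) := hf.1.fderiv_right (by simp)
  refine ⟨hsmooth.clm_apply contDiff_const, fun n => ?_⟩
  obtain ⟨C, hC⟩ := hf.2 (n + 1)
  refine ⟨‖ContinuousLinearMap.apply ℝ ℂ m‖ * C, fun x => ?_⟩
  calc ‖iteratedFDeriv ℝ n (fun x => fderiv ℝ f x m) x‖
      ≤ ‖ContinuousLinearMap.apply ℝ ℂ m‖ * ‖iteratedFDeriv ℝ n (fderiv ℝ f) x‖ :=
        (ContinuousLinearMap.apply ℝ ℂ m).norm_iteratedFDeriv_comp_left (N := ∞)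
          hsmooth.contDiffAt (by exact_mod_cast le_top)
    _ ≤ ‖ContinuousLinearMap.apply ℝ ℂ m‖ * C := by
        rw [norm_iteratedFDeriv_fderiv]
        gcongr
        exact hC x

end IsSmoothBounded

end SmoothBounded

/-! ### Operators with symbol `f (x + B ξ)` -/

section SymbolOp

open FourierTransform

variable {d : ℕ}

/-- The pseudodifferential operator with symbol `f (x + B ξ)`, in the normalization
`e^{2πi⟨ξ, x⟩}` of the Fourier transform. Left Moyal multiplication is the case `B = -πΘ`. -/
noncomputable def symbolOp (B : Pt d →L[ℝ] Pt d) (f : Pt d → ℂ) (ψ : Spinor d) (x : Pt d) :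
    Fock d :=
  ∫ ξ : Pt d, Real.fourierChar (inner ℝ ξ x) • f (x + B ξ) • 𝓕 ψ ξ

variable {B : Pt d →L[ℝ] Pt d} {f : Pt d → ℂ}

theorem IsSmoothBounded.hasTemperateGrowth_symbol (hf : IsSmoothBounded f) (B : Pt d →L[ℝ] Pt d)
    (x : Pt d) : Function.HasTemperateGrowth fun ξ : Pt d => f (x + B ξ) :=
  hf.hasTemperateGrowth.comp
    ((Function.HasTemperateGrowth.const x).add B.hasTemperateGrowth)

theorem symbolOp_eq_fourierInv (hf : IsSmoothBounded f) (ψ : Spinor d) (x : Pt d) :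
    symbolOp B f ψ x = 𝓕⁻ (SchwartzMap.smulLeftCLM (Fock d) (fun ξ => f (x + B ξ)) (𝓕 ψ)) x := by
  rw [SchwartzMap.fourierInv_coe, Real.fourierInv_eq]
  simp only [SchwartzMap.smulLeftCLM_apply_apply (hf.hasTemperateGrowth_symbol B x)]
  rfl

theorem IsSmoothBounded.exists_norm_symbolOp_integrand_le (hf : IsSmoothBounded f)
    (B : Pt d →L[ℝ] Pt d) (ψ : Spinor d) :
    ∃ C, ∀ x ξ : Pt d,
      ‖Real.fourierChar (inner ℝ ξ x) • f (x + B ξ) • 𝓕 ψ ξ‖ ≤ C * ‖𝓕 ψ ξ‖ := by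
  obtain ⟨C, hC⟩ := hf.exists_norm_le
  refine ⟨C, fun x ξ => ?_⟩
  rw [Circle.norm_smul, norm_smul]
  exact mul_le_mul_of_nonneg_right (hC _) (norm_nonneg _)

theorem continuous_symbolOp_integrand (hf : IsSmoothBounded f) (ψ : Spinor d) :
    Continuous (Function.uncurry fun x ξ : Pt d =>
      Real.fourierChar (inner ℝ ξ x) • f (x + B ξ) • 𝓕 ψ ξ) := by
  have hchar : Continuous fun p : Pt d × Pt d => Real.fourierChar (inner ℝ p.2 p.1) :=
    Real.continuous_fourierChar.comp (by fun_prop)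
  exact hchar.smul ((hf.continuous.comp (by fun_prop)).smul
    ((𝓕 ψ).continuous.comp continuous_snd))

theorem integrable_symbolOp_integrand (hf : IsSmoothBounded f) (ψ : Spinor d) (x : Pt d) :
    Integrable fun ξ : Pt d => Real.fourierChar (inner ℝ ξ x) • f (x + B ξ) • 𝓕 ψ ξ := by
  obtain ⟨C, hC⟩ := hf.exists_norm_symbolOp_integrand_le B ψ
  have hcont := (continuous_symbolOp_integrand (B := B) hf ψ).uncurry_left x
  exact ((𝓕 ψ).integrable.norm.const_mul C).mono' hcont.aestronglyMeasurable (ae_of_all _ (hC x))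

theorem exists_norm_symbolOp_le (hf : IsSmoothBounded f) (B : Pt d →L[ℝ] Pt d) (ψ : Spinor d) :
    ∃ C, ∀ x, ‖symbolOp B f ψ x‖ ≤ C := by
  obtain ⟨C, hC⟩ := hf.exists_norm_symbolOp_integrand_le B ψ
  exact ⟨∫ ξ, C * ‖𝓕 ψ ξ‖, fun x => norm_integral_le_of_norm_le
    ((𝓕 ψ).integrable.norm.const_mul C) (ae_of_all _ (hC x))⟩

theorem continuous_symbolOp (hf : IsSmoothBounded f) (ψ : Spinor d) :
    Continuous (symbolOp B f ψ) := by
  obtain ⟨C, hC⟩ := hf.exists_norm_symbolOp_integrand_le B ψ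
  exact continuous_of_dominated
    (fun x => (integrable_symbolOp_integrand hf ψ x).aestronglyMeasurable)
    (fun x => ae_of_all _ (hC x)) ((𝓕 ψ).integrable.norm.const_mul C)
    (ae_of_all _ fun ξ => (continuous_symbolOp_integrand hf ψ).uncurry_right ξ)

theorem symbolOp_add (hf : IsSmoothBounded f) (ψ₁ ψ₂ : Spinor d) (x : Pt d) :
    symbolOp B f (ψ₁ + ψ₂) x = symbolOp B f ψ₁ x + symbolOp B f ψ₂ x := by
  unfold symbolOp
  rw [← integral_add (integrable_symbolOp_integrand hf ψ₁ x)
    (integrable_symbolOp_integrand hf ψ₂ x)]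
  congr 1 with ξ : 1
  rw [FourierTransform.fourier_add, add_apply, smul_add, smul_add]

theorem symbolOp_smul (c : ℂ) (ψ : Spinor d) (x : Pt d) :
    symbolOp B f (c • ψ) x = c • symbolOp B f ψ x := by
  unfold symbolOp
  rw [← integral_smul]
  congr 1 with ξ : 1
  rw [FourierTransform.fourier_smul, smul_apply, smul_comm (f _) c, smul_comm _ c]

theorem symbolOp_const_smul (c : ℂ) (ψ : Spinor d) (x : Pt d) :
    symbolOp B (fun y => c • f y) ψ x = c • symbolOp B f ψ x := by
  unfold symbolOp
  rw [← integral_smul]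
  congr 1 with ξ : 1
  rw [smul_assoc, smul_comm _ c]

theorem symbolOp_sum (hf : IsSmoothBounded f) {ι : Type*} (s : Finset ι) (ψ : ι → Spinor d)
    (x : Pt d) : symbolOp B f (∑ i ∈ s, ψ i) x = ∑ i ∈ s, symbolOp B f (ψ i) x :=
  map_sum (⟨⟨fun ψ => symbolOp B f ψ x, by simpa using symbolOp_smul (B := B) (f := f) 0 0 x⟩,
    fun ψ₁ ψ₂ => symbolOp_add hf ψ₁ ψ₂ x⟩ : Spinor d →+ Fock d) ψ s

theorem fourier_fiberOp (M : Fock d →L[ℂ] Fock d) (ψ : Spinor d) (ξ : Pt d) :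
    𝓕 (fiberOp M ψ) ξ = M (𝓕 ψ ξ) := by
  rw [SchwartzMap.fourier_coe, SchwartzMap.fourier_coe, Real.fourier_eq, Real.fourier_eq,
    ← M.integral_comp_comm]
  · congr 1 with y : 1
    rw [fiberOp_apply]
    exact (map_smul M ((Real.fourierChar _ : Circle) : ℂ) _).symm
  · exact (Real.fourierIntegral_convergent_iff ξ).2 ψ.integrable

theorem symbolOp_fiberOp (hf : IsSmoothBounded f) (M : Fock d →L[ℂ] Fock d) (ψ : Spinor d)
    (x : Pt d) : symbolOp B f (fiberOp M ψ) x = M (symbolOp B f ψ x) := by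
  unfold symbolOp
  rw [← M.integral_comp_comm (integrable_symbolOp_integrand hf ψ x)]
  congr 1 with ξ : 1
  rw [fourier_fiberOp, ← map_smul]
  exact (map_smul M ((Real.fourierChar _ : Circle) : ℂ) _).symm

/-- The derivative `(2πi)⁻¹ ∂_{B m} f`: the symbol of the commutator of `symbolOp B f` with
multiplication by `⟨m, ·⟩`. -/
noncomputable def symbolDeriv (B : Pt d →L[ℝ] Pt d) (m : Pt d) (f : Pt d → ℂ) (x : Pt d) : ℂ :=
  (2 * Real.pi * Complex.I)⁻¹ • fderiv ℝ f x (B m)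

theorem IsSmoothBounded.symbolDeriv (hf : IsSmoothBounded f) (B : Pt d →L[ℝ] Pt d) (m : Pt d) :
    IsSmoothBounded (symbolDeriv B m f) :=
  (hf.fderiv_apply (B m)).const_smul _

theorem positionOp_eq (μ : Fin d) (ψ : Spinor d) :
    positionOp μ ψ =
      SchwartzMap.smulLeftCLM (Fock d) (inner ℝ · (EuclideanSpace.single μ (1 : ℝ))) ψ := by
  ext1 x
  rw [positionOp_apply, SchwartzMap.smulLeftCLM_apply_apply (by fun_prop)]
  simp [EuclideanSpace.inner_single_right]

open LineDeriv in
theorem fourier_positionOp (μ : Fin d) (ψ : Spinor d) :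
    (2 * Real.pi * Complex.I) • 𝓕 (positionOp μ ψ) =
      -∂_{(EuclideanSpace.single μ (1 : ℝ) : Pt d)} (𝓕 ψ) := by
  rw [SchwartzMap.lineDerivOp_fourier_eq, ← positionOp_eq, FourierTransform.fourier_smul,
    neg_smul, neg_neg]

open LineDeriv in
theorem lineDerivOp_symbol_smul (hf : IsSmoothBounded f) (B : Pt d →L[ℝ] Pt d) (x m : Pt d)
    (φ : Spinor d) :
    ∂_{m} (SchwartzMap.smulLeftCLM (Fock d) (fun ξ => f (x + B ξ)) φ) =
      (2 * Real.pi * Complex.I) •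
        SchwartzMap.smulLeftCLM (Fock d) (fun ξ => symbolDeriv B m f (x + B ξ)) φ +
      SchwartzMap.smulLeftCLM (Fock d) (fun ξ => f (x + B ξ)) (∂_{m} φ) := by
  have hsymbol := hf.hasTemperateGrowth_symbol B x
  have hsymbol' := (hf.symbolDeriv B m).hasTemperateGrowth_symbol B x
  ext1 ξ
  have hcoe : (SchwartzMap.smulLeftCLM (Fock d) (fun ξ => f (x + B ξ)) φ : Pt d → Fock d) =
      (fun ξ => f (x + B ξ)) • (φ : Pt d → Fock d) :=
    funext fun ξ => SchwartzMap.smulLeftCLM_apply_apply hsymbol _ ξ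
  have hderiv : HasFDerivAt (fun ξ => f (x + B ξ)) (fderiv ℝ f (x + B ξ) ∘L B) ξ :=
    (hf.differentiable (x + B ξ)).hasFDerivAt.comp ξ (B.hasFDerivAt.const_add x)
  rw [SchwartzMap.lineDerivOp_apply_eq_fderiv, hcoe,
    (hderiv.smul φ.differentiableAt.hasFDerivAt).fderiv]
  change f (x + B ξ) • fderiv ℝ φ ξ m + fderiv ℝ f (x + B ξ) (B m) • φ ξ = _
  rw [add_apply, smul_apply,
    SchwartzMap.smulLeftCLM_apply_apply hsymbol', SchwartzMap.smulLeftCLM_apply_apply hsymbol,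
    SchwartzMap.lineDerivOp_apply_eq_fderiv, symbolDeriv, smul_assoc,
    smul_inv_smul₀ (by simp [Real.pi_ne_zero])]
  simp [add_comm]

theorem symbolOp_positionOp (hf : IsSmoothBounded f) (μ : Fin d) (ψ : Spinor d) (x : Pt d) :
    symbolOp B f (positionOp μ ψ) x = ((x μ : ℝ) : ℂ) • symbolOp B f ψ x +
      symbolOp B (symbolDeriv B (EuclideanSpace.single μ 1) f) ψ x := by
  set m : Pt d := EuclideanSpace.single μ (1 : ℝ)
  have hsub : ∀ φ₁ φ₂ : Spinor d, 𝓕⁻ (φ₁ - φ₂) = 𝓕⁻ φ₁ - 𝓕⁻ φ₂ := fun φ₁ φ₂ =>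
    map_sub (FourierTransform.fourierCLE ℂ (Spinor d)).symm φ₁ φ₂
  have hderiv : LineDeriv.lineDerivOp m
        (SchwartzMap.smulLeftCLM (Fock d) (fun ξ => f (x + B ξ)) (𝓕 ψ)) =
      (2 * Real.pi * Complex.I) • (SchwartzMap.smulLeftCLM (Fock d)
        (fun ξ => symbolDeriv B m f (x + B ξ)) (𝓕 ψ) -
        SchwartzMap.smulLeftCLM (Fock d) (fun ξ => f (x + B ξ)) (𝓕 (positionOp μ ψ))) := by
    rw [lineDerivOp_symbol_smul hf, smul_sub, ← map_smul _ _ (𝓕 (positionOp μ ψ)),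
      fourier_positionOp, map_neg, sub_neg_eq_add]
  have hinverse := congr($(SchwartzMap.fourierInv_lineDerivOp_eq
    (SchwartzMap.smulLeftCLM (Fock d) (fun ξ => f (x + B ξ)) (𝓕 ψ)) m) x)
  rw [hderiv, FourierTransform.fourierInv_smul, hsub, smul_apply, sub_apply,
    smul_apply, SchwartzMap.smulLeftCLM_apply_apply (by fun_prop), ← symbolOp_eq_fourierInv hf,
    ← symbolOp_eq_fourierInv hf, ← symbolOp_eq_fourierInv (hf.symbolDeriv B m), neg_smul,
    ← smul_neg] at hinverse
  have hcancel := smul_right_injective _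
    (show (2 * Real.pi * Complex.I) ≠ 0 by simp [Real.pi_ne_zero]) hinverse
  have hinner : (inner ℝ x m : ℝ) = x μ := by simp [m, EuclideanSpace.inner_single_right]
  simp only [hinner, Complex.coe_smul] at hcancel ⊢
  linear_combination (norm := module) -hcancel

end SymbolOp

/-! ### Localised bounds for operators with symbol `f (x + B ξ)` -/

section IntegralAddMul

variable {G 𝕜 : Type*} [AddCommGroup G] [MeasurableSpace G] [MeasurableAdd₂ G]
  {μ : Measure G} [SFinite μ] [μ.IsAddLeftInvariant] [RCLike 𝕜] {w p : G → 𝕜}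

theorem integrable_add_mul (hw : Integrable w μ) (hp : Integrable p μ) :
    Integrable (Function.uncurry fun s x => w (x + s) * p x) (μ.prod μ) :=
  ((measurePreserving_prod_add_swap μ μ).integrable_comp_of_integrable (hp.mul_prod hw)).congr
    (ae_of_all _ fun _ => mul_comm _ _)

theorem integral_integral_add_mul (hw : Integrable w μ) (hp : Integrable p μ) :
    ∫ s, ∫ x, w (x + s) * p x ∂μ ∂μ = (∫ x, w x ∂μ) * ∫ x, p x ∂μ := by
  rw [integral_integral_swap (integrable_add_mul hw hp), ← integral_const_mul]
  congr 1 with x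
  rw [integral_mul_const, integral_add_left_eq_self w x]

end IntegralAddMul

section LocalBound

open FourierTransform

variable {d : ℕ} {B : Pt d →L[ℝ] Pt d} {f : Pt d → ℂ}

theorem norm_toHilb_sq (ψ : Spinor d) : ‖toHilb ψ‖ ^ 2 = ∫ x, ‖ψ x‖ ^ 2 := by
  have hinner := inner_toHilb ψ ψ
  simp only [inner_self_eq_norm_sq_to_K] at hinner
  have hcast : ((‖toHilb ψ‖ ^ 2 : ℝ) : ℂ) = ((∫ x, ‖ψ x‖ ^ 2 : ℝ) : ℂ) := by
    rw [← integral_complex_ofReal]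
    push_cast
    exact hinner
  exact_mod_cast hcast

theorem integral_norm_sq_fourier_eq (ψ : Spinor d) : ∫ ξ, ‖𝓕 ψ ξ‖ ^ 2 = ‖toHilb ψ‖ ^ 2 := by
  rw [norm_toHilb_sq, SchwartzMap.integral_norm_sq_fourier]

theorem integral_norm_sq_fourierInv_eq (ψ : Spinor d) :
    ∫ ξ, ‖𝓕⁻ ψ ξ‖ ^ 2 = ‖toHilb ψ‖ ^ 2 := by
  rw [← norm_toHilb_sq, ← integral_norm_sq_fourier_eq, FourierTransform.fourier_fourierInv_eq,
    norm_toHilb_sq]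

theorem integrable_norm_sq (ψ : Spinor d) : Integrable fun x => ‖ψ x‖ ^ 2 :=
  (ψ.memLp 2 volume).integrable_norm_pow (by norm_num)

theorem integrable_uncurry_inner_symbolOp (hf : IsSmoothBounded f) {q : Pt d → ℂ}
    (hq : Continuous q) {K : ℝ} (hK : ∀ x, ‖q x‖ ≤ K) (φ ψ : Spinor d) :
    Integrable (Function.uncurry fun x ξ : Pt d =>
      (inner ℂ (φ x) (q x • Real.fourierChar (inner ℝ ξ x) • f (x + B ξ) • 𝓕 ψ ξ) : ℂ))
      (volume.prod volume) := by
  obtain ⟨C, hC⟩ := hf.exists_norm_symbolOp_integrand_le B ψ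
  have hcont : Continuous (Function.uncurry fun x ξ : Pt d =>
      (inner ℂ (φ x) (q x • Real.fourierChar (inner ℝ ξ x) • f (x + B ξ) • 𝓕 ψ ξ) : ℂ)) :=
    Continuous.inner (φ.continuous.comp continuous_fst)
      ((hq.comp continuous_fst).smul (continuous_symbolOp_integrand hf ψ))
  refine ((φ.integrable.norm.mul_prod (𝓕 ψ).integrable.norm).const_mul (K * C)).mono'
    hcont.aestronglyMeasurable (ae_of_all _ fun ⟨x, ξ⟩ => ?_)
  simp only [Function.uncurry_apply_pair]
  have hK0 : 0 ≤ K := (norm_nonneg _).trans (hK x)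
  calc ‖inner ℂ (φ x) (q x • Real.fourierChar (inner ℝ ξ x) • f (x + B ξ) • 𝓕 ψ ξ)‖
      ≤ ‖φ x‖ * (‖q x‖ * ‖Real.fourierChar (inner ℝ ξ x) • f (x + B ξ) • 𝓕 ψ ξ‖) := by
        rw [← norm_smul]
        exact norm_inner_le_norm _ _
    _ ≤ ‖φ x‖ * (K * (C * ‖𝓕 ψ ξ‖)) := by
        gcongr
        exacts [hK x, hC x ξ]
    _ = K * C * (‖φ x‖ * ‖𝓕 ψ ξ‖) := by ring

theorem integral_inner_symbolOp (hf : IsSmoothBounded f) {q : Pt d → ℂ} (hq : Continuous q)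
    {K : ℝ} (hK : ∀ x, ‖q x‖ ≤ K) (φ ψ : Spinor d) :
    ∫ x, inner ℂ (φ x) (q x • symbolOp B f ψ x) =
      ∫ ξ, ∫ x, inner ℂ (φ x) (q x • Real.fourierChar (inner ℝ ξ x) • f (x + B ξ) • 𝓕 ψ ξ) := by
  have hinner : ∀ x, inner ℂ (φ x) (q x • symbolOp B f ψ x) =
      ∫ ξ, inner ℂ (φ x) (q x • Real.fourierChar (inner ℝ ξ x) • f (x + B ξ) • 𝓕 ψ ξ) := by
    intro x
    have hint : Integrable fun ξ : Pt d =>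
        q x • Real.fourierChar (inner ℝ ξ x) • f (x + B ξ) • 𝓕 ψ ξ :=
      (integrable_symbolOp_integrand hf ψ x).smul (q x)
    rw [symbolOp, ← integral_smul, integral_inner hint]
  simp_rw [hinner]
  exact integral_integral_swap (integrable_uncurry_inner_symbolOp hf hq hK φ ψ)

theorem exists_integral_iteratedFDeriv_le (χ : 𝓢(Pt d, ℂ)) (hf : IsSmoothBounded f) (n : ℕ) :
    ∃ K, ∀ c : Pt d, ∫ x, ‖iteratedFDeriv ℝ n (fun x => f (x + c) • χ x) x‖ ≤ K := by
  choose F hF using hf.2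
  let b : Pt d → ℝ := fun x =>
    ∑ i ∈ Finset.range (n + 1), (n.choose i : ℝ) * F i * ‖iteratedFDeriv ℝ (n - i) χ x‖
  have hb : Integrable b := by
    refine integrable_finsetSum _ fun i _ => Integrable.const_mul ?_ _
    simpa using χ.integrable_pow_mul_iteratedFDeriv volume 0 (n - i)
  refine ⟨∫ x, b x, fun c => ?_⟩
  refine integral_mono_of_nonneg (ae_of_all _ fun x => norm_nonneg _) hb (ae_of_all _ fun x => ?_)
  have hsmooth : ContDiff ℝ ∞ fun x => f (x + c) := hf.1.comp (contDiff_id.add contDiff_const)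
  refine (norm_iteratedFDeriv_smul_le (N := ∞) hsmooth (χ.smooth ⊤) x
    (by exact_mod_cast le_top)).trans (Finset.sum_le_sum fun i _ => ?_)
  rw [iteratedFDeriv_comp_add_right]
  gcongr
  exact hF i _

theorem exists_pow_mul_norm_fourier_translate_le (χ : 𝓢(Pt d, ℂ)) (hf : IsSmoothBounded f)
    (n : ℕ) :
    ∃ K, ∀ c η : Pt d,
      ‖η‖ ^ n * ‖∫ x, Real.fourierChar (inner ℝ x η) • (f (x + c) • χ x)‖ ≤ K := by
  choose K hK using fun n => exists_integral_iteratedFDeriv_le χ hf n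
  refine ⟨2 ^ n * ∑ p ∈ Finset.range (n + 1), K p, fun c η => ?_⟩
  have htemperate : Function.HasTemperateGrowth fun x => f (x + c) :=
    hf.hasTemperateGrowth.comp (by fun_prop)
  let h : 𝓢(Pt d, ℂ) := SchwartzMap.smulLeftCLM ℂ (fun x => f (x + c)) χ
  have hcoe : (h : Pt d → ℂ) = fun x => f (x + c) • χ x :=
    funext fun x => SchwartzMap.smulLeftCLM_apply_apply htemperate χ x
  have hfourier := Real.pow_mul_norm_iteratedFDeriv_fourier_le (K := ⊤) (N := ⊤) (f := h)
    (h.smooth ⊤) (fun k n _ _ => h.integrable_pow_mul_iteratedFDeriv volume k n) (k := 0) (n := n)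
    le_top le_top (-η)
  simp only [norm_neg, norm_iteratedFDeriv_zero, pow_zero, one_mul, Nat.cast_zero, mul_zero,
    zero_add, Finset.range_one, Finset.singleton_product, Finset.sum_map] at hfourier
  rw [Real.fourier_eq, hcoe] at hfourier
  simp only [inner_neg_right, neg_neg, Function.Embedding.coeFn_mk, pow_zero, one_mul] at hfourier
  refine hfourier.trans ?_
  gcongr with p
  exact hK p c

theorem exists_integrable_fourier_translate_le (χ : 𝓢(Pt d, ℂ)) (hf : IsSmoothBounded f) :
    ∃ w : Pt d → ℝ, Integrable w ∧
      ∀ c η : Pt d, ‖∫ x, Real.fourierChar (inner ℝ x η) • (f (x + c) • χ x)‖ ≤ w η := by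
  let l := (volume : Measure (Pt d)).integrablePower
  obtain ⟨K₀, hK₀⟩ := exists_pow_mul_norm_fourier_translate_le χ hf 0
  obtain ⟨K, hK⟩ := exists_pow_mul_norm_fourier_translate_le χ hf l
  refine ⟨fun η => 2 ^ l * (K₀ + K) * (1 + ‖η‖) ^ (-(l : ℝ)),
    (Measure.integrable_pow_neg_integrablePower volume).const_mul _, fun c η => ?_⟩
  simpa only [pow_zero, one_mul, zero_add] using
    pow_mul_le_of_le_of_pow_mul_le (k := 0) (l := l) (norm_nonneg η) (norm_nonneg _)
      (by simpa using hK₀ c η) (by simpa using hK c η)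

theorem norm_fourierInv_localized_le {χ : 𝓢(Pt d, ℂ)} {w : Pt d → ℝ}
    (hw : ∀ c η : Pt d, ‖∫ x, Real.fourierChar (inner ℝ x η) • (f (x + c) • χ x)‖ ≤ w η)
    (s ξ ζ : Pt d) (v : Fock d) :
    ‖∫ x : Pt d, Real.fourierChar (inner ℝ x ζ) •
      (χ (x + s) • Real.fourierChar (inner ℝ ξ x) • f (x + B ξ) • v)‖ ≤ w (ζ + ξ) * ‖v‖ := by
  have hfactor : ∀ x : Pt d, Real.fourierChar (inner ℝ x ζ) •
      (χ (x + s) • Real.fourierChar (inner ℝ ξ x) • f (x + B ξ) • v) =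
      (((Real.fourierChar (inner ℝ x (ζ + ξ)) : Circle) : ℂ) * (f (x + B ξ) * χ (x + s))) • v := by
    intro x
    rw [inner_add_right, AddChar.map_add_eq_mul, real_inner_comm x ξ]
    simp only [Circle.smul_def, smul_smul, Circle.coe_mul]
    congr 1
    ring
  have htranslate : ∀ x : Pt d, ((Real.fourierChar (inner ℝ (x - s) (ζ + ξ)) : Circle) : ℂ) *
      (f (x - s + B ξ) * χ (x - s + s)) = ((Real.fourierChar (-inner ℝ s (ζ + ξ)) : Circle) : ℂ) *
        (Real.fourierChar (inner ℝ x (ζ + ξ)) • (f (x + (B ξ - s)) • χ x)) := by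
    intro x
    rw [inner_sub_left, sub_eq_add_neg, AddChar.map_add_eq_mul, sub_add_cancel,
      show x - s + B ξ = x + (B ξ - s) by abel]
    simp only [Circle.smul_def, smul_eq_mul, Circle.coe_mul]
    ring
  simp_rw [hfactor]
  rw [integral_smul_const, norm_smul, ← integral_sub_right_eq_self _ s]
  simp_rw [htranslate]
  rw [integral_const_mul, norm_mul, Circle.norm_coe, one_mul]
  exact mul_le_mul_of_nonneg_right (hw _ _) (norm_nonneg v)

theorem integral_inner_eq_fourierInv (φ : Spinor d) {G : Pt d → Fock d} (hG : Integrable G) :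
    ∫ x, inner ℂ (φ x) (G x) =
      ∫ ζ, inner ℂ (𝓕⁻ φ ζ) (∫ x : Pt d, Real.fourierChar (inner ℝ x ζ) • G x) := by
  have hparseval := VectorFourier.integral_sesq_fourierIntegral_eq_neg_flip (L := innerₗ (Pt d))
    (μ := volume) (ν := volume) (innerSL ℂ (E := Fock d)) Real.continuous_fourierChar
    continuous_inner (𝓕⁻ φ).integrable hG
  have hinverse : ∀ x, VectorFourier.fourierIntegral Real.fourierChar volume (innerₗ (Pt d))
      (𝓕⁻ φ : Spinor d) x = φ x := by
    intro x
    have hφ : (𝓕 (𝓕⁻ φ) : Spinor d) x = φ x := by rw [FourierTransform.fourier_fourierInv_eq]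
    rwa [SchwartzMap.fourier_coe] at hφ
  simp only [hinverse, innerSL_apply_apply] at hparseval
  rw [hparseval]
  simp only [VectorFourier.fourierIntegral, LinearMap.neg_apply, neg_neg, flip_innerₗ,
    innerₗ_apply_apply]

theorem integrable_localized (χ : 𝓢(Pt d, ℂ)) (hf : IsSmoothBounded f) (s ξ : Pt d)
    (v : Fock d) :
    Integrable fun x => χ (x + s) • Real.fourierChar (inner ℝ ξ x) • f (x + B ξ) • v := by
  obtain ⟨C, hC⟩ := hf.exists_norm_le
  have hchar : Continuous fun x : Pt d => Real.fourierChar (inner ℝ ξ x) :=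
    Real.continuous_fourierChar.comp (by fun_prop)
  have hcont : Continuous fun x =>
      χ (x + s) • Real.fourierChar (inner ℝ ξ x) • f (x + B ξ) • v :=
    (χ.continuous.comp (by fun_prop)).smul
      (hchar.smul ((hf.continuous.comp (by fun_prop)).smul continuous_const))
  refine ((χ.integrable.comp_add_right s).norm.mul_const (C * ‖v‖)).mono'
    hcont.aestronglyMeasurable (ae_of_all _ fun x => ?_)
  rw [norm_smul, Circle.norm_smul, norm_smul]
  gcongr
  exact hC _

theorem norm_integral_inner_localized_le {χ : 𝓢(Pt d, ℂ)} (hf : IsSmoothBounded f)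
    {w : Pt d → ℝ} (hwint : Integrable w)
    (hw : ∀ c η : Pt d, ‖∫ x, Real.fourierChar (inner ℝ x η) • (f (x + c) • χ x)‖ ≤ w η)
    (s ξ : Pt d) (φ : Spinor d) (v : Fock d)
    (hφ : Integrable fun ζ => w (ζ + ξ) * ‖𝓕⁻ φ ζ‖ ^ 2) :
    ‖∫ x, inner ℂ (φ x) (χ (x + s) • Real.fourierChar (inner ℝ ξ x) • f (x + B ξ) • v)‖ ≤
      ((∫ ζ, w (ζ + ξ) * ‖𝓕⁻ φ ζ‖ ^ 2) + (∫ x, w x) * ‖v‖ ^ 2) / 2 := by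
  have hv : Integrable fun ζ => w (ζ + ξ) * ‖v‖ ^ 2 := (hwint.comp_add_right ξ).mul_const _
  rw [integral_inner_eq_fourierInv φ (integrable_localized χ hf s ξ v),
    ← integral_add_right_eq_self w ξ, ← integral_mul_const, ← integral_add hφ hv,
    ← integral_div]
  refine norm_integral_le_of_norm_le ((hφ.add hv).div_const 2) (ae_of_all _ fun ζ => ?_)
  have hwnonneg : 0 ≤ w (ζ + ξ) := (norm_nonneg _).trans (hw 0 _)
  calc _ ≤ ‖𝓕⁻ φ ζ‖ * ‖∫ x : Pt d, Real.fourierChar (inner ℝ x ζ) •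
          (χ (x + s) • Real.fourierChar (inner ℝ ξ x) • f (x + B ξ) • v)‖ :=
        norm_inner_le_norm _ _
    _ ≤ ‖𝓕⁻ φ ζ‖ * (w (ζ + ξ) * ‖v‖) :=
        mul_le_mul_of_nonneg_left (norm_fourierInv_localized_le hw s ξ ζ v) (norm_nonneg _)
    _ ≤ (w (ζ + ξ) * ‖𝓕⁻ φ ζ‖ ^ 2 + w (ζ + ξ) * ‖v‖ ^ 2) / 2 := by
        nlinarith [mul_nonneg hwnonneg (sq_nonneg (‖𝓕⁻ φ ζ‖ - ‖v‖))]

theorem exists_local_bound (χ : 𝓢(Pt d, ℂ)) (hf : IsSmoothBounded f) (B : Pt d →L[ℝ] Pt d) :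
    ∃ C, ∀ (s : Pt d) (φ ψ : Spinor d),
      ‖∫ x, inner ℂ (φ x) (χ (x + s) • symbolOp B f ψ x)‖ ≤
        C * (‖toHilb φ‖ ^ 2 + ‖toHilb ψ‖ ^ 2) := by
  obtain ⟨w, hwint, hw⟩ := exists_integrable_fourier_translate_le χ hf
  refine ⟨(∫ x, w x) / 2, fun s φ ψ => ?_⟩
  have hχ : Continuous fun x => χ (x + s) := χ.continuous.comp (by fun_prop)
  have hχbound : ∀ x, ‖χ (x + s)‖ ≤ ‖χ.toBoundedContinuousFunction‖ := fun x =>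
    χ.toBoundedContinuousFunction.norm_coe_le_norm (x + s)
  have hφ := integrable_add_mul hwint (integrable_norm_sq (𝓕⁻ φ))
  have hφint : Integrable fun ξ => ∫ ζ, w (ζ + ξ) * ‖𝓕⁻ φ ζ‖ ^ 2 := hφ.integral_prod_left
  have hψint := (integrable_norm_sq (𝓕 ψ)).const_mul (∫ x, w x)
  calc ‖∫ x, inner ℂ (φ x) (χ (x + s) • symbolOp B f ψ x)‖
      ≤ ∫ ξ, ((∫ ζ, w (ζ + ξ) * ‖𝓕⁻ φ ζ‖ ^ 2) + (∫ x, w x) * ‖𝓕 ψ ξ‖ ^ 2) / 2 := by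
        rw [integral_inner_symbolOp hf hχ hχbound]
        refine norm_integral_le_of_norm_le ((hφint.add hψint).div_const 2) ?_
        filter_upwards [hφ.prod_right_ae] with ξ hξ
        exact norm_integral_inner_localized_le hf hwint hw s ξ φ (𝓕 ψ ξ) hξ
    _ = (∫ x, w x) / 2 * (‖toHilb φ‖ ^ 2 + ‖toHilb ψ‖ ^ 2) := by
        rw [integral_div, integral_add hφint hψint, integral_const_mul,
          integral_norm_sq_fourier_eq,
          integral_integral_add_mul hwint (integrable_norm_sq (𝓕⁻ φ)),
          integral_norm_sq_fourierInv_eq]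
        ring

end LocalBound

/-! ### `L²` bounds for operators with symbol `f (x + B ξ)` -/

section Weights

variable {d : ℕ} {B : Pt d →L[ℝ] Pt d} {f : Pt d → ℂ}

/-- Multiplication by `x_μ + s_μ`, out of which `weightOp` is built. -/
noncomputable def shiftOp (s : Pt d) (μ : Fin d) : Spinor d →L[ℂ] Spinor d :=
  positionOp μ + ((s μ : ℝ) : ℂ) • ContinuousLinearMap.id ℂ (Spinor d)

/-- Multiplication by `1 + |x + s|²`. Its powers compensate the decaying weight of the second
argument in the local bounds. -/
noncomputable def weightOp (s : Pt d) : Spinor d →L[ℂ] Spinor d :=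
  ContinuousLinearMap.id ℂ (Spinor d) + ∑ μ, shiftOp s μ ∘L shiftOp s μ

theorem shiftOp_apply (s : Pt d) (μ : Fin d) (ψ : Spinor d) (x : Pt d) :
    shiftOp s μ ψ x = (((x + s) μ : ℝ) : ℂ) • ψ x := by
  change positionOp μ ψ x + ((s μ : ℝ) : ℂ) • ψ x = _
  rw [positionOp_apply, ← add_smul, ← Complex.ofReal_add]
  rfl

theorem symbolOp_shiftOp (hf : IsSmoothBounded f) (s : Pt d) (μ : Fin d) (ψ : Spinor d)
    (x : Pt d) : symbolOp B f (shiftOp s μ ψ) x = (((x + s) μ : ℝ) : ℂ) • symbolOp B f ψ x +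
      symbolOp B (symbolDeriv B (EuclideanSpace.single μ 1) f) ψ x := by
  change symbolOp B f (positionOp μ ψ + ((s μ : ℝ) : ℂ) • ψ) x = _
  rw [symbolOp_add hf, symbolOp_smul, symbolOp_positionOp hf, PiLp.add_apply, Complex.ofReal_add,
    add_smul]
  abel

theorem weightOp_eq (s : Pt d) (ψ : Spinor d) :
    weightOp s ψ = ψ + ∑ μ, shiftOp s μ (shiftOp s μ ψ) := by
  simp [weightOp, sum_apply, add_apply]

theorem weightOp_apply (s : Pt d) (ψ : Spinor d) (x : Pt d) :
    weightOp s ψ x = (1 + ‖x + s‖ ^ 2) • ψ x := by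
  rw [weightOp_eq, add_apply, sum_apply, EuclideanSpace.real_norm_sq_eq, add_smul, one_smul,
    Finset.sum_smul]
  congr 1
  refine Finset.sum_congr rfl fun μ _ => ?_
  rw [shiftOp_apply, shiftOp_apply, smul_smul, ← Complex.ofReal_mul, ← sq]
  exact (RCLike.real_smul_eq_coe_smul (K := ℂ) _ _).symm

theorem weightOp_iterate_apply (s : Pt d) (M : ℕ) (ψ : Spinor d) (x : Pt d) :
    ((weightOp s)^[M] ψ) x = (1 + ‖x + s‖ ^ 2) ^ M • ψ x := by
  induction M with
  | zero => simp
  | succ M ih => rw [Function.iterate_succ_apply', weightOp_apply, ih, smul_smul, pow_succ' (1 + _)]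

theorem symbolOp_weightOp (hf : IsSmoothBounded f) (s : Pt d) (ψ : Spinor d) (x : Pt d) :
    symbolOp B f (weightOp s ψ) x = ((1 + ‖x + s‖ ^ 2 : ℝ) : ℂ) • symbolOp B f ψ x +
      ∑ μ, ((2 * (((x + s) μ : ℝ) : ℂ)) •
          symbolOp B (symbolDeriv B (EuclideanSpace.single μ 1) f) ψ x +
        symbolOp B (symbolDeriv B (EuclideanSpace.single μ 1)
          (symbolDeriv B (EuclideanSpace.single μ 1) f)) ψ x) := by
  rw [weightOp_eq, symbolOp_add hf, symbolOp_sum hf, EuclideanSpace.real_norm_sq_eq,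
    Complex.ofReal_add, Complex.ofReal_one, add_smul, one_smul, add_assoc, Complex.ofReal_sum,
    Finset.sum_smul, ← Finset.sum_add_distrib]
  congr 1
  refine Finset.sum_congr rfl fun μ _ => ?_
  rw [symbolOp_shiftOp hf, symbolOp_shiftOp hf,
    symbolOp_shiftOp (hf.symbolDeriv B (EuclideanSpace.single μ 1))]
  push_cast
  module

theorem exists_schwartz_smul_symbolOp_weightOp_eq (χ : 𝓢(Pt d, ℂ)) :
    ∃ (χ₀ : 𝓢(Pt d, ℂ)) (χ₁ : Fin d → 𝓢(Pt d, ℂ)), ∀ {f : Pt d → ℂ}, IsSmoothBounded f →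
      ∀ (s : Pt d) (ψ : Spinor d) (x : Pt d),
      χ (x + s) • symbolOp B f (weightOp s ψ) x = χ₀ (x + s) • symbolOp B f ψ x +
        ∑ μ, (χ₁ μ (x + s) • symbolOp B (symbolDeriv B (EuclideanSpace.single μ 1) f) ψ x +
          χ (x + s) • symbolOp B (symbolDeriv B (EuclideanSpace.single μ 1)
            (symbolDeriv B (EuclideanSpace.single μ 1) f)) ψ x) := by
  have hnorm : Function.HasTemperateGrowth fun x : Pt d => ((1 + ‖x‖ ^ 2 : ℝ) : ℂ) :=
    Complex.ofRealCLM.hasTemperateGrowth.comp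
      ((Function.HasTemperateGrowth.const 1).add (Function.hasTemperateGrowth_norm_sq (Pt d)))
  have hcoord (μ : Fin d) : Function.HasTemperateGrowth fun x : Pt d => 2 * ((x μ : ℝ) : ℂ) :=
    (Function.HasTemperateGrowth.const 2).mul (hasTemperateGrowth_coord μ)
  refine ⟨SchwartzMap.smulLeftCLM ℂ (fun x : Pt d => ((1 + ‖x‖ ^ 2 : ℝ) : ℂ)) χ, fun μ =>
    SchwartzMap.smulLeftCLM ℂ (fun x : Pt d => 2 * ((x μ : ℝ) : ℂ)) χ, fun hf s ψ x => ?_⟩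
  rw [symbolOp_weightOp hf, smul_add, Finset.smul_sum, SchwartzMap.smulLeftCLM_apply_apply hnorm,
    smul_smul, smul_eq_mul, mul_comm (χ _)]
  congr 1
  refine Finset.sum_congr rfl fun μ _ => ?_
  rw [smul_add, SchwartzMap.smulLeftCLM_apply_apply (hcoord μ), smul_smul, smul_eq_mul,
    mul_comm (χ _)]

theorem integrable_inner_smul_symbolOp (hf : IsSmoothBounded f) {q : Pt d → ℂ} (hq : Continuous q)
    {K : ℝ} (hK : ∀ x, ‖q x‖ ≤ K) (φ ψ : Spinor d) :
    Integrable fun x => inner ℂ (φ x) (q x • symbolOp B f ψ x) := by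
  obtain ⟨C, hC⟩ := exists_norm_symbolOp_le hf B ψ
  refine (φ.integrable.norm.mul_const (K * C)).mono'
    (φ.continuous.inner (hq.smul (continuous_symbolOp hf ψ))).aestronglyMeasurable
    (ae_of_all _ fun x => ?_)
  refine (norm_inner_le_norm _ _).trans (mul_le_mul_of_nonneg_left ?_ (norm_nonneg _))
  rw [norm_smul]
  exact mul_le_mul (hK x) (hC x) (norm_nonneg _) ((norm_nonneg _).trans (hK x))

theorem integrable_inner_symbolOp (hf : IsSmoothBounded f) (φ ψ : Spinor d) :
    Integrable fun x => inner ℂ (φ x) (symbolOp B f ψ x) := by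
  simpa using integrable_inner_smul_symbolOp (B := B) hf (q := fun _ => 1) continuous_const
    (K := 1) (by simp) φ ψ

theorem integrable_inner_localized (hf : IsSmoothBounded f) (χ : 𝓢(Pt d, ℂ)) (s : Pt d)
    (φ ψ : Spinor d) : Integrable fun x => inner ℂ (φ x) (χ (x + s) • symbolOp B f ψ x) :=
  integrable_inner_smul_symbolOp hf (χ.continuous.comp (by fun_prop)) (fun x =>
    χ.toBoundedContinuousFunction.norm_coe_le_norm (x + s)) φ ψ

theorem exists_weighted_local_bound (B : Pt d →L[ℝ] Pt d) (M : ℕ) :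
    ∀ (χ : 𝓢(Pt d, ℂ)) (f : Pt d → ℂ), IsSmoothBounded f → ∃ C, ∀ (s : Pt d) (φ ψ : Spinor d),
      ‖∫ x, inner ℂ (φ x) (χ (x + s) • symbolOp B f ((weightOp s)^[M] ψ) x)‖ ≤
        C * (‖toHilb φ‖ ^ 2 + ‖toHilb ψ‖ ^ 2) := by
  induction M with
  | zero => exact fun χ f hf => exists_local_bound χ hf B
  | succ M ih =>
    intro χ f hf
    have hf₁ (μ : Fin d) := hf.symbolDeriv B (EuclideanSpace.single μ 1)
    have hf₂ (μ : Fin d) := (hf₁ μ).symbolDeriv B (EuclideanSpace.single μ 1)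
    obtain ⟨χ₀, χ₁, hexpand⟩ := exists_schwartz_smul_symbolOp_weightOp_eq (B := B) χ
    obtain ⟨C₀, hC₀⟩ := ih χ₀ f hf
    choose C₁ hC₁ using fun μ => ih (χ₁ μ) _ (hf₁ μ)
    choose C₂ hC₂ using fun μ => ih χ _ (hf₂ μ)
    refine ⟨C₀ + ∑ μ, (C₁ μ + C₂ μ), fun s φ ψ => ?_⟩
    set ψ' := (weightOp s)^[M] ψ with hψ'
    have hint₀ := integrable_inner_localized (B := B) hf χ₀ s φ ψ'
    have hint₁ := fun μ => integrable_inner_localized (B := B) (hf₁ μ) (χ₁ μ) s φ ψ'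
    have hint₂ := fun μ => integrable_inner_localized (B := B) (hf₂ μ) χ s φ ψ'
    have hint := fun (μ : Fin d) (_ : μ ∈ Finset.univ) => (hint₁ μ).add (hint₂ μ)
    simp only [Pi.add_def] at hint
    simp_rw [Function.iterate_succ_apply', ← hψ', hexpand hf, inner_add_right, inner_sum,
      inner_add_right]
    rw [integral_add hint₀ (integrable_finsetSum _ hint), integral_finsetSum _ hint, add_mul,
      Finset.sum_mul]
    refine (norm_add_le _ _).trans (add_le_add (hC₀ s φ ψ) ((norm_sum_le _ _).trans
      (Finset.sum_le_sum fun μ _ => ?_)))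
    rw [integral_add (hint₁ μ) (hint₂ μ), add_mul]
    exact (norm_add_le _ _).trans (add_le_add (hC₁ μ s φ ψ) (hC₂ μ s φ ψ))

end Weights

section CalderonVaillancourt

variable {d : ℕ} {f g : Pt d → ℂ}

theorem norm_toHilb_smulLeftCLM_sq (hg : g.HasTemperateGrowth) (ψ : Spinor d) :
    ‖toHilb (SchwartzMap.smulLeftCLM (Fock d) g ψ)‖ ^ 2 = ∫ x, ‖g x‖ ^ 2 * ‖ψ x‖ ^ 2 := by
  rw [norm_toHilb_sq]
  congr 1 with x
  rw [SchwartzMap.smulLeftCLM_apply_apply hg, norm_smul, mul_pow]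

theorem hasTemperateGrowth_translate (hg : g.HasTemperateGrowth) (s : Pt d) :
    Function.HasTemperateGrowth fun x => g (x + s) :=
  hg.comp (by fun_prop)

theorem integrable_norm_toHilb_translate_smul_sq (hg : g.HasTemperateGrowth)
    (hint : Integrable fun x => ‖g x‖ ^ 2) (ψ : Spinor d) :
    Integrable fun s =>
      ‖toHilb (SchwartzMap.smulLeftCLM (Fock d) (fun x => g (x + s)) ψ)‖ ^ 2 := by
  simp_rw [norm_toHilb_smulLeftCLM_sq (hasTemperateGrowth_translate hg _)]
  exact (integrable_add_mul hint (integrable_norm_sq ψ)).integral_prod_left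

theorem integral_norm_toHilb_translate_smul_sq (hg : g.HasTemperateGrowth)
    (hint : Integrable fun x => ‖g x‖ ^ 2) (ψ : Spinor d) :
    ∫ s, ‖toHilb (SchwartzMap.smulLeftCLM (Fock d) (fun x => g (x + s)) ψ)‖ ^ 2 =
      (∫ x, ‖g x‖ ^ 2) * ‖toHilb ψ‖ ^ 2 := by
  simp_rw [norm_toHilb_smulLeftCLM_sq (hasTemperateGrowth_translate hg _)]
  rw [integral_integral_add_mul hint (integrable_norm_sq ψ), norm_toHilb_sq]

theorem exists_schwartz_integral_norm_sq_pos :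
    ∃ χ : 𝓢(Pt d, ℂ), Integrable (fun x => ‖χ x‖ ^ 2) ∧ 0 < ∫ x, ‖χ x‖ ^ 2 := by
  let χ : 𝓢(Pt d, ℂ) := SchwartzMap.postcompCLM (𝕜 := ℝ) Complex.ofRealCLM (gaussian 1 one_pos)
  have hχ : χ 0 = ((Real.exp (-1 * ‖(0 : Pt d)‖ ^ 2) : ℝ) : ℂ) := rfl
  have hint : Integrable fun x => ‖χ x‖ ^ 2 :=
    (χ.memLp 2 volume).integrable_norm_pow (by norm_num)
  exact ⟨χ, hint, integral_pos_of_integrable_nonneg_nonzero (x := 0)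
    (χ.continuous.norm.pow 2) hint (fun x => sq_nonneg _) (by simp [hχ])⟩

theorem exists_inverse_weight (d : ℕ) :
    ∃ u : Pt d → ℂ, u.HasTemperateGrowth ∧ Integrable (fun x => ‖u x‖ ^ 2) ∧
      ∀ x, ((1 + ‖x‖ ^ 2) ^ (d + 1)) • u x = 1 := by
  refine ⟨fun x => (((1 + ‖x‖ ^ 2) ^ (-((d + 1 : ℕ) : ℝ)) : ℝ) : ℂ),
    Complex.ofRealCLM.hasTemperateGrowth.comp
      (Function.hasTemperateGrowth_one_add_norm_sq_rpow _ _), ?_, fun x => ?_⟩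
  · have hint := integrable_rpow_neg_one_add_norm_sq (E := Pt d) (μ := volume)
      (r := 4 * ((d + 1 : ℕ) : ℝ)) (by
        rw [finrank_euclideanSpace, Fintype.card_fin]
        push_cast
        linarith [d.cast_nonneg (α := ℝ)])
    refine hint.congr (ae_of_all _ fun x => ?_)
    have hpos : 0 < 1 + ‖x‖ ^ 2 := by positivity
    simp only [Complex.norm_real, Real.norm_eq_abs, sq_abs]
    rw [← Real.rpow_natCast (_ ^ _), ← Real.rpow_mul hpos.le]
    congr 1
    push_cast
    ring
  · have hpos : 0 < 1 + ‖x‖ ^ 2 := by positivity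
    rw [Complex.real_smul, ← Complex.ofReal_mul, Real.rpow_neg hpos.le, Real.rpow_natCast,
      mul_inv_cancel₀ (by positivity), Complex.ofReal_one]

theorem integral_norm_sq_mul_inner_eq (χ : 𝓢(Pt d, ℂ)) (s : Pt d) (φ : Spinor d)
    (Φ : Pt d → Fock d) :
    ∫ x, ((‖χ (x + s)‖ ^ 2 : ℝ) : ℂ) * inner ℂ (φ x) (Φ x) =
      ∫ x, inner ℂ (SchwartzMap.smulLeftCLM (Fock d) (fun x => χ (x + s)) φ x)
        (χ (x + s) • Φ x) := by
  congr 1 with x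
  rw [SchwartzMap.smulLeftCLM_apply_apply (hasTemperateGrowth_translate χ.hasTemperateGrowth s),
    inner_smul_left, inner_smul_right, ← mul_assoc, mul_comm ((starRingEnd ℂ) _),
    Complex.mul_conj, Complex.normSq_eq_norm_sq]

theorem integral_norm_sq_mul_norm_integral_inner_le (χ : 𝓢(Pt d, ℂ))
    (hχ : Integrable fun x => ‖χ x‖ ^ 2) {φ : Spinor d} {Φ : Pt d → Fock d}
    (hΦ : Integrable fun x => inner ℂ (φ x) (Φ x)) {F : Pt d → ℝ} (hF : Integrable F)
    (hle : ∀ s, ‖∫ x, inner ℂ (SchwartzMap.smulLeftCLM (Fock d) (fun x => χ (x + s)) φ x)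
      (χ (x + s) • Φ x)‖ ≤ F s) :
    (∫ x, ‖χ x‖ ^ 2) * ‖∫ x, inner ℂ (φ x) (Φ x)‖ ≤ ∫ s, F s := by
  have hχc : Integrable fun x => ((‖χ x‖ ^ 2 : ℝ) : ℂ) := hχ.ofReal
  have hnorm : ‖((∫ x, ‖χ x‖ ^ 2 : ℝ) : ℂ)‖ = ∫ x, ‖χ x‖ ^ 2 := by
    rw [Complex.norm_real, Real.norm_of_nonneg (integral_nonneg fun x => sq_nonneg _)]
  rw [← hnorm, ← norm_mul, ← integral_complex_ofReal, ← integral_integral_add_mul hχc hΦ]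
  refine norm_integral_le_of_norm_le hF (ae_of_all _ fun s => ?_)
  rw [integral_norm_sq_mul_inner_eq]
  exact hle s

/- The local bounds are averaged over all translates of the window `χ`. Integrability of the
average in the second argument costs the weight `(1 + |x + s|²) ^ (d + 1)`, which `weightOp`
provides. -/
theorem exists_quadratic_bound (hf : IsSmoothBounded f) (B : Pt d →L[ℝ] Pt d) :
    ∃ C, 0 ≤ C ∧ ∀ φ ψ : Spinor d, ‖∫ x, inner ℂ (φ x) (symbolOp B f ψ x)‖ ≤
      C * (‖toHilb φ‖ ^ 2 + ‖toHilb ψ‖ ^ 2) := by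
  obtain ⟨χ, hχint, hκ⟩ := exists_schwartz_integral_norm_sq_pos (d := d)
  obtain ⟨u, hu, huint, hweight⟩ := exists_inverse_weight d
  obtain ⟨C, hC⟩ := exists_weighted_local_bound B (d + 1) χ f hf
  set κ := ∫ x, ‖χ x‖ ^ 2
  set κ' := ∫ x, ‖u x‖ ^ 2
  have hκ' : 0 ≤ κ' := integral_nonneg fun x => sq_nonneg _
  refine ⟨κ⁻¹ * (|C| * (κ + κ')), by positivity, fun φ ψ => ?_⟩
  have hdivide (s : Pt d) : (weightOp s)^[d + 1]
      (SchwartzMap.smulLeftCLM (Fock d) (fun x => u (x + s)) ψ) = ψ := by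
    ext1 x
    rw [weightOp_iterate_apply,
      SchwartzMap.smulLeftCLM_apply_apply (hasTemperateGrowth_translate hu s), ← smul_assoc,
      hweight, one_smul]
  have hφint := integrable_norm_toHilb_translate_smul_sq χ.hasTemperateGrowth hχint φ
  have hψint := integrable_norm_toHilb_translate_smul_sq hu huint ψ
  have haverage := integral_norm_sq_mul_norm_integral_inner_le χ hχint
    (integrable_inner_symbolOp hf φ ψ)
    ((hφint.add hψint).const_mul |C|) fun s => by
      have hlocal := hC s (SchwartzMap.smulLeftCLM (Fock d) (fun x => χ (x + s)) φ)
        (SchwartzMap.smulLeftCLM (Fock d) (fun x => u (x + s)) ψ)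
      rw [hdivide] at hlocal
      exact hlocal.trans (mul_le_mul_of_nonneg_right (le_abs_self C) (by positivity))
  simp only [Pi.add_apply] at haverage
  rw [integral_const_mul, integral_add hφint hψint,
    integral_norm_toHilb_translate_smul_sq χ.hasTemperateGrowth hχint φ,
    integral_norm_toHilb_translate_smul_sq hu huint ψ] at haverage
  rw [mul_assoc, ← div_eq_inv_mul, le_div_iff₀ hκ, mul_comm, mul_assoc]
  refine haverage.trans (mul_le_mul_of_nonneg_left ?_ (abs_nonneg C))
  nlinarith [mul_nonneg hκ.le (sq_nonneg ‖toHilb ψ‖), mul_nonneg hκ' (sq_nonneg ‖toHilb φ‖)]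

end CalderonVaillancourt

/-! ### The bounded operators with symbol `f (x + B ξ)` -/

section LinearBounds

variable {𝕜 E F G : Type*} [RCLike 𝕜] [NormedAddCommGroup E] [InnerProductSpace 𝕜 E]

/- Testing against `t • v` gives a quadratic inequality in `t`, whose discriminant is the claim. -/
theorem norm_le_of_forall_norm_inner_le_add_sq {v : E} {b C : ℝ} (hb : 0 ≤ b) (hC : 0 ≤ C)
    (h : ∀ w : E, ‖inner 𝕜 w v‖ ≤ C * (‖w‖ ^ 2 + b ^ 2)) : ‖v‖ ≤ 2 * C * b := by
  have hdiscrim : discrim (C * ‖v‖ ^ 2) (-‖v‖ ^ 2) (C * b ^ 2) ≤ 0 := by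
    refine discrim_le_zero fun t => ?_
    have ht := h ((t : 𝕜) • v)
    rw [inner_smul_left, norm_mul, RCLike.norm_conj, norm_smul, inner_self_eq_norm_sq_to_K,
      norm_pow, RCLike.norm_ofReal, RCLike.norm_ofReal, abs_norm, mul_pow, sq_abs] at ht
    nlinarith [mul_le_mul_of_nonneg_right (le_abs_self t) (sq_nonneg ‖v‖)]
  rcases (norm_nonneg v).eq_or_lt with hv | hv
  · rw [← hv]
    positivity
  refine le_of_sq_le_sq ?_ (by positivity)
  rw [discrim] at hdiscrim
  exact le_of_mul_le_mul_left (by linarith) (pow_pos hv 2)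

variable [NormedAddCommGroup F] [NormedSpace ℝ F] [NormedAddCommGroup G] [NormedSpace ℝ G]
  {α : Type*} [MeasurableSpace α] {ν : Measure α}

theorem hasLineDerivAt_integral_of_dominated {g g' : F → α → G} {bound : α → ℝ} {v : F}
    (hg : ∀ x, Integrable (g x) ν) (hg' : ∀ x, AEStronglyMeasurable (g' x) ν)
    (hbound : ∀ x a, ‖g' x a‖ ≤ bound a) (hint : Integrable bound ν)
    (hderiv : ∀ x a, HasLineDerivAt ℝ (g · a) (g' x a) x v) (x : F) :
    HasLineDerivAt ℝ (fun x => ∫ a, g x a ∂ν) (∫ a, g' x a ∂ν) x v := by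
  have hline (a : α) (t : ℝ) : HasDerivAt (fun t => g (x + t • v) a) (g' (x + t • v) a) t := by
    have hzero := hderiv (x + t • v) a
    rw [HasLineDerivAt, ← sub_self t] at hzero
    simpa [add_assoc, ← add_smul] using hzero.comp_sub_const t t
  have hintegral := (hasDerivAt_integral_of_dominated_loc_of_deriv_le (s := Set.univ)
    (x₀ := (0 : ℝ)) Filter.univ_mem (.of_forall fun t => (hg (x + t • v)).aestronglyMeasurable)
    (hg _) (hg' _) (ae_of_all _ fun a t _ => hbound (x + t • v) a) hint
    (ae_of_all _ fun a t _ => hline a t)).2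
  rwa [zero_smul, add_zero] at hintegral

end LinearBounds

section BoundedSymbolOp

open FourierTransform

variable {d : ℕ} {B : Pt d →L[ℝ] Pt d} {f : Pt d → ℂ}

theorem norm_le_sum_abs (x : Pt d) : ‖x‖ ≤ ∑ μ, |x μ| := by
  conv_lhs => rw [← (EuclideanSpace.basisFun (Fin d) ℝ).sum_repr x]
  refine (norm_sum_le _ _).trans (Finset.sum_le_sum fun μ _ => ?_)
  rw [norm_smul, OrthonormalBasis.norm_eq_one, mul_one, EuclideanSpace.basisFun_repr,
    Real.norm_eq_abs]

theorem exists_pow_mul_norm_symbolOp_le (B : Pt d →L[ℝ] Pt d) (n : ℕ) :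
    ∀ (f : Pt d → ℂ), IsSmoothBounded f → ∀ ψ : Spinor d,
      ∃ C, ∀ x, ‖x‖ ^ n * ‖symbolOp B f ψ x‖ ≤ C := by
  induction n with
  | zero => exact fun f hf ψ => by simpa using exists_norm_symbolOp_le hf B ψ
  | succ n ih =>
    intro f hf ψ
    choose C hC using fun μ => ih f hf (positionOp μ ψ)
    choose K hK using fun μ => ih _ (hf.symbolDeriv B (EuclideanSpace.single μ 1)) ψ
    refine ⟨∑ μ, (C μ + K μ), fun x => ?_⟩
    calc ‖x‖ ^ (n + 1) * ‖symbolOp B f ψ x‖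
        = ‖x‖ * (‖x‖ ^ n * ‖symbolOp B f ψ x‖) := by ring
      _ ≤ (∑ μ, |x μ|) * (‖x‖ ^ n * ‖symbolOp B f ψ x‖) :=
        mul_le_mul_of_nonneg_right (norm_le_sum_abs x) (by positivity)
      _ = ∑ μ, ‖x‖ ^ n * ‖((x μ : ℝ) : ℂ) • symbolOp B f ψ x‖ := by
        rw [Finset.sum_mul]
        refine Finset.sum_congr rfl fun μ _ => ?_
        rw [norm_smul, Complex.norm_real, Real.norm_eq_abs]
        ring
      _ ≤ ∑ μ, (C μ + K μ) := Finset.sum_le_sum fun μ _ => by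
        rw [eq_sub_of_add_eq (symbolOp_positionOp (B := B) hf μ ψ x).symm]
        refine (mul_le_mul_of_nonneg_left (norm_sub_le _ _) (by positivity)).trans ?_
        rw [mul_add]
        exact add_le_add (hC μ x) (hK μ x)

theorem memLp_symbolOp (hf : IsSmoothBounded f) (B : Pt d →L[ℝ] Pt d) (ψ : Spinor d) :
    MemLp (symbolOp B f ψ) 2 (volume : Measure (Pt d)) := by
  have hmeas := (continuous_symbolOp (B := B) hf ψ).aestronglyMeasurable (μ := volume)
  rw [memLp_two_iff_integrable_sq_norm hmeas]
  obtain ⟨C, hC⟩ := exists_norm_symbolOp_le hf B ψ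
  set l := (volume : Measure (Pt d)).integrablePower
  obtain ⟨K, hK⟩ := exists_pow_mul_norm_symbolOp_le B l f hf ψ
  have hbounded (x : Pt d) : ‖‖symbolOp B f ψ x‖ ^ 2‖ ≤ C * C := by
    rw [norm_pow, norm_norm, sq]
    exact mul_le_mul (hC x) (hC x) (norm_nonneg _) ((norm_nonneg _).trans (hC x))
  have hdecay (x : Pt d) : ‖x‖ ^ (0 + l) * ‖‖symbolOp B f ψ x‖ ^ 2‖ ≤ K * C := by
    rw [norm_pow, norm_norm, sq, zero_add, ← mul_assoc]
    exact mul_le_mul (hK x) (hC x) (norm_nonneg _)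
      ((mul_nonneg (by positivity) (norm_nonneg _)).trans (hK x))
  simpa using integrable_of_le_of_pow_mul_le hbounded hdecay (hmeas.norm.pow 2)

/-- `T` is the pseudodifferential operator with symbol `f (x + B ξ)`: the bounded operator on
`L²` which agrees with `symbolOp B f` on Schwartz spinors. -/
def IsSymbolOp (B : Pt d →L[ℝ] Pt d) (f : Pt d → ℂ) (T : Hilb d →L[ℂ] Hilb d) : Prop :=
  ∀ ψ : Spinor d, T (toHilb ψ) =ᵐ[volume] symbolOp B f ψ

theorem inner_toHilb_eq_integral (φ : Spinor d) {v : Hilb d} {g : Pt d → Fock d}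
    (h : v =ᵐ[volume] g) : inner ℂ (toHilb φ) v = ∫ x, inner ℂ (φ x) (g x) := by
  rw [L2.inner_def]
  refine integral_congr_ae ?_
  filter_upwards [coeFn_toHilb φ, h] with x hφ hv
  rw [hφ, hv]

theorem exists_isSymbolOp (hf : IsSmoothBounded f) (B : Pt d →L[ℝ] Pt d) :
    ∃ T, IsSymbolOp B f T := by
  let S : Spinor d →ₗ[ℂ] Hilb d :=
    { toFun := fun ψ => (memLp_symbolOp hf B ψ).toLp _
      map_add' := fun ψ₁ ψ₂ => by
        rw [← MemLp.toLp_add]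
        exact MemLp.toLp_congr _ _ (ae_of_all _ fun x => symbolOp_add hf ψ₁ ψ₂ x)
      map_smul' := fun c ψ => by
        rw [RingHom.id_apply, ← MemLp.toLp_const_smul]
        exact MemLp.toLp_congr _ _ (ae_of_all _ fun x => symbolOp_smul c ψ x) }
  have hS (ψ : Spinor d) : S ψ =ᵐ[volume] symbolOp B f ψ :=
    MemLp.coeFn_toLp (memLp_symbolOp hf B ψ)
  obtain ⟨C, hC₀, hC⟩ := exists_quadratic_bound hf B
  have hquad (v : Hilb d) (ψ : Spinor d) :
      ‖inner ℂ v (S ψ)‖ ≤ C * (‖v‖ ^ 2 + ‖toHilb ψ‖ ^ 2) := by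
    refine denseRange_toHilb.induction_on v
      (isClosed_le (by fun_prop) (by fun_prop)) fun φ => ?_
    rw [inner_toHilb_eq_integral φ (hS ψ)]
    exact hC φ ψ
  have hbound (ψ : Spinor d) : ‖S ψ‖ ≤ 2 * C * ‖toHilb ψ‖ :=
    norm_le_of_forall_norm_inner_le_add_sq (norm_nonneg _) hC₀ fun v => hquad v ψ
  refine ⟨S.extendOfNorm toHilb, fun ψ => ?_⟩
  rw [LinearMap.extendOfNorm_eq denseRange_toHilb ⟨_, hbound⟩]
  exact hS ψ

variable {T : Hilb d →L[ℂ] Hilb d}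

theorem IsSymbolOp.inner_toHilb (h : IsSymbolOp B f T) (φ ψ : Spinor d) :
    inner ℂ (toHilb φ) (T (toHilb ψ)) = ∫ x, inner ℂ (φ x) (symbolOp B f ψ x) :=
  inner_toHilb_eq_integral φ (h ψ)

theorem IsSymbolOp.fiberHilb_apply (h : IsSymbolOp B f T) (hf : IsSmoothBounded f)
    (M : Fock d →L[ℂ] Fock d) (v : Hilb d) : fiberHilb M (T v) = T (fiberHilb M v) := by
  refine denseRange_toHilb.induction_on v (isClosed_eq (by fun_prop) (by fun_prop)) fun ψ => ?_
  rw [← toHilb_fiberOp]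
  apply Lp.ext
  filter_upwards [h ψ, h (fiberOp M ψ),
    ContinuousLinearMap.coeFn_compLpL (p := 2) (μ := volume) M (T (toHilb ψ))] with x hT hTM hM
  rw [hTM, symbolOp_fiberOp hf, ← hT]
  exact hM

theorem IsSymbolOp.const_smul (h : IsSymbolOp B f T) (c : ℂ) :
    IsSymbolOp B (fun x => c • f x) (c • T) := by
  intro ψ
  rw [smul_apply]
  filter_upwards [h ψ, Lp.coeFn_smul c (T (toHilb ψ))] with x hT hc
  rw [hc, Pi.smul_apply, hT, symbolOp_const_smul]

theorem IsSymbolOp.isWeakCommutator_positionOp (h : IsSymbolOp B f T)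
    (hf : IsSmoothBounded f) (μ : Fin d) {T' : Hilb d →L[ℂ] Hilb d}
    (h' : IsSymbolOp B (symbolDeriv B (EuclideanSpace.single μ 1) f) T') :
    IsWeakCommutator toHilb (positionOp μ).toLinearMap T (-T') := by
  intro φ ψ
  rw [neg_apply, inner_neg_right]
  change inner ℂ (toHilb (positionOp μ φ)) _ - inner ℂ _ (T (toHilb (positionOp μ ψ))) = _
  rw [h.inner_toHilb, h.inner_toHilb, h'.inner_toHilb,
    ← integral_sub (integrable_inner_symbolOp hf _ _) (integrable_inner_symbolOp hf _ _),
    ← integral_neg]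
  congr 1 with x
  rw [symbolOp_positionOp hf, positionOp_apply, inner_smul_left, inner_add_right,
    inner_smul_right, Complex.conj_ofReal]
  ring

theorem fourier_partialOp (μ : Fin d) (ψ : Spinor d) (ξ : Pt d) :
    𝓕 (partialOp μ ψ) ξ = (2 * Real.pi * Complex.I *
      ((inner ℝ ξ (EuclideanSpace.single μ (1 : ℝ)) : ℝ) : ℂ)) • 𝓕 ψ ξ := by
  have h : 𝓕 (partialOp μ ψ) = _ := SchwartzMap.fourier_lineDerivOp_eq ψ (EuclideanSpace.single μ 1)
  rw [h, smul_apply, SchwartzMap.smulLeftCLM_apply_apply (by fun_prop),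
    mul_smul (2 * Real.pi * Complex.I)]
  congr 1

theorem hasLineDerivAt_symbolOp_integrand (hf : Differentiable ℝ f) (μ : Fin d) (ψ : Spinor d)
    (x ξ : Pt d) :
    HasLineDerivAt ℝ (fun x => Real.fourierChar (inner ℝ ξ x) • f (x + B ξ) • 𝓕 ψ ξ)
      (Real.fourierChar (inner ℝ ξ x) • f (x + B ξ) • 𝓕 (partialOp μ ψ) ξ +
        Real.fourierChar (inner ℝ ξ x) •
          fderiv ℝ f (x + B ξ) (EuclideanSpace.single μ 1) • 𝓕 ψ ξ) x
      (EuclideanSpace.single μ 1) := by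
  set m : Pt d := EuclideanSpace.single μ (1 : ℝ)
  have hphase : HasLineDerivAt ℝ (fun x => inner ℝ ξ x) (inner ℝ ξ m) x m :=
    (innerSL ℝ ξ).hasFDerivAt.hasLineDerivAt m
  have hchar : HasLineDerivAt ℝ (fun x => (Real.fourierChar (inner ℝ ξ x) : ℂ))
      ((2 * Real.pi * Complex.I * ((inner ℝ ξ m : ℝ) : ℂ)) * Real.fourierChar (inner ℝ ξ x))
      x m := by
    refine ((Real.hasDerivAt_fourierChar _).scomp 0 hphase).congr_deriv ?_
    rw [Complex.real_smul, zero_smul, add_zero]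
    ring
  have hsymbol : HasLineDerivAt ℝ (fun x => f (x + B ξ)) (fderiv ℝ f (x + B ξ) m) x m :=
    ((hf _).hasFDerivAt.comp x ((hasFDerivAt_id x).add_const _)).hasLineDerivAt m
  have hprod := (HasDerivAt.mul hchar hsymbol).smul_const (𝓕 ψ ξ)
  rw [fourier_partialOp]
  simp only [Circle.smul_def, smul_smul]
  refine HasDerivAt.congr_deriv hprod ?_
  simp only [zero_smul, add_zero]
  module

theorem hasLineDerivAt_symbolOp (hf : IsSmoothBounded f) (μ : Fin d) (ψ : Spinor d) (x : Pt d) :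
    HasLineDerivAt ℝ (symbolOp B f ψ) (symbolOp B f (partialOp μ ψ) x +
      symbolOp B (fun y => fderiv ℝ f y (EuclideanSpace.single μ 1)) ψ x) x
      (EuclideanSpace.single μ 1) := by
  have hf' := hf.fderiv_apply (EuclideanSpace.single μ 1)
  obtain ⟨C, hC⟩ := hf.exists_norm_symbolOp_integrand_le B (partialOp μ ψ)
  obtain ⟨C', hC'⟩ := hf'.exists_norm_symbolOp_integrand_le B ψ
  have hint := fun y => integrable_symbolOp_integrand (B := B) hf (partialOp μ ψ) y
  have hint' := fun y => integrable_symbolOp_integrand (B := B) hf' ψ y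
  have hderiv := hasLineDerivAt_integral_of_dominated
    (fun y => integrable_symbolOp_integrand (B := B) hf ψ y)
    (fun y => ((hint y).add (hint' y)).aestronglyMeasurable)
    (fun y ξ => (norm_add_le _ _).trans (add_le_add (hC y ξ) (hC' y ξ)))
    (((𝓕 (partialOp μ ψ)).integrable.norm.const_mul C).add ((𝓕 ψ).integrable.norm.const_mul C'))
    (fun y ξ => hasLineDerivAt_symbolOp_integrand hf.differentiable μ ψ y ξ) x
  simp only [Pi.add_apply] at hderiv
  rwa [integral_add (hint x) (hint' x)] at hderiv

theorem IsSymbolOp.inner_partialOp_add_inner (h : IsSymbolOp B f T)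
    (hf : IsSmoothBounded f) (μ : Fin d) {T' : Hilb d →L[ℂ] Hilb d}
    (h' : IsSymbolOp B (fun y => fderiv ℝ f y (EuclideanSpace.single μ 1)) T') (φ ψ : Spinor d) :
    inner ℂ (toHilb (partialOp μ φ)) (T (toHilb ψ)) +
      inner ℂ (toHilb φ) (T (toHilb (partialOp μ ψ))) =
      -inner ℂ (toHilb φ) (T' (toHilb ψ)) := by
  have hint := integrable_inner_symbolOp (B := B) hf
  have hint' := integrable_inner_symbolOp (B := B) (hf.fderiv_apply (EuclideanSpace.single μ 1))
  have hsum : Integrable fun x => inner ℂ (φ x) (symbolOp B f (partialOp μ ψ) x +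
      symbolOp B (fun y => fderiv ℝ f y (EuclideanSpace.single μ 1)) ψ x) := by
    simp only [inner_add_right]
    exact (hint φ (partialOp μ ψ)).add (hint' φ ψ)
  have hparts := integral_bilinear_hasLineDerivAt_right_eq_neg_left_of_integrable (μ := volume)
    (B := (isBoundedBilinearMap_inner (𝕜 := ℂ) (E := Fock d)).toContinuousLinearMap)
    (f := φ) (f' := partialOp μ φ) (g := symbolOp B f ψ) (v := EuclideanSpace.single μ (1 : ℝ))
    (hint (partialOp μ φ) ψ) hsum (hint φ ψ)
    (fun x _ => (partialOp_apply μ φ x) ▸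
      φ.differentiableAt.hasFDerivAt.hasLineDerivAt (EuclideanSpace.single μ (1 : ℝ)))
    (fun x _ => hasLineDerivAt_symbolOp hf μ ψ x)
  change ∫ x, inner ℂ (φ x) (symbolOp B f (partialOp μ ψ) x +
      symbolOp B (fun y => fderiv ℝ f y (EuclideanSpace.single μ 1)) ψ x) =
    -∫ x, inner ℂ (partialOp μ φ x) (symbolOp B f ψ x) at hparts
  simp only [inner_add_right] at hparts
  rw [integral_add (hint _ _) (hint' _ _)] at hparts
  rw [h.inner_toHilb, h.inner_toHilb, h'.inner_toHilb]
  linear_combination hparts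

end BoundedSymbolOp

/-! ### Regularity of left Moyal multiplication -/

section Moyal

open FourierTransform

variable {d : ℕ}

theorem integral_exp_smul_translate (ψ : Spinor d) (x ξ : Pt d) :
    ∫ y : Pt d, Complex.exp (Complex.I * ((inner ℝ (-(2 * Real.pi) • ξ) y : ℝ) : ℂ)) • ψ (x + y) =
      (Real.fourierChar (inner ℝ ξ x) : ℂ) • 𝓕 ψ ξ := by
  rw [SchwartzMap.fourier_coe, Real.fourier_eq', ← integral_smul]
  refine Eq.trans ?_ (integral_add_left_eq_self _ x)
  congr 1 with y : 1
  rw [smul_smul, Real.fourierChar_apply, ← Complex.exp_add]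
  congr 2
  rw [real_inner_smul_left, inner_add_left, real_inner_comm y ξ, real_inner_comm x ξ]
  push_cast
  ring

/- Substituting `k = -2πξ` turns the inner integral into the Fourier transform. -/
theorem moyal_eq_symbolOp (Θ : Matrix (Fin d) (Fin d) ℝ) (f : Pt d → ℂ) (ψ : Spinor d) :
    moyal Θ f ψ =
      symbolOp ((-Real.pi) • (Matrix.toEuclideanLin Θ).toContinuousLinearMap) f ψ := by
  ext1 x
  have hsubst := Measure.integral_comp_smul (volume : Measure (Pt d))
    (fun k => f (x + (2⁻¹ : ℝ) • Matrix.toEuclideanLin Θ k) •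
      ∫ y : Pt d, Complex.exp (Complex.I * ((inner ℝ k y : ℝ) : ℂ)) • ψ (x + y)) (-(2 * Real.pi))
  have hjacobian : |((-(2 * Real.pi)) ^ Module.finrank ℝ (Pt d))⁻¹| = ((2 * Real.pi) ^ d)⁻¹ := by
    rw [finrank_euclideanSpace_fin, abs_inv, abs_pow, abs_neg, abs_of_pos (by positivity)]
  rw [hjacobian] at hsubst
  rw [moyal, ← hsubst, symbolOp]
  congr 1 with ξ : 1
  have hpoint : x + (2⁻¹ : ℝ) • Matrix.toEuclideanLin Θ (-(2 * Real.pi) • ξ) =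
      x + ((-Real.pi) • (Matrix.toEuclideanLin Θ).toContinuousLinearMap) ξ := by
    rw [map_smul, smul_smul, smul_apply, LinearMap.coe_toContinuousLinearMap']
    congr 2
    ring
  rw [hpoint, integral_exp_smul_translate, smul_comm]
  rfl

end Moyal

section Regularity

variable {d : ℕ} {B : Pt d →L[ℝ] Pt d} {f : Pt d → ℂ} {T : Hilb d →L[ℂ] Hilb d}

theorem IsSymbolOp.exists_isWeakCommutator_gen (h : IsSymbolOp B f T) (hf : IsSmoothBounded f)
    (Ω : ℝ) (k : Fin d ⊕ Fin d) : ∃ f' T', IsSmoothBounded f' ∧ IsSymbolOp B f' T' ∧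
      IsWeakCommutator toHilb (gen Ω k).toLinearMap T T' := by
  rcases k with μ | μ
  · have hf' := hf.fderiv_apply (EuclideanSpace.single μ 1)
    obtain ⟨T', h'⟩ := exists_isSymbolOp hf' B
    refine ⟨_, _, hf'.const_smul (-Complex.I), h'.const_smul (-Complex.I), fun φ ψ => ?_⟩
    change inner ℂ (toHilb ((-Complex.I) • partialOp μ φ)) _ -
      inner ℂ _ (T (toHilb ((-Complex.I) • partialOp μ ψ))) = _
    rw [map_smul, map_smul, map_smul, smul_apply, inner_smul_left, inner_smul_right,
      inner_smul_right, map_neg, Complex.conj_I]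
    linear_combination Complex.I * h.inner_partialOp_add_inner hf μ h' φ ψ
  · have hf' := hf.symbolDeriv B (EuclideanSpace.single μ 1)
    obtain ⟨T', h'⟩ := exists_isSymbolOp hf' B
    refine ⟨_, _, hf'.const_smul (-Ω : ℂ), h'.const_smul (-Ω : ℂ), fun φ ψ => ?_⟩
    have hposition := h.isWeakCommutator_positionOp hf μ h' φ ψ
    rw [neg_apply, inner_neg_right] at hposition
    change inner ℂ (toHilb (positionOp μ φ)) _ -
      inner ℂ _ (T (toHilb (positionOp μ ψ))) = _ at hposition
    change inner ℂ (toHilb ((Ω : ℂ) • positionOp μ φ)) _ -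
      inner ℂ _ (T (toHilb ((Ω : ℂ) • positionOp μ ψ))) = _
    rw [map_smul, map_smul, map_smul, smul_apply, inner_smul_left, inner_smul_right,
      inner_smul_right, Complex.conj_ofReal]
    linear_combination (Ω : ℂ) * hposition

theorem fiberHilb_fiberHilb (M M' : Fock d →L[ℂ] Fock d) (v : Hilb d) :
    fiberHilb M (fiberHilb M' v) = fiberHilb (M * M') v := by
  refine denseRange_toHilb.induction_on v (isClosed_eq (by fun_prop) (by fun_prop)) fun ψ => ?_
  rw [← toHilb_fiberOp, ← toHilb_fiberOp, ← toHilb_fiberOp, fiberOp_fiberOp]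

theorem fiberHilb_sub (M M' : Fock d →L[ℂ] Fock d) (v : Hilb d) :
    fiberHilb (M - M') v = fiberHilb M v - fiberHilb M' v := by
  refine denseRange_toHilb.induction_on v (isClosed_eq (by fun_prop) (by fun_prop)) fun ψ => ?_
  rw [← toHilb_fiberOp, ← toHilb_fiberOp, ← toHilb_fiberOp, ← map_sub]
  rfl

theorem fiberHilb_one (v : Hilb d) : fiberHilb 1 v = v := by
  refine denseRange_toHilb.induction_on v (isClosed_eq (by fun_prop) (by fun_prop)) fun ψ => ?_
  rw [← toHilb_fiberOp]
  rfl

theorem inner_fiberHilb {M M' : Fock d →L[ℂ] Fock d}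
    (h : ∀ v w, inner ℂ (M v) w = inner ℂ v (M' w)) (φ : Spinor d) (v : Hilb d) :
    inner ℂ (toHilb (fiberOp M φ)) v = inner ℂ (toHilb φ) (fiberHilb M' v) := by
  refine denseRange_toHilb.induction_on v (isClosed_eq (by fun_prop) (by fun_prop)) fun ψ => ?_
  rw [← toHilb_fiberOp, inner_fiberOp h]

/-- The operators `T ⊗ M` with `T` the operator of a symbol `f (x + B ξ)` and `M` a matrix. Their
span contains such a `T` and its commutators with Dirac operators, and is closed under the
commutators that control smoothness with respect to `⟨D⟩⁻¹`. -/
def symbolFamily (B : Pt d →L[ℝ] Pt d) : Set (Hilb d →L[ℂ] Hilb d) :=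
  {S | ∃ f T M, IsSmoothBounded f ∧ IsSymbolOp B f T ∧ S = T * fiberHilb M}

theorem exists_isWeakCommutator_mem_symbolFamily (Ω : ℝ) {S : Hilb d →L[ℂ] Hilb d}
    (hS : S ∈ symbolFamily B) (k : Fin d ⊕ Fin d) :
    ∃ S' ∈ symbolFamily B, IsWeakCommutator toHilb (gen Ω k).toLinearMap S S' := by
  obtain ⟨f, T, M, hf, h, rfl⟩ := hS
  obtain ⟨f', T', hf', h', hweak⟩ := h.exists_isWeakCommutator_gen hf Ω k
  refine ⟨_, ⟨f', T', M, hf', h', rfl⟩, fun φ ψ => ?_⟩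
  change inner ℂ _ (T (fiberHilb M (toHilb ψ))) -
    inner ℂ _ (T (fiberHilb M (toHilb (gen Ω k ψ)))) = inner ℂ _ (T' (fiberHilb M (toHilb ψ)))
  rw [← toHilb_fiberOp, ← toHilb_fiberOp, fiberOp_gen]
  exact hweak φ (fiberOp M ψ)

theorem commutator_fiberHilb_mem_symbolFamily (P : Fock d →L[ℂ] Fock d) {S : Hilb d →L[ℂ] Hilb d}
    (hS : S ∈ symbolFamily B) : fiberHilb P * S - S * fiberHilb P ∈ symbolFamily B := by
  obtain ⟨f, T, M, hf, h, rfl⟩ := hS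
  refine ⟨f, T, P * M - M * P, hf, h, ?_⟩
  ext1 v
  change fiberHilb P (T (fiberHilb M v)) - T (fiberHilb M (fiberHilb P v)) =
    T (fiberHilb (P * M - M * P) v)
  rw [h.fiberHilb_apply hf, fiberHilb_fiberHilb, fiberHilb_fiberHilb, fiberHilb_sub, map_sub]

theorem IsSymbolOp.mem_symbolFamily (h : IsSymbolOp B f T) (hf : IsSmoothBounded f) :
    T ∈ symbolFamily B := by
  refine ⟨f, T, 1, hf, h, ?_⟩
  ext1 v
  exact congrArg T (fiberHilb_one v).symm

theorem IsSymbolOp.isWeakCommutator_diracOf (h : IsSymbolOp B f T) (hf : IsSmoothBounded f)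
    {Ω : ℝ} {Γ : Fin d ⊕ Fin d → Fock d →L[ℂ] Fock d} (hΓ : IsClifford Γ)
    {f' : Fin d ⊕ Fin d → Pt d → ℂ} {T' : Fin d ⊕ Fin d → Hilb d →L[ℂ] Hilb d}
    (hf' : ∀ k, IsSmoothBounded (f' k)) (h' : ∀ k, IsSymbolOp B (f' k) (T' k))
    (hweak : ∀ k, IsWeakCommutator toHilb (gen Ω k).toLinearMap T (T' k)) :
    IsWeakCommutator toHilb (diracOf Ω Γ).toLinearMap T (∑ k, T' k * fiberHilb (Γ k)) := by
  intro φ ψ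
  change inner ℂ (toHilb (diracOf Ω Γ φ)) _ - inner ℂ _ (T (toHilb (diracOf Ω Γ ψ))) = _
  rw [diracOf_apply, diracOf_apply, map_sum, map_sum, map_sum, sum_inner, inner_sum,
    ← Finset.sum_sub_distrib, sum_apply, inner_sum]
  refine Finset.sum_congr rfl fun k _ => ?_
  have hgen : inner ℂ (toHilb (gen Ω k (fiberOp (Γ k) φ))) (T (toHilb ψ)) -
      inner ℂ (toHilb (fiberOp (Γ k) φ)) (T (toHilb (gen Ω k ψ))) =
      inner ℂ (toHilb (fiberOp (Γ k) φ)) (T' k (toHilb ψ)) := hweak k (fiberOp (Γ k) φ) ψ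
  rwa [inner_fiberHilb (hΓ.symm k), inner_fiberHilb (hΓ.symm k), h.fiberHilb_apply hf,
    (h' k).fiberHilb_apply (hf' k), ← toHilb_fiberOp, fiberOp_gen] at hgen

theorem IsSymbolOp.regular (h : IsSymbolOp B f T) (hf : IsSmoothBounded f) {Ω : ℝ} (hΩ : 0 < Ω)
    {Γ : Fin d ⊕ Fin d → Fock d →L[ℂ] Fock d} (hΓ : IsClifford Γ) {D : Hilb d →ₗ.[ℂ] Hilb d}
    (hD : D = (ofCore (diracOf Ω Γ)).closure) :
    IsSelfAdjoint D ∧ (∃! A, IsBracket D A) ∧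
      ∃ C : Hilb d →L[ℂ] Hilb d, IsCommutator D T C ∧
        ∀ A, IsBracket D A → ∀ n : ℕ, MemDomDeltaPow A n T ∧ MemDomDeltaPow A n C := by
  have hosc := isOscillator_diracOf Ω hΓ (denseRange_diracOf_sq_add_one hΩ hΓ)
  rw [← hD] at hosc
  have hsmooth {S : Hilb d →L[ℂ] Hilb d} (hS : S ∈ Submodule.span ℂ (symbolFamily B)) :
      IsSmoothFor (bracketInv toHilb (diracOf Ω Γ).toLinearMap) S :=
    hosc.isSmoothFor_of_weak (fun S hS => exists_isWeakCommutator_mem_symbolFamily Ω hS)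
      (fun S hS => commutator_fiberHilb_mem_symbolFamily _ hS) hS
  choose f' T' hf' h' hweak using fun k => h.exists_isWeakCommutator_gen hf Ω k
  have hC : (∑ k, T' k * fiberHilb (Γ k)) ∈ Submodule.span ℂ (symbolFamily B) :=
    Submodule.sum_mem _ fun k _ => Submodule.subset_span ⟨f' k, T' k, Γ k, hf' k, h' k, rfl⟩
  have hT : T ∈ Submodule.span ℂ (symbolFamily B) :=
    Submodule.subset_span (h.mem_symbolFamily hf)
  exact ⟨hosc.isSelfAdjoint, hosc.existsUnique_isBracket, _,
    hosc.isCommutator_of_core (h.isWeakCommutator_diracOf hf hΓ hf' h' hweak), fun A hA n =>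
      ⟨hosc.memDomDeltaPow_of_isSmoothFor hA n (hsmooth hT),
        hosc.memDomDeltaPow_of_isSmoothFor hA n (hsmooth hC)⟩⟩

end Regularity

end MoyalOscillator

open MoyalOscillator in
theorem mainTheorem4_general {d : ℕ} (Θ : Matrix (Fin d) (Fin d) ℝ) {Ω : ℝ} (hΩ : 0 < Ω)
    {f : Pt d → ℂ} (hf : IsSmoothBounded f) :
    ∃ T : Hilb d →L[ℂ] Hilb d, IsLeftMoyal Θ f T ∧
      ∀ D ∈ ({dirac₁ Ω, dirac₂ Ω} : Set (Hilb d →ₗ.[ℂ] Hilb d)),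
        IsSelfAdjoint D ∧ (∃! A, IsBracket D A) ∧
        ∃ C : Hilb d →L[ℂ] Hilb d, IsCommutator D T C ∧
          ∀ A, IsBracket D A → ∀ n : ℕ, MemDomDeltaPow A n T ∧ MemDomDeltaPow A n C := by
  obtain ⟨T, hT⟩ := exists_isSymbolOp hf
    ((-Real.pi) • (Matrix.toEuclideanLin Θ).toContinuousLinearMap)
  refine ⟨T, fun ψ => ?_, ?_⟩
  · rw [moyal_eq_symbolOp]
    exact hT ψ
  rintro D (rfl | rfl)
  · exact hT.regular hf hΩ (isClifford_clifford (z₁ := Complex.I) (z₂ := 1) (by simp) (by simp)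
      (by simp)) (by rw [dirac₁, diracCore₁_eq])
  · exact hT.regular hf hΩ (isClifford_clifford (z₁ := -1) (z₂ := -Complex.I) (by simp) (by simp)
      (by simp)) (by rw [dirac₂, diracCore₂_eq])

open MoyalOscillator in
theorem mainTheorem4 {d : ℕ} (Θ : Matrix (Fin d) (Fin d) ℝ) (hΘ : Θ.transpose = -Θ)
    (hΘ' : IsUnit Θ.det) (Ω : ℝ) (hΩ : 0 < Ω) (f : Pt d → ℂ) (hf : IsSmoothBounded f) :
    ∃ T : Hilb d →L[ℂ] Hilb d, IsLeftMoyal Θ f T ∧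
      ∀ D ∈ ({dirac₁ Ω, dirac₂ Ω} : Set (Hilb d →ₗ.[ℂ] Hilb d)),
        IsSelfAdjoint D ∧ (∃! A, IsBracket D A) ∧
        ∃ C : Hilb d →L[ℂ] Hilb d, IsCommutator D T C ∧
          ∀ A, IsBracket D A → ∀ n : ℕ, MemDomDeltaPow A n T ∧ MemDomDeltaPow A n C :=
  mainTheorem4_general Θ hΩ hf
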